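/- **Setting.** Let $M$ be a simply connected (in particular connected) smooth manifold, $F,E\to M$ smooth real vector bundles of finite rank, and $l:F\to E$ a fibrewise surjective vector bundle map. An *$l$-connection* (relative connection) is a linear operator $D:\Gamma(F)\to\Omega^1(M,E)$ with $D_X(fs)=f\,D_Xs+(L_Xf)\,l(s)$; its space of solutions is $\mathrm{Sol}(F,D)=\{s\in\Gamma(F): Ds=0\}$. *Symbols.* Put $\mathfrak g=\mathfrak g^{(0)}=\ker l$ and let $\partial_D:\mathfrak g\to\mathrm{Hom}(TM,E)$ be the symbol map, $\partial_D(s(x))=D(s)(x)$ for sections $s$ of $\mathfrak g$. Fibrewise, $\mathfrak g^{(1)}$ is the space of linear maps $T:T_xM\to\mathfrak g_x$ with $\partial_D(Tu)v=\partial_D(Tv)u$ for all $u,v$, and, for $i\ge 1$, $\mathfrak g^{(i+1)}\subset S^{i+1}T^*M\otimes\mathfrak g$ is the space of symmetric $T$ with $T(u,\cdot,\dots,\cdot)\in\mathfrak g^{(i)}$ for all $u$. $D$ is of *finite type* if $\mathfrak g^{(k)}=0$ for some $k$; the smallest such $k$ is the *order* of $D$. *Prolongations.* Identify $\Gamma(J^1F)$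 with $\Gamma(F)\oplus\Omega^1(M,F)$ by $(\alpha,\omega)\mapsto j^1\alpha+i(\omega)$, where $i:\mathrm{Hom}(TM,F)\to J^1F$ is determined by $i(df\otimes\alpha)=f\,j^1\alpha-j^1(f\alpha)$. The pairs with $D\alpha=l\circ\omega$ are the sections of the subbundle $J^1_DF=\{j^1_xs: D(s)(x)=0\}$, on which $$\varkappa_D(\alpha,\omega)(X,Y)=D_X(\omega(Y))-D_Y(\omega(X))-l(\omega([X,Y]))$$ defines a bundle map $\varkappa_D:J^1_DF\to\mathrm{Hom}(\wedge^2TM,E)$. Let $P_D(F)=\ker\varkappa_D\subset J^1F$ (pointwise kernel) and $pr:P_D(F)\to F$, $j^1_xs\mapsto s(x)$. $P_D(F)$ is *smoothly defined* if it is a smooth subbundle of $J^1F$ and $pr$ is surjective; then $D^{(1)}(\alpha,\omega)=\omega$ is a $pr$-connection $\Gamma(P_D(F))\to\Omega^1(M,F)$. Inductively $P^0_D(F)=F$, $D^{(0)}=D$, $P^{j+1}_D(F)=P_{D^{(j)}}(P^j_D(F))$, $D^{(j+1)}=(D^{(j)})^{(1)}$; $P^k_D(F)$ is *smoothly defined*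 if the prolongations of orders $1,\dots,k$ are. **Theorem.** Let $D$ be of finite type and of order $k$. Assume that $P^k_D(F)$ is smoothly defined and that $pr:P^{k+1}_D(F)\to P^k_D(F)$ is (fibrewise) surjective. Then: 1. $\mathrm{Sol}(F,D)$ is a finite dimensional vector space of dimension $$r=\mathrm{rank}\,F+\sum_{1\le i<k}\mathrm{rank}\,\mathfrak g^{(i)}$$ (the ranks on the right may be computed at any point of $M$). Moreover, with $V=\mathbb R^r$ and $V_M=M\times V$ with its canonical flat connection $\nabla^{\rm flat}$, there is a fibrewise surjective vector bundle map $p:V_M\to F$ with $D\circ p=(l\circ p)\circ\nabla^{\rm flat}$ which maps $\mathrm{Sol}(V_M,\nabla^{\rm flat})$ (the constant sections) bijectively onto $\mathrm{Sol}(F,D)$. 2. Suppose in addition that $F=A$ is a Lie algebroid over $M$ with anchor $\rho$, and that $D$ is a Spencer operator, i.e. $D_{\rho(\beta)}\alpha=-l[\alpha,\beta]$ for $\alpha\in\Gamma(A)$, $\beta\in\Gamma(\mathfrak g)$, and $$D_X[\alpha,\alpha']=\nabla_\alpha(D_X\alpha')-D_{[\rho(\alpha),X]}\alpha'-\nabla_{\alpha'}(D_X\alpha)+D_{[\rho(\alpha'),X]}\alpha$$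 for $\alpha,\alpha'\in\Gamma(A)$, $X\in\mathfrak X(M)$, where $\nabla_\alpha(l(\alpha'))=D_{\rho(\alpha')}\alpha+l[\alpha,\alpha']$. Then $\mathrm{Sol}(A,D)$ is a Lie subalgebra of $\Gamma(A)$ (of dimension $r$), and there are a Lie algebra $\mathfrak h$ of dimension $r$, an infinitesimal action $\psi:\mathfrak h\to\mathfrak X(M)$ (a Lie algebra map), and a fibrewise surjective vector bundle map $p:\mathfrak h\ltimes M\to A$ from the action algebroid (the bundle $\mathfrak h_M$ with anchor $(x,u)\mapsto\psi(u)_x$ and bracket $[\alpha,\beta]=[\alpha,\beta]_{\mathfrak h}+\nabla^{\rm flat}_{\psi(\alpha)}\beta-\nabla^{\rm flat}_{\psi(\beta)}\alpha$) which is a Lie algebroid morphism, satisfies $D\circ p=(l\circ p)\circ\nabla^{\rm flat}$, and maps the constant sections bijectively onto $\mathrm{Sol}(A,D)$. -/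

import Mathlib

open Set Bundle Module
open scoped Manifold ContDiff Topology

universe uB uM v w v₁ w₁ v₂ w₂

noncomputable section

/-! ## Smooth vector bundles, sections, bundle maps, one-forms -/

/-- A smooth real vector bundle of finite rank over `M` (Mathlib's notion, bundled). -/
structure SmoothVB (B : Type uB) [NormedAddCommGroup B] [NormedSpace ℝ B]
    (M : Type uM) [TopologicalSpace M] [ChartedSpace B M] where
  Model : Type v
  Fiber : M → Type w
  [normedModel : NormedAddCommGroup Model]
  [spaceModel : NormedSpace ℝ Model]
  [finiteModel : FiniteDimensional ℝ Model]
  [groupFiber : ∀ x, AddCommGroup (Fiber x)]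
  [moduleFiber : ∀ x, Module ℝ (Fiber x)]
  [topFiber : ∀ x, TopologicalSpace (Fiber x)]
  [topGroupFiber : ∀ x, IsTopologicalAddGroup (Fiber x)]
  [contSMulFiber : ∀ x, ContinuousSMul ℝ (Fiber x)]
  [topTotal : TopologicalSpace (TotalSpace Model Fiber)]
  [fiberBundle : FiberBundle Model Fiber]
  [vectorBundle : VectorBundle ℝ Model Fiber]
  [smoothBundle : ContMDiffVectorBundle ∞ Model Fiber 𝓘(ℝ, B)]

attribute [instance] SmoothVB.normedModel SmoothVB.spaceModel SmoothVB.finiteModel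
  SmoothVB.groupFiber SmoothVB.moduleFiber SmoothVB.topFiber SmoothVB.topGroupFiber
  SmoothVB.contSMulFiber SmoothVB.topTotal SmoothVB.fiberBundle SmoothVB.vectorBundle
  SmoothVB.smoothBundle

section

variable {B : Type uB} [NormedAddCommGroup B] [NormedSpace ℝ B]
  {M : Type uM} [TopologicalSpace M] [ChartedSpace B M]

/-- `Γ(F)`, the space of smooth sections. -/
abbrev Sect (F : SmoothVB.{uB, uM, v, w} B M) : Type _ :=
  ContMDiffSection 𝓘(ℝ, B) F.Model ∞ F.Fiber

variable [IsManifold 𝓘(ℝ, B) ∞ M]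

/-- `Ω¹(M, F)`, the space of smooth sections of `Hom(TM, F)`. -/
abbrev OneForm (F : SmoothVB.{uB, uM, v, w} B M) : Type _ :=
  ContMDiffSection 𝓘(ℝ, B) (B →L[ℝ] F.Model) ∞
    (fun x : M => TangentSpace 𝓘(ℝ, B) x →L[ℝ] F.Fiber x)

variable (B M) in
/-- `𝔛(M)`, the space of smooth vector fields. -/
abbrev VField : Type _ :=
  ContMDiffSection 𝓘(ℝ, B) B ∞ (fun x : M => TangentSpace 𝓘(ℝ, B) x)

variable (B M) in
/-- The tangent bundle. -/
abbrev tangentVB [FiniteDimensional ℝ B] : SmoothVB.{uB, uM, uB, uB} B M where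
  Model := B
  Fiber := fun x : M => TangentSpace 𝓘(ℝ, B) x

variable (B M) in
/-- The trivial vector bundle `V_M`. -/
abbrev trivialVB (V : Type v) [NormedAddCommGroup V] [NormedSpace ℝ V] [FiniteDimensional ℝ V] :
    SmoothVB.{uB, uM, v, v} B M where
  Model := V
  Fiber := Bundle.Trivial M V


/-- A smooth vector bundle map covering the identity of `M`. -/
structure VBHom (F : SmoothVB.{uB, uM, v₁, w₁} B M) (E : SmoothVB.{uB, uM, v₂, w₂} B M) where
  app : ∀ x, F.Fiber x →ₗ[ℝ] E.Fiber x
  smooth : ContMDiff (𝓘(ℝ, B).prod 𝓘(ℝ, F.Model)) (𝓘(ℝ, B).prod 𝓘(ℝ, E.Model)) ∞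
    (fun p : TotalSpace F.Model F.Fiber => TotalSpace.mk' E.Model p.1 (app p.1 p.2))

/-- The map `Γ(F) → Γ(E)` induced by a bundle map. -/
def VBHom.map {F : SmoothVB.{uB, uM, v₁, w₁} B M} {E : SmoothVB.{uB, uM, v₂, w₂} B M}
    (φ : VBHom F E) (s : Sect F) : Sect E where
  toFun x := φ.app x (s x)
  contMDiff_toFun := φ.smooth.comp s.contMDiff

/-- The section `f s`. -/
def Sect.smulFun {F : SmoothVB.{uB, uM, v, w} B M} (f : C^∞⟮𝓘(ℝ, B), M; 𝓘(ℝ, ℝ), ℝ⟯)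
    (s : Sect F) : Sect F where
  toFun x := f x • s x
  contMDiff_toFun := f.contMDiff.smul_section s.contMDiff

/-- The section `η(X)` for a one-form `η` and a vector field `X`. -/
def OneForm.along {F : SmoothVB.{uB, uM, v, w} B M} (η : OneForm F) (X : VField B M) :
    Sect F where
  toFun x := η x (X x)
  contMDiff_toFun := ContMDiff.clm_bundle_apply η.contMDiff X.contMDiff

/-! ## Relative connections -/

/-- A relative connection `(D, l) : F → E`: a surjective bundle map `l` and an operator
`D : Γ(F) → Ω¹(M, E)` with `D_X(f s) = f D_X s + (L_X f) l(s)`. -/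
structure RelConn (F : SmoothVB.{uB, uM, v₁, w₁} B M) (E : SmoothVB.{uB, uM, v₂, w₂} B M) where
  l : VBHom F E
  surj : ∀ x, Function.Surjective (l.app x)
  D : Sect F →ₗ[ℝ] OneForm E
  leibniz : ∀ (f : C^∞⟮𝓘(ℝ, B), M; 𝓘(ℝ, ℝ), ℝ⟯) (s : Sect F) (x : M)
    (X : TangentSpace 𝓘(ℝ, B) x),
    D (s.smulFun f) x X = f x • D s x X + (mvfderiv 𝓘(ℝ, B) f x X) • l.app x (s x)

/-! ## First jets of sections -/

/-- The derivative at `x` of a section, read in the preferred trivialization of the bundle at `x`. -/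
def Sect.localDeriv {F : SmoothVB.{uB, uM, v, w} B M} (s : Sect F) (x : M) :
    TangentSpace 𝓘(ℝ, B) x →L[ℝ] F.Fiber x :=
  ((trivializationAt F.Model F.Fiber x).symmL ℝ x).comp
    (mvfderiv 𝓘(ℝ, B) (fun y => (trivializationAt F.Model F.Fiber x ⟨y, s y⟩).2) x)

/-- The fibre at `x` of the first jet bundle `J¹F`.  A one-jet at `x` is recorded by its value and
its first derivatives in the preferred trivialization at `x`; two sections have the same one-jet
at `x` exactly when these data agree. -/
abbrev Jet1 (F : SmoothVB.{uB, uM, v, w} B M) (x : M) : Type _ :=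
  F.Fiber x × (TangentSpace 𝓘(ℝ, B) x →L[ℝ] F.Fiber x)

/-- The one-jet `j¹_x s`. -/
def Sect.jet1 {F : SmoothVB.{uB, uM, v, w} B M} (s : Sect F) (x : M) : Jet1 F x :=
  (s x, s.localDeriv x)

/-- The value at `x` of the section `(α, η) = j¹α + i(η)` of `J¹F` given by the Spencer
decomposition `Γ(J¹F) ≅ Γ(F) ⊕ Ω¹(M, F)`, where `i : Hom(TM, F) → J¹F` is determined by
`i(df ⊗ α) = f j¹α - j¹(f α)`, that is `i(η)_x = (0, -η_x)`. -/
def spencerJet {F : SmoothVB.{uB, uM, v, w} B M} (α : Sect F) (η : OneForm F) (x : M) :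
    Jet1 F x :=
  α.jet1 x + (0, -η x)

theorem Sect.mdiff_local {F : SmoothVB.{uB, uM, v, w} B M} (s : Sect F) (x : M) :
    MDifferentiableAt 𝓘(ℝ, B) 𝓘(ℝ, F.Model)
      (fun y => (trivializationAt F.Model F.Fiber x ⟨y, s y⟩).2) x := by
  have h := (contMDiffAt_section x).1 s.contMDiff.contMDiffAt
  exact h.mdifferentiableAt (by simp)

theorem Sect.localDeriv_add {F : SmoothVB.{uB, uM, v, w} B M} (s t : Sect F) (x : M) :
    (s + t).localDeriv x = s.localDeriv x + t.localDeriv x := by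
  have hx := FiberBundle.mem_baseSet_trivializationAt' (F := F.Model) (E := F.Fiber) x
  have h : (fun y => (trivializationAt F.Model F.Fiber x ⟨y, (s + t) y⟩).2) =ᶠ[𝓝 x]
      (fun y => (trivializationAt F.Model F.Fiber x ⟨y, s y⟩).2) +
      (fun y => (trivializationAt F.Model F.Fiber x ⟨y, t y⟩).2) := by
    filter_upwards [(trivializationAt F.Model F.Fiber x).open_baseSet.mem_nhds hx] with y hy
    exact ((trivializationAt F.Model F.Fiber x).linear ℝ hy).map_add _ _
  have h2 : mvfderiv 𝓘(ℝ, B) (fun y => (trivializationAt F.Model F.Fiber x ⟨y, (s + t) y⟩).2) x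
      = mvfderiv 𝓘(ℝ, B) ((fun y => (trivializationAt F.Model F.Fiber x ⟨y, s y⟩).2) +
        (fun y => (trivializationAt F.Model F.Fiber x ⟨y, t y⟩).2)) x := by
    ext u
    simp only [mvfderiv]
    rw [h.mfderiv_eq]
    rfl
  unfold Sect.localDeriv
  rw [h2, mvfderiv_add (s.mdiff_local x) (t.mdiff_local x), ContinuousLinearMap.comp_add]

theorem Sect.localDeriv_smul {F : SmoothVB.{uB, uM, v, w} B M} (c : ℝ) (s : Sect F) (x : M) :
    (c • s).localDeriv x = c • s.localDeriv x := by
  have hx := FiberBundle.mem_baseSet_trivializationAt' (F := F.Model) (E := F.Fiber) x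
  have h : (fun y => (trivializationAt F.Model F.Fiber x ⟨y, (c • s) y⟩).2) =ᶠ[𝓝 x]
      (fun _ : M => c) • (fun y => (trivializationAt F.Model F.Fiber x ⟨y, s y⟩).2) := by
    filter_upwards [(trivializationAt F.Model F.Fiber x).open_baseSet.mem_nhds hx] with y hy
    exact ((trivializationAt F.Model F.Fiber x).linear ℝ hy).map_smul _ _
  have h2 : mvfderiv 𝓘(ℝ, B) (fun y => (trivializationAt F.Model F.Fiber x ⟨y, (c • s) y⟩).2) x
      = mvfderiv 𝓘(ℝ, B) ((fun _ : M => c) •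
        (fun y => (trivializationAt F.Model F.Fiber x ⟨y, s y⟩).2)) x := by
    ext u
    simp only [mvfderiv]
    rw [h.mfderiv_eq]
    rfl
  unfold Sect.localDeriv
  rw [h2, mvfderiv_smul (mdifferentiableAt_const) (s.mdiff_local x)]
  ext u
  simp [mvfderiv_const]

theorem spencerJet_add {F : SmoothVB.{uB, uM, v, w} B M} (α α' : Sect F) (η η' : OneForm F)
    (x : M) : spencerJet (α + α') (η + η') x = spencerJet α η x + spencerJet α' η' x := by
  simp only [spencerJet, Sect.jet1, Sect.localDeriv_add, Prod.mk_add_mk,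
    ContMDiffSection.coe_add, Pi.add_apply, Prod.mk.injEq]
  constructor
  · abel
  · abel

theorem spencerJet_smul {F : SmoothVB.{uB, uM, v, w} B M} (c : ℝ) (α : Sect F) (η : OneForm F)
    (x : M) : spencerJet (c • α) (c • η) x = c • spencerJet α η x := by
  simp [spencerJet, Sect.jet1, Sect.localDeriv_smul]

/-! ## Symbols, solutions and prolongations -/

namespace RelConn

section

variable {F : SmoothVB.{uB, uM, v₁, w₁} B M} {E : SmoothVB.{uB, uM, v₂, w₂} B M}
  (D : RelConn F E)

/-- The space of solutions `Sol(F, D) ⊆ Γ(F)`. -/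
def Sol : Submodule ℝ (Sect F) := LinearMap.ker D.D

/-- `D.IsSymbol x e φ` says `∂_D(e) = φ`, where `∂_D : 𝔤 → Hom(TM, E)` is the symbol map on
`𝔤 = ker l`, i.e. `∂_D(e) = D(s)(x)` for a section `s` of `𝔤` through `e`. -/
def IsSymbol (x : M) (e : F.Fiber x) (φ : TangentSpace 𝓘(ℝ, B) x →L[ℝ] E.Fiber x) : Prop :=
  ∃ s : Sect F, (∀ y, D.l.app y (s y) = 0) ∧ s x = e ∧ D.D s x = φ

/-- The fibre at `x` of the `k`-th prolongation `𝔤⁽ᵏ⁾ ⊆ Sᵏ T* ⊗ 𝔤` of the symbol map `∂_D`: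
`𝔤⁽⁰⁾ = 𝔤 = ker l`, `𝔤⁽¹⁾` consists of the linear `T : TM → 𝔤` with `∂_D(T u) v = ∂_D(T v) u`,
and for `k ≥ 1`, `𝔤⁽ᵏ⁺¹⁾` consists of the symmetric `T` with `T(u, ·, …, ·) ∈ 𝔤⁽ᵏ⁾` for all `u`. -/
def symbolProl (x : M) : (k : ℕ) →
    Submodule ℝ (MultilinearMap ℝ (fun _ : Fin k => TangentSpace 𝓘(ℝ, B) x) (F.Fiber x))
  | 0 =>
    { carrier := {T | ∀ m, D.l.app x (T m) = 0}
      add_mem' := fun {a b} ha hb m => by simp [ha m, hb m]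
      zero_mem' := fun m => by simp
      smul_mem' := fun c a ha m => by simp [ha m] }
  | 1 =>
    { carrier := {T | (∀ m, D.l.app x (T m) = 0) ∧
        ∀ u v : TangentSpace 𝓘(ℝ, B) x, ∃ φ ψ, D.IsSymbol x (T fun _ => u) φ ∧
          D.IsSymbol x (T fun _ => v) ψ ∧ φ v = ψ u}
      add_mem' := by
        rintro a b ⟨ha, ha'⟩ ⟨hb, hb'⟩
        refine ⟨fun m => by simp [ha m, hb m], fun u v => ?_⟩
        obtain ⟨_, _, ⟨s, hs, hs1, rfl⟩, ⟨t, ht, ht1, rfl⟩, h⟩ := ha' u v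
        obtain ⟨_, _, ⟨s', hs', hs1', rfl⟩, ⟨t', ht', ht1', rfl⟩, h'⟩ := hb' u v
        refine ⟨_, _, ⟨s + s', fun y => by simp [hs y, hs' y], by simp [hs1, hs1'], rfl⟩,
          ⟨t + t', fun y => by simp [ht y, ht' y], by simp [ht1, ht1'], rfl⟩, ?_⟩
        simp [h, h']
      zero_mem' := ⟨fun m => by simp, fun u v => ⟨_, _, ⟨0, fun y => by simp, by simp, rfl⟩,
        ⟨0, fun y => by simp, by simp, rfl⟩, by simp⟩⟩
      smul_mem' := by
        rintro c a ⟨ha, ha'⟩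
        refine ⟨fun m => by simp [ha m], fun u v => ?_⟩
        obtain ⟨_, _, ⟨s, hs, hs1, rfl⟩, ⟨t, ht, ht1, rfl⟩, h⟩ := ha' u v
        refine ⟨_, _, ⟨c • s, fun y => by simp [hs y], by simp [hs1], rfl⟩,
          ⟨c • t, fun y => by simp [ht y], by simp [ht1], rfl⟩, ?_⟩
        simp [h] }
  | k + 2 =>
    { carrier := {T | (∀ (σ : Equiv.Perm (Fin (k + 2))) (m : Fin (k + 2) → TangentSpace 𝓘(ℝ, B) x),
        T (fun i => m (σ i)) = T m) ∧ ∀ u, T.curryLeft u ∈ symbolProl x (k + 1)}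
      add_mem' := by
        rintro a b ⟨ha, ha'⟩ ⟨hb, hb'⟩
        exact ⟨fun σ m => by simp [ha σ m, hb σ m],
          fun u => by simpa using! (symbolProl x (k + 1)).add_mem (ha' u) (hb' u)⟩
      zero_mem' := ⟨fun σ m => by simp, fun u => (symbolProl x (k + 1)).zero_mem⟩
      smul_mem' := by
        rintro c a ⟨ha, ha'⟩
        exact ⟨fun σ m => by simp [ha σ m],
          fun u => by simpa using! (symbolProl x (k + 1)).smul_mem c (ha' u)⟩ }

/-- `k` is the order of `D`: the smallest `k` with `𝔤⁽ᵏ⁾ = 0`.  `D` is of finite type when it has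
an order. -/
def IsOrder (k : ℕ) : Prop :=
  IsLeast {j : ℕ | ∀ x : M, D.symbolProl x j = ⊥} k

/-- The expression `D_X(η(Y)) - D_Y(η(X)) - l(η[X, Y])` at `x`.  On sections `(α, η)` of `J¹_D F`,
i.e. those with `D(α) = l ∘ η`, this is the curvature `ϰ_D(α, η)(X, Y)`. -/
def curvature (η : OneForm F) (X Y : VField B M) (x : M) : E.Fiber x :=
  D.D (OneForm.along η Y) x (X x) - D.D (OneForm.along η X) x (Y x)
    - D.l.app x (η x (VectorField.mlieBracket 𝓘(ℝ, B) X Y x))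

theorem curvature_add (η η' : OneForm F) (X Y : VField B M) (x : M) :
    D.curvature (η + η') X Y x = D.curvature η X Y x + D.curvature η' X Y x := by
  have h : ∀ Z : VField B M, OneForm.along (η + η') Z = OneForm.along η Z + OneForm.along η' Z :=
    fun Z => rfl
  simp only [curvature, h, map_add, ContMDiffSection.coe_add, Pi.add_apply,
    _root_.add_apply]
  abel

theorem curvature_smul (c : ℝ) (η : OneForm F) (X Y : VField B M) (x : M) :
    D.curvature (c • η) X Y x = c • D.curvature η X Y x := by
  have h : ∀ Z : VField B M, OneForm.along (c • η) Z = c • OneForm.along η Z := fun Z => rfl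
  simp only [curvature, h, map_smul, ContMDiffSection.coe_smul, Pi.smul_apply,
    _root_.smul_apply, smul_sub]

/-- The fibre at `x` of the classical prolongation space `P_D(F) ⊆ J¹_D F ⊆ J¹F`, the pointwise
kernel of the curvature `ϰ_D : J¹_D F → Hom(Λ²TM, E)`: the jets `p` at `x` that extend to a section
`(α, η)` of `J¹_D F` (that is, with `D(α) = l ∘ η`) whose curvature vanishes at `x`. As `ϰ_D` is a
bundle map, the choice of the extension is irrelevant. -/
def prolSpace (x : M) : Submodule ℝ (Jet1 F x) where
  carrier := {p | ∃ (α : Sect F) (η : OneForm F),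
    (∀ y (u : TangentSpace 𝓘(ℝ, B) y), D.D α y u = D.l.app y (η y u)) ∧
    spencerJet α η x = p ∧ ∀ X Y : VField B M, D.curvature η X Y x = 0}
  add_mem' := by
    rintro _ _ ⟨α, η, h1, rfl, h2⟩ ⟨α', η', h1', rfl, h2'⟩
    exact ⟨α + α', η + η', fun y u => by simp [h1, h1'], spencerJet_add _ _ _ _ _,
      fun X Y => by simp [curvature_add, h2, h2']⟩
  zero_mem' := by
    refine ⟨0, 0, fun y u => by simp, ?_, fun X Y => ?_⟩
    · have h := spencerJet_smul (0 : ℝ) (0 : Sect F) (0 : OneForm F) x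
      rwa [zero_smul, show (0 : ℝ) • (0 : OneForm F) = 0 from zero_smul ℝ (0 : OneForm F), zero_smul] at h
    · have h := D.curvature_smul (0 : ℝ) (0 : OneForm F) X Y x
      rwa [show (0 : ℝ) • (0 : OneForm F) = 0 from zero_smul ℝ (0 : OneForm F), zero_smul] at h
  smul_mem' := by
    rintro c _ ⟨α, η, h1, rfl, h2⟩
    exact ⟨c • α, c • η, fun y u => by simp [h1], spencerJet_smul _ _ _ _,
      fun X Y => by simp [curvature_smul, h2]⟩

/-- The projection `pr : P_D(F) → F`, `j¹_x s ↦ s(x)`, is surjective. -/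
def ProlSurjective : Prop :=
  ∀ (x : M) (e : F.Fiber x), ∃ p ∈ D.prolSpace x, p.1 = e

end

section

variable {K F E : SmoothVB.{uB, uM, v, w} B M}

/-- `P_D(F)` is smoothly defined, with first classical prolongation `(D⁽¹⁾, pr) : P_D(F) → F`
given by `(K, D₁)`: the smooth vector bundle `K` is carried by `Φ` isomorphically onto the family of
subspaces `P_D(F)` of `J¹F`, and `D₁` is the restriction of the classical Spencer operator
`D^clas(α, η) = η` relative to `pr(α, η) = α`; thus for a section `σ` of `K` the section `Φ(σ)` of
`J¹F` has Spencer decomposition `(l₁(σ), D₁(σ))`, which also says that `Φ` is smooth.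
Surjectivity of `pr` is part of `D₁` being a relative connection. -/
def IsFirstProlongation (D : RelConn F E) (D₁ : RelConn K F) : Prop :=
  ∃ Φ : ∀ x, K.Fiber x ≃ₗ[ℝ] D.prolSpace x,
    ∀ (σ : Sect K) (x : M), (Φ x (σ x) : Jet1 F x) = spencerJet (D₁.l.map σ) (D₁.D σ) x

end

/-- `D.IsProlongation k Dk` says that `P^k_D(F)` is smoothly defined, and that `Dk` is the classical
`k`-prolongation `(D⁽ᵏ⁾, pr) : P^k_D(F) → P^{k-1}_D(F)`; by convention `D⁽⁰⁾ = D : F → E`. -/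
inductive IsProlongation {F E : SmoothVB.{uB, uM, v, w} B M} (D : RelConn F E) :
    ℕ → ∀ {F' E' : SmoothVB.{uB, uM, v, w} B M}, RelConn F' E' → Prop
  | zero : IsProlongation D 0 D
  | succ {k : ℕ} {F' E' K : SmoothVB.{uB, uM, v, w} B M} {D' : RelConn F' E'} {D₁ : RelConn K F'} :
      IsProlongation D k D' → IsFirstProlongation D' D₁ → IsProlongation D (k + 1) D₁

end RelConn


/-! ## The flat connection on a trivial bundle -/

section flat

variable (V : Type v) [NormedAddCommGroup V] [NormedSpace ℝ V] [FiniteDimensional ℝ V]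

theorem trivialSect_contMDiff (s : Sect (trivialVB B M V)) :
    ContMDiff 𝓘(ℝ, B) 𝓘(ℝ, V) ∞ (fun x => (s x : V)) := by
  intro x
  exact (contMDiffAt_section x).1 s.contMDiff.contMDiffAt

variable {V} in
/-- The one-form `ds` of a section `s` of `V_M`, i.e. of a smooth function `s : M → V`. -/
def trivialDeriv (s : Sect (trivialVB B M V)) : OneForm (trivialVB B M V) where
  toFun x := mvfderiv 𝓘(ℝ, B) (fun y => (s y : V)) x
  contMDiff_toFun := by
    intro x₀
    have h := (trivialSect_contMDiff V s x₀).mfderiv_const (m := ∞) (by simp)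
    refine (contMDiffAt_hom_bundle _).2 ⟨contMDiffAt_id, ?_⟩
    refine h.congr_of_eventuallyEq (Filter.Eventually.of_forall fun x => ?_)
    ext u
    simp [inTangentCoordinates, ContinuousLinearMap.inCoordinates, mvfderiv]
    rfl

variable (B M) in
/-- The canonical flat connection `∇^flat` on `V_M`, as a connection relative to the identity. -/
def flatConn : RelConn (trivialVB B M V) (trivialVB B M V) where
  l := { app := fun _ => LinearMap.id, smooth := contMDiff_id }
  surj := fun x => Function.surjective_id
  D :=
    { toFun := trivialDeriv
      map_add' := fun s t => by
        ext1 x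
        exact mvfderiv_add ((trivialSect_contMDiff V s).mdifferentiable (by simp) x)
          ((trivialSect_contMDiff V t).mdifferentiable (by simp) x)
      map_smul' := fun c s => by
        ext1 x
        have h := mvfderiv_smul (x := x) (I := 𝓘(ℝ, B)) (a := fun _ : M => c)
          mdifferentiableAt_const ((trivialSect_contMDiff V s).mdifferentiable (by simp) x)
        rw [mvfderiv_const] at h
        refine h.trans ?_
        ext u
        simp
        rfl }
  leibniz := fun f s x X => by
    have h := mvfderiv_smul (x := x) (I := 𝓘(ℝ, B)) (f.contMDiff.mdifferentiable (by simp) x)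
      ((trivialSect_contMDiff V s).mdifferentiable (by simp) x)
    refine (congrArg (fun φ => φ X) h).trans ?_
    simp
    rfl

end flat


/-- `p : (V_M, ∇^flat) → (F, D)` is a morphism of relative connections:
`D ∘ p = (l ∘ p) ∘ ∇^flat`. -/
def IsFlatMorphism {V : Type v₁} [NormedAddCommGroup V] [NormedSpace ℝ V] [FiniteDimensional ℝ V]
    {F : SmoothVB.{uB, uM, v, w} B M} {E : SmoothVB.{uB, uM, v₂, w₂} B M}
    (p : VBHom (trivialVB B M V) F) (D : RelConn F E) : Prop :=
  ∀ (s : Sect (trivialVB B M V)) (x : M) (X : TangentSpace 𝓘(ℝ, B) x),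
    D.D (p.map s) x X = D.l.app x (p.app x ((flatConn B M V).D s x X))

/-! ## Lie algebroids and Spencer operators -/

/-- A Lie bracket on a given real vector space. -/
structure LieBracketOn (L : Type v) [AddCommGroup L] [Module ℝ L] where
  br : L →ₗ[ℝ] L →ₗ[ℝ] L
  self : ∀ a, br a a = 0
  jacobi : ∀ a b c, br a (br b c) = br (br a b) c + br b (br a c)

/-- The associated Lie ring in Mathlib's sense. -/
abbrev LieBracketOn.toLieRing {L : Type v} [AddCommGroup L] [Module ℝ L] (b : LieBracketOn L) :
    LieRing L where
  bracket x y := b.br x y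
  add_lie x y z := by simp
  lie_add x y z := by simp
  lie_self x := b.self x
  leibniz_lie x y z := b.jacobi x y z

/-- The associated Lie algebra in Mathlib's sense. -/
abbrev LieBracketOn.toLieAlgebra {L : Type v} [AddCommGroup L] [Module ℝ L]
    (b : LieBracketOn L) : @LieAlgebra ℝ L _ b.toLieRing :=
  letI := b.toLieRing
  { lie_smul := fun c x y => (b.br x).map_smul c y }

/-- A Lie algebroid structure on a vector bundle `A`: an anchor `ρ : A → TM` and a Lie bracket on
`Γ(A)` with `[α, f β] = f [α, β] + (L_{ρ(α)} f) β`. -/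
structure LieAlgebroid [FiniteDimensional ℝ B] (A : SmoothVB.{uB, uM, v, w} B M) where
  anchor : VBHom A (tangentVB B M)
  lie : LieBracketOn (Sect A)
  leibniz : ∀ (α β : Sect A) (f : C^∞⟮𝓘(ℝ, B), M; 𝓘(ℝ, ℝ), ℝ⟯) (x : M),
    lie.br α (β.smulFun f) x =
      f x • lie.br α β x + (mvfderiv 𝓘(ℝ, B) f x (anchor.app x (α x))) • β x

/-- `D` is a Spencer operator on the Lie algebroid `A` relative to `l : A → E`:
* `D_{ρ(β)} α = - l[α, β]` for sections `β` of `ker l`;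
* `D_X[α, α'] = ∇_α(D_X α') - D_{[ρ(α), X]} α' - ∇_{α'}(D_X α) + D_{[ρ(α'), X]} α`, where
  `∇ : Γ(A) × Γ(E) → Γ(E)` is given by `∇_α(l(α')) = D_{ρ(α')} α + l[α, α']`. -/
structure IsSpencerOperator [FiniteDimensional ℝ B] {A : SmoothVB.{uB, uM, v₁, w₁} B M}
    {E : SmoothVB.{uB, uM, v₂, w₂} B M} (S : LieAlgebroid A) (D : RelConn A E) : Prop where
  horizontal : ∀ α β : Sect A, (∀ y, D.l.app y (β y) = 0) → ∀ x,
    D.D α x (S.anchor.app x (β x)) = - D.l.app x (S.lie.br α β x)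
  compatible : ∃ nabla : Sect A → Sect E → Sect E,
    (∀ (α α' : Sect A) (x : M), nabla α (D.l.map α') x =
      D.D α x (S.anchor.app x (α' x)) + D.l.app x (S.lie.br α α' x)) ∧
    ∀ (α α' : Sect A) (X : VField B M) (x : M), D.D (S.lie.br α α') x (X x) =
      nabla α (OneForm.along (D.D α') X) x
        - D.D α' x (VectorField.mlieBracket 𝓘(ℝ, B) (fun y => S.anchor.app y (α y)) X x)
        - nabla α' (OneForm.along (D.D α) X) x
        + D.D α x (VectorField.mlieBracket 𝓘(ℝ, B) (fun y => S.anchor.app y (α' y)) X x)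

section action

variable {V : Type v} [NormedAddCommGroup V] [NormedSpace ℝ V] [FiniteDimensional ℝ V]

variable (B M) in
/-- An infinitesimal action on `M` of the Lie algebra `(V, [·, ·])`, i.e. a Lie algebra map
`V → 𝔛(M)`. -/
structure InfinitesimalAction (L : LieBracketOn V) where
  act : V →ₗ[ℝ] VField B M
  map_lie : ∀ (a b : V) (x : M),
    act (L.br a b) x = VectorField.mlieBracket 𝓘(ℝ, B) (act a) (act b) x

variable {L : LieBracketOn V} (ψ : InfinitesimalAction B M L)

/-- The anchor `(x, a) ↦ ψ(a)_x` of the action algebroid, applied to a section `α`. -/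
def InfinitesimalAction.anchorSect (α : Sect (trivialVB B M V)) : VField B M where
  toFun x := ψ.act (α x) x
  contMDiff_toFun := by
    let b := Module.finBasis ℝ V
    have h : ∀ x, ψ.act (α x) x = ∑ i, b.coord i (α x) • ψ.act (b i) x := by
      intro x
      have h1 : ψ.act (α x) = ∑ i, b.coord i (α x) • ψ.act (b i) := by
        have h3 := congrArg ψ.act (b.sum_repr (α x))
        rw [map_sum] at h3
        simpa using h3.symm
      have h2 : ∀ (t : Finset (Fin (finrank ℝ V))) (f : Fin (finrank ℝ V) → VField B M),
          (∑ i ∈ t, f i) x = ∑ i ∈ t, f i x := fun t f => by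
        classical
        induction t using Finset.induction_on with
        | empty => simp
        | insert i t hi ih => rw [Finset.sum_insert hi, Finset.sum_insert hi, ← ih]; rfl
      rw [h1, h2]
      rfl
    simp_rw [h]
    refine ContMDiff.sum_section fun i _ => ContMDiff.smul_section ?_ (ψ.act (b i)).contMDiff
    exact (LinearMap.toContinuousLinearMap (b.coord i)).contMDiff.comp
      (trivialSect_contMDiff V α)

/-- The bracket on `Γ(V ⋉ M) = C^∞(M, V)` of the action algebroid:
`[α, β] = [α, β]_V + ∇^flat_{ρ(α)} β - ∇^flat_{ρ(β)} α`. -/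
def InfinitesimalAction.bracket (α β : Sect (trivialVB B M V)) : Sect (trivialVB B M V) where
  toFun x := L.br (α x) (β x) + (flatConn B M V).D β x (ψ.anchorSect α x)
    - (flatConn B M V).D α x (ψ.anchorSect β x)
  contMDiff_toFun := by
    have h1 : ContMDiff 𝓘(ℝ, B) (𝓘(ℝ, B).prod 𝓘(ℝ, V)) ∞
        (fun x => TotalSpace.mk' V (E := Bundle.Trivial M V) x (L.br (α x) (β x))) := by
      intro x
      refine (contMDiffAt_section x).2 ?_
      let c : V →L[ℝ] V →L[ℝ] V := LinearMap.toContinuousLinearMap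
        (LinearMap.toContinuousLinearMap.toLinearMap.comp L.br)
      exact (c.contMDiff.comp (trivialSect_contMDiff V α)).clm_apply (trivialSect_contMDiff V β) x
    exact (h1.add_section (OneForm.along ((flatConn B M V).D β) (ψ.anchorSect α)).contMDiff).sub_section
      (OneForm.along ((flatConn B M V).D α) (ψ.anchorSect β)).contMDiff

/-- The bundle map `p : V ⋉ M → A` over `M` is a morphism of Lie algebroids: it is compatible with
the anchors and with the brackets of sections. -/
def IsActionMorphism [FiniteDimensional ℝ B] {A : SmoothVB.{uB, uM, v₁, w₁} B M}
    (S : LieAlgebroid A) (p : VBHom (trivialVB B M V) A) : Prop :=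
  (∀ (x : M) (a : V), S.anchor.app x (p.app x a) = ψ.act a x) ∧
  ∀ α β : Sect (trivialVB B M V), p.map (ψ.bracket α β) = S.lie.br (p.map α) (p.map β)

end action

end
end

/-! Prolonging does not change the solutions. If `s` solves `D`, its jets `j¹s` form a section of
`P_D(F)` killed by `D⁽¹⁾`, and every solution of `D⁽¹⁾` arises in this way (`map_mem_Sol`,
`eq_zero_of_map_eq_zero`, `exists_mem_Sol_map_eq`). Iterating, the surjective projection `P^k_D(F) →
F` maps the solutions of `D⁽ᵏ⁾` bijectively onto those of `D` (`IsProlongation.exists_projection`).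

At level `k` the equation is a flat linear connection. The elements of `P_D(F)` over zero form
`𝔤⁽¹⁾` (`zero_mk_mem_prolSpace_iff`), and there the symbol of `D⁽¹⁾` is minus the inclusion into
`Hom(TM, F)`. Hence `𝔤⁽ⁿ⁾(D⁽¹⁾) ≅ 𝔤⁽ⁿ⁺¹⁾(D)` (`finrank_symbolProl_prol`). It follows that the kernel
of the map `l` of `D⁽ᵏ⁾` is `𝔤⁽ᵏ⁾ = 0`, and that the rank of `P^k_D(F)` is the number `r`. So `D⁽ᵏ⁾`
is a connection relative to an isomorphism, that is, an ordinary linear connection on `P^k_D(F)`.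
The curvature is tensorial (`RelConn.curvature_eq_zero`), and for injective `l` the value of `α` at
a point determines its jet in `J¹_D`; surjectivity of the next projection therefore says exactly
that the curvature vanishes (`curvature_eq_zero_of_prolSurjective`).

A flat connection has local parallel frames (`exists_isParallelFrame`), obtained from parallel
transport along rays in a chart; flatness and Grönwall's inequality show that the result is parallel
in all directions (`hasFDerivAt_radial_solution`). The local parallel sections form a covering
space, so over a simply connected base each vector extends to a unique global parallel section
(`exists_linearEquiv_Sol`). A basis `s₁, …, s_r` of the solutions of `D` then gives the bundle map
`(x, a) ↦ ∑ aᵢ sᵢ(x)`.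

For a Spencer operator, compatibility expresses `D[α, α']` through `Dα` and `Dα'`, so solutions are
closed under the bracket. They act on `M` through the anchor, which preserves brackets by the Jacobi
identity (`LieAlgebroid.anchor_br`), and the Leibniz rule makes the same bundle map a morphism from
the action algebroid. -/

set_option linter.unusedSectionVars false

noncomputable section

section Toolkit

variable {B : Type uB} [NormedAddCommGroup B] [NormedSpace ℝ B]
  {M : Type uM} [TopologicalSpace M] [ChartedSpace B M] [IsManifold 𝓘(ℝ, B) ∞ M]

/-! ### Evaluation of sections and one-forms -/

namespace SmoothVB

variable (F : SmoothVB.{uB, uM, v, w} B M)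

/-- The linear isomorphism of a fibre with the model fibre. -/
def fiberEquiv (x : M) : F.Fiber x ≃ₗ[ℝ] F.Model :=
  (trivializationAt F.Model F.Fiber x).linearEquivAt ℝ x
    (FiberBundle.mem_baseSet_trivializationAt' x)

instance finiteDimensional_fiber (x : M) : FiniteDimensional ℝ (F.Fiber x) :=
  (F.fiberEquiv x).symm.finiteDimensional

theorem finrank_fiber (x : M) : finrank ℝ (F.Fiber x) = finrank ℝ F.Model :=
  (F.fiberEquiv x).finrank_eq

end SmoothVB

/-- Evaluation at a point, as a linear map on sections. -/
def Sect.evalAt {F : SmoothVB.{uB, uM, v, w} B M} (x : M) : Sect F →ₗ[ℝ] F.Fiber x where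
  toFun s := s x
  map_add' _ _ := rfl
  map_smul' _ _ := rfl

theorem Sect.sum_apply {F : SmoothVB.{uB, uM, v, w} B M} {ι : Type*} (t : Finset ι)
    (s : ι → Sect F) (x : M) : (∑ i ∈ t, s i) x = ∑ i ∈ t, s i x :=
  map_sum (Sect.evalAt x) s t

/-- Evaluation at a point, as a linear map on one-forms. -/
def OneForm.evalAt {F : SmoothVB.{uB, uM, v, w} B M} (x : M) :
    OneForm F →ₗ[ℝ] (TangentSpace 𝓘(ℝ, B) x →L[ℝ] F.Fiber x) where
  toFun s := s x
  map_add' _ _ := rfl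
  map_smul' _ _ := rfl

theorem OneForm.sum_apply {F : SmoothVB.{uB, uM, v, w} B M} {ι : Type*} (t : Finset ι)
    (s : ι → OneForm F) (x : M) : (∑ i ∈ t, s i) x = ∑ i ∈ t, s i x :=
  map_sum (OneForm.evalAt x) s t

@[simp] theorem Sect.smulFun_apply {F : SmoothVB.{uB, uM, v, w} B M}
    (f : C^∞⟮𝓘(ℝ, B), M; 𝓘(ℝ, ℝ), ℝ⟯) (s : Sect F) (x : M) : s.smulFun f x = f x • s x := rfl

@[simp] theorem VBHom.map_apply {F : SmoothVB.{uB, uM, v₁, w₁} B M}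
    {E : SmoothVB.{uB, uM, v₂, w₂} B M} (φ : VBHom F E) (s : Sect F) (x : M) :
    φ.map s x = φ.app x (s x) := rfl

@[simp] theorem OneForm.along_apply {F : SmoothVB.{uB, uM, v, w} B M} (η : OneForm F)
    (X : VField B M) (x : M) : η.along X x = η x (X x) := rfl

theorem VBHom.map_add {F : SmoothVB.{uB, uM, v₁, w₁} B M}
    {E : SmoothVB.{uB, uM, v₂, w₂} B M} (φ : VBHom F E) (s t : Sect F) :
    φ.map (s + t) = φ.map s + φ.map t := by
  ext x; simp

theorem VBHom.map_smulFun {F : SmoothVB.{uB, uM, v₁, w₁} B M}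
    {E : SmoothVB.{uB, uM, v₂, w₂} B M} (φ : VBHom F E) (f : C^∞⟮𝓘(ℝ, B), M; 𝓘(ℝ, ℝ), ℝ⟯)
    (s : Sect F) : φ.map (s.smulFun f) = (φ.map s).smulFun f := by
  ext x; simp

/-- The map on sections induced by a bundle map, as a linear map. -/
def VBHom.mapₗ {F : SmoothVB.{uB, uM, v₁, w₁} B M}
    {E : SmoothVB.{uB, uM, v₂, w₂} B M} (φ : VBHom F E) : Sect F →ₗ[ℝ] Sect E where
  toFun := φ.map
  map_add' := φ.map_add
  map_smul' c s := by ext x; simp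

/-! ### Cut-off and extension -/

section Bump

variable [FiniteDimensional ℝ B] [T2Space M]

theorem exists_bump {x : M} {U : Set M} (hU : U ∈ 𝓝 x) :
    ∃ χ : C^∞⟮𝓘(ℝ, B), M; 𝓘(ℝ, ℝ), ℝ⟯, (∀ᶠ y in 𝓝 x, χ y = 1) ∧ tsupport χ ⊆ U := by
  obtain ⟨f, -, hf⟩ := (SmoothBumpFunction.nhds_basis_tsupport (I := 𝓘(ℝ, B)) x).mem_iff.1 hU
  exact ⟨⟨f, f.contMDiff⟩, f.eventuallyEq_one, hf⟩

/-- Multiply by a bump function supported in the domain. Relative connections act on global sections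
only, so local objects such as frames are always replaced by global ones with the same germ. -/
theorem exists_sect_eventuallyEq {F : SmoothVB.{uB, uM, v, w} B M} {U : Set M} (hU : IsOpen U)
    {x : M} (hx : x ∈ U) {s : ∀ y, F.Fiber y}
    (hs : ContMDiffOn 𝓘(ℝ, B) (𝓘(ℝ, B).prod 𝓘(ℝ, F.Model)) ∞
      (fun y => TotalSpace.mk' F.Model y (s y)) U) :
    ∃ t : Sect F, ∀ᶠ y in 𝓝 x, t y = s y := by
  obtain ⟨χ, h1, h2⟩ := exists_bump (B := B) (hU.mem_nhds hx)
  refine ⟨⟨fun y => χ y • s y,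
    ContMDiffOn.smul_section_of_tsupport χ.contMDiff.contMDiffOn hU h2 hs⟩, ?_⟩
  filter_upwards [h1] with y hy
  simp [hy]

theorem exists_fun_eventuallyEq {W : Type*} [NormedAddCommGroup W] [NormedSpace ℝ W]
    {U : Set M} (hU : IsOpen U) {x : M} (hx : x ∈ U) {f : M → W}
    (hf : ContMDiffOn 𝓘(ℝ, B) 𝓘(ℝ, W) ∞ f U) :
    ∃ g : C^∞⟮𝓘(ℝ, B), M; 𝓘(ℝ, W), W⟯, ∀ᶠ y in 𝓝 x, g y = f y := by
  obtain ⟨χ, h1, h2⟩ := exists_bump (B := B) (hU.mem_nhds hx)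
  refine ⟨⟨fun y => χ y • f y, ?_⟩, ?_⟩
  · refine contMDiff_of_tsupport fun y hy => ?_
    have hyU : y ∈ U := h2 (closure_mono (Function.support_smul_subset_left _ _) hy)
    exact χ.contMDiff.contMDiffAt.smul (hf.contMDiffAt (hU.mem_nhds hyU))
  · filter_upwards [h1] with y hy
    simp [hy]

/-- Local frames are the restrictions of global sections. -/
theorem SmoothVB.exists_frame (F : SmoothVB.{uB, uM, v, w} B M) (x : M) :
    ∃ (b : Fin (finrank ℝ F.Model) → Sect F) (U : Set M), IsOpen U ∧ x ∈ U ∧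
      ∀ y ∈ U, LinearIndependent ℝ (fun i => b i y) := by
  let e := trivializationAt F.Model F.Fiber x
  have hx : x ∈ e.baseSet := FiberBundle.mem_baseSet_trivializationAt' x
  let β := finBasis ℝ F.Model
  have h := fun i => exists_sect_eventuallyEq (F := F) e.open_baseSet hx
    (e.contMDiffOn_localFrame_baseSet (I := 𝓘(ℝ, B)) ∞ β i)
  choose b hb using h
  have h2 : ∀ᶠ y in 𝓝 x, y ∈ e.baseSet ∧ ∀ i, b i y = e.localFrame β i y :=
    Filter.Eventually.and (e.open_baseSet.mem_nhds hx) (Filter.eventually_all.2 hb)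
  obtain ⟨U, hU, hUo, hxU⟩ := eventually_nhds_iff.1 h2
  refine ⟨b, U, hUo, hxU, fun y hy => ?_⟩
  obtain ⟨hy1, hy2⟩ := hU y hy
  have : (fun i => b i y) = e.basisAt β hy1 := by
    funext i
    rw [hy2 i, e.localFrame_apply_of_mem_baseSet β hy1]
  rw [this]
  exact (e.basisAt β hy1).linearIndependent

theorem exists_sect_apply_eq {F : SmoothVB.{uB, uM, v, w} B M} {x : M} (e : F.Fiber x) :
    ∃ s : Sect F, s x = e := by
  obtain ⟨b, U, -, hx, hU⟩ := F.exists_frame x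
  let β := basisOfLinearIndependentOfCardEqFinrank' _ (hU x hx) (by simp [F.finrank_fiber])
  refine ⟨∑ i, β.repr e i • b i, ?_⟩
  rw [Sect.sum_apply]
  conv_rhs => rw [← β.sum_repr e]
  refine Finset.sum_congr rfl fun i _ => ?_
  simp [β]

theorem exists_vfield_apply_eq {x : M} (u : TangentSpace 𝓘(ℝ, B) x) :
    ∃ X : VField B M, X x = u :=
  exists_sect_apply_eq (F := tangentVB B M) u

end Bump
end Toolkit
end

noncomputable section

section Derivatives

variable {B : Type uB} [NormedAddCommGroup B] [NormedSpace ℝ B]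
  {M : Type uM} [TopologicalSpace M] [ChartedSpace B M] [IsManifold 𝓘(ℝ, B) ∞ M]

/-! ### Derivatives of functions -/

section Functions

variable {W : Type v} [NormedAddCommGroup W] [NormedSpace ℝ W]

theorem mvfderiv_congr {f g : M → W} {x : M} (h : f =ᶠ[𝓝 x] g) :
    mvfderiv 𝓘(ℝ, B) f x = mvfderiv 𝓘(ℝ, B) g x := by
  ext u
  simp only [mvfderiv]
  rw [h.mfderiv_eq]
  rfl

variable [FiniteDimensional ℝ W]

/-- A smooth vector-valued function as a section of a trivial bundle. -/
def trivialSect (f : C^∞⟮𝓘(ℝ, B), M; 𝓘(ℝ, W), W⟯) : Sect (trivialVB B M W) where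
  toFun x := f x
  contMDiff_toFun x := (contMDiffAt_section x).2 f.contMDiff.contMDiffAt

/-- The derivative of a vector-valued function along a vector field. -/
def dirDeriv (X : VField B M) (f : C^∞⟮𝓘(ℝ, B), M; 𝓘(ℝ, W), W⟯) :
    C^∞⟮𝓘(ℝ, B), M; 𝓘(ℝ, W), W⟯ :=
  ⟨fun x => mvfderiv 𝓘(ℝ, B) f x (X x),
    trivialSect_contMDiff W (OneForm.along (trivialDeriv (trivialSect f)) X)⟩

@[simp] theorem dirDeriv_apply (X : VField B M) (f : C^∞⟮𝓘(ℝ, B), M; 𝓘(ℝ, W), W⟯) (x : M) :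
    dirDeriv X f x = mvfderiv 𝓘(ℝ, B) f x (X x) := rfl

end Functions

/-- The one-form `df ⊗ s`. -/
def OneForm.dsmul {F : SmoothVB.{uB, uM, v, w} B M} (f : C^∞⟮𝓘(ℝ, B), M; 𝓘(ℝ, ℝ), ℝ⟯)
    (s : Sect F) : OneForm F where
  toFun x := (mvfderiv 𝓘(ℝ, B) f x).smulRight (s x)
  contMDiff_toFun := by
    intro x₀
    have h1 := ((contMDiffAt_hom_bundle _).1
      ((trivialDeriv (trivialSect f)).contMDiff.contMDiffAt (x := x₀))).2
    have h2 := (contMDiffAt_section x₀).1 (s.contMDiff.contMDiffAt (x := x₀))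
    refine (contMDiffAt_hom_bundle _).2 ⟨contMDiffAt_id, ?_⟩
    have h3 := (isBoundedBilinearMap_smulRight (𝕜 := ℝ) (E := B) (F := F.Model)).contDiff
      (n := ∞) |>.contMDiff.contMDiffAt.comp x₀ (h1.prodMk_space h2)
    refine h3.congr_of_eventuallyEq ?_
    have hx := FiberBundle.mem_baseSet_trivializationAt' (F := F.Model) (E := F.Fiber) x₀
    filter_upwards [(trivializationAt F.Model F.Fiber x₀).open_baseSet.mem_nhds hx] with x hx
    ext u
    simp [ContinuousLinearMap.inCoordinates, Trivialization.linearMapAt_apply, hx]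
    rfl

@[simp] theorem OneForm.dsmul_apply {F : SmoothVB.{uB, uM, v, w} B M}
    (f : C^∞⟮𝓘(ℝ, B), M; 𝓘(ℝ, ℝ), ℝ⟯) (s : Sect F) (x : M) (u : TangentSpace 𝓘(ℝ, B) x) :
    OneForm.dsmul f s x u = mvfderiv 𝓘(ℝ, B) f x u • s x := rfl

theorem OneForm.along_dsmul {F : SmoothVB.{uB, uM, v, w} B M}
    (f : C^∞⟮𝓘(ℝ, B), M; 𝓘(ℝ, ℝ), ℝ⟯) (s : Sect F) (X : VField B M) :
    (OneForm.dsmul f s).along X = s.smulFun (dirDeriv X f) := by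
  ext x; simp

/-! ### The derivative of a section in the preferred trivialization -/

theorem Sect.localDeriv_congr {F : SmoothVB.{uB, uM, v, w} B M} {s t : Sect F} {x : M}
    (h : ∀ᶠ y in 𝓝 x, s y = t y) : s.localDeriv x = t.localDeriv x := by
  unfold Sect.localDeriv
  rw [mvfderiv_congr]
  filter_upwards [h] with y hy
  rw [hy]

/-- The derivative of a section in the preferred trivialization, as a linear map. -/
def Sect.localDerivₗ {F : SmoothVB.{uB, uM, v, w} B M} (x : M) :
    Sect F →ₗ[ℝ] (TangentSpace 𝓘(ℝ, B) x →L[ℝ] F.Fiber x) where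
  toFun s := s.localDeriv x
  map_add' s t := s.localDeriv_add t x
  map_smul' c s := Sect.localDeriv_smul c s x

theorem mvfderiv_trivialization_smulFun {F : SmoothVB.{uB, uM, v, w} B M}
    (f : C^∞⟮𝓘(ℝ, B), M; 𝓘(ℝ, ℝ), ℝ⟯) (s : Sect F) (x₀ : M) {x : M}
    (hx : x ∈ (trivializationAt F.Model F.Fiber x₀).baseSet) (u : TangentSpace 𝓘(ℝ, B) x) :
    mvfderiv 𝓘(ℝ, B) (fun y => (trivializationAt F.Model F.Fiber x₀ ⟨y, s.smulFun f y⟩).2) x u =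
      f x • mvfderiv 𝓘(ℝ, B) (fun y => (trivializationAt F.Model F.Fiber x₀ ⟨y, s y⟩).2) x u +
      mvfderiv 𝓘(ℝ, B) f x u • (trivializationAt F.Model F.Fiber x₀ ⟨x, s x⟩).2 := by
  have h : (fun y => (trivializationAt F.Model F.Fiber x₀ ⟨y, s.smulFun f y⟩).2) =ᶠ[𝓝 x]
      (f : M → ℝ) • (fun y => (trivializationAt F.Model F.Fiber x₀ ⟨y, s y⟩).2) := by
    filter_upwards [(trivializationAt F.Model F.Fiber x₀).open_baseSet.mem_nhds hx] with y hy
    exact ((trivializationAt F.Model F.Fiber x₀).linear ℝ hy).map_smul _ _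
  have h' : MDifferentiableAt 𝓘(ℝ, B) 𝓘(ℝ, F.Model)
      (fun y => (trivializationAt F.Model F.Fiber x₀ ⟨y, s y⟩).2) x := by
    have h := ((trivializationAt F.Model F.Fiber x₀).contMDiffAt_section_iff hx).1
      (s.contMDiff.contMDiffAt (x := x))
    exact h.mdifferentiableAt (by simp)
  rw [mvfderiv_congr h, mvfderiv_smul (f.contMDiff.mdifferentiable (by simp) x) h']
  simp

theorem Sect.localDeriv_smulFun {F : SmoothVB.{uB, uM, v, w} B M}
    (f : C^∞⟮𝓘(ℝ, B), M; 𝓘(ℝ, ℝ), ℝ⟯) (s : Sect F) (x : M) (u : TangentSpace 𝓘(ℝ, B) x) :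
    (s.smulFun f).localDeriv x u =
      f x • s.localDeriv x u + mvfderiv 𝓘(ℝ, B) f x u • s x := by
  have hx := FiberBundle.mem_baseSet_trivializationAt' (F := F.Model) (E := F.Fiber) x
  simp only [Sect.localDeriv, ContinuousLinearMap.comp_apply]
  rw [mvfderiv_trivialization_smulFun f s x hx u, map_add, map_smul, map_smul]
  congr 2
  rw [Trivialization.symmL_apply _ hx]
  exact Trivialization.symm_apply_apply_mk _ hx _

/-! ### Sections vanishing at a point -/

section Bump

variable [FiniteDimensional ℝ B] [T2Space M]

/-- A section vanishing at `x` is a combination of sections whose coefficients vanish at `x`. -/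
theorem Sect.mem_span_of_apply_eq_zero {F : SmoothVB.{uB, uM, v, w} B M} {s : Sect F} {x : M}
    (hs : s x = 0) : s ∈ Submodule.span ℝ
      {t : Sect F | ∃ (f : C^∞⟮𝓘(ℝ, B), M; 𝓘(ℝ, ℝ), ℝ⟯) (e : Sect F),
        f x = 0 ∧ t = e.smulFun f} := by
  let e := trivializationAt F.Model F.Fiber x
  have hx : x ∈ e.baseSet := FiberBundle.mem_baseSet_trivializationAt' x
  let β := finBasis ℝ F.Model
  have h := fun i => exists_sect_eventuallyEq (F := F) e.open_baseSet hx
    (e.contMDiffOn_localFrame_baseSet (I := 𝓘(ℝ, B)) ∞ β i)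
  choose b hb using h
  have h := fun i => exists_fun_eventuallyEq (B := B) e.open_baseSet hx
    (contMDiffOn_baseSet_localFrameCoeff (I := 𝓘(ℝ, B)) (k := ∞) (e := e) β
      s.contMDiff.contMDiffOn i)
  choose c hc using h
  have h2 : ∀ᶠ y in 𝓝 x, s y = ∑ i, c i y • b i y := by
    filter_upwards [Filter.eventually_all.2 hb, Filter.eventually_all.2 hc,
      e.open_baseSet.mem_nhds hx] with y h1 h2 h3
    rw [e.eq_sum_localFrameCoeff_smul (I := 𝓘(ℝ, B)) (b := β) (s := s) h3]
    refine Finset.sum_congr rfl fun i _ => ?_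
    rw [h1 i, h2 i]
    rfl
  obtain ⟨χ, h3, h4⟩ := exists_bump (B := B) h2
  -- All coefficients vanish at `x`: the `c i` because `s x = 0`, and `1 - χ` because `χ = 1` near
  -- `x`.
  have h5 : s = ∑ i, (b i).smulFun (χ * c i) + s.smulFun (1 - χ) := by
    ext y
    have h6 : χ y • s y = χ y • ∑ i, c i y • b i y := by
      by_cases hy : y ∈ tsupport χ
      · rw [h4 hy]
      · rw [image_eq_zero_of_notMem_tsupport hy]; simp
    simp only [ContMDiffSection.coe_add, Pi.add_apply, Sect.sum_apply, Sect.smulFun_apply,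
      ContMDiffMap.coe_mul, Pi.mul_apply, mul_smul]
    rw [← Finset.smul_sum, ← h6, ← add_smul]
    simp
  rw [h5]
  have hc0 : ∀ i, c i x = 0 := fun i => by
    rw [(hc i).self_of_nhds]
    simp [LinearMap.piApply, hs]
  refine Submodule.add_mem _ (Submodule.sum_mem _ fun i _ => Submodule.subset_span ?_)
    (Submodule.subset_span ?_)
  · exact ⟨_, _, by simp [hc0], rfl⟩
  · exact ⟨_, _, by simp [h3.self_of_nhds], rfl⟩

/-- Reduces additive statements about sections vanishing at `x` to products `f e` with `f x = 0`,
where a Leibniz rule leaves only the term in `df`. Real scalars are absorbed into `f`. -/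
theorem Sect.vanishing_induction {F : SmoothVB.{uB, uM, v, w} B M} {x : M} {p : Sect F → Prop}
    (hzero : p 0) (hadd : ∀ s t, p s → p t → p (s + t))
    (hsmul : ∀ (f : C^∞⟮𝓘(ℝ, B), M; 𝓘(ℝ, ℝ), ℝ⟯) (e : Sect F), f x = 0 → p (e.smulFun f))
    {s : Sect F} (hs : s x = 0) : p s := by
  refine Submodule.closure_induction (p := fun t _ => p t) hzero (fun s t _ _ => hadd s t) ?_
    (Sect.mem_span_of_apply_eq_zero hs)
  rintro c _ ⟨f, e, hf, rfl⟩
  have : c • e.smulFun f = e.smulFun (c • f) := by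
    ext y
    simp [mul_smul]
  rw [this]
  exact hsmul _ _ (by simp [hf])

/-- At a zero the derivative of a section is intrinsic: for `f e` with `f x = 0` both sides are
`df(u) φ(e(x))`. -/
theorem VBHom.localDeriv_map {F : SmoothVB.{uB, uM, v₁, w₁} B M}
    {E : SmoothVB.{uB, uM, v₂, w₂} B M} (φ : VBHom F E) {s : Sect F} {x : M} (hs : s x = 0)
    (u : TangentSpace 𝓘(ℝ, B) x) :
    (φ.map s).localDeriv x u = φ.app x (s.localDeriv x u) := by
  refine Sect.vanishing_induction
    (p := fun s => (φ.map s).localDeriv x u = φ.app x (s.localDeriv x u)) ?_ ?_ ?_ hs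
  · have h1 : φ.map 0 = 0 := φ.mapₗ.map_zero
    have h2 : (0 : Sect F).localDeriv x = 0 := (Sect.localDerivₗ x).map_zero
    have h3 : (0 : Sect E).localDeriv x = 0 := (Sect.localDerivₗ x).map_zero
    simp [h1, h2, h3]
  · intro s t hs ht
    simp [φ.map_add, Sect.localDeriv_add, hs, ht]
  · intro f e hf
    simp [φ.map_smulFun, Sect.localDeriv_smulFun, hf]

/-- The derivative of a section vanishing at `x` can be computed in any trivialization. -/
theorem Sect.mvfderiv_trivialization {F : SmoothVB.{uB, uM, v, w} B M} {s : Sect F} (x₀ : M)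
    {x : M} (hx : x ∈ (trivializationAt F.Model F.Fiber x₀).baseSet) (hs : s x = 0)
    (u : TangentSpace 𝓘(ℝ, B) x) :
    mvfderiv 𝓘(ℝ, B) (fun y => (trivializationAt F.Model F.Fiber x₀ ⟨y, s y⟩).2) x u =
      (trivializationAt F.Model F.Fiber x₀ ⟨x, s.localDeriv x u⟩).2 := by
  let L := (trivializationAt F.Model F.Fiber x₀).linearEquivAt ℝ x hx
  have hmd : ∀ t : Sect F, MDifferentiableAt 𝓘(ℝ, B) 𝓘(ℝ, F.Model)
      (fun y => (trivializationAt F.Model F.Fiber x₀ ⟨y, t y⟩).2) x := fun t =>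
    (((trivializationAt F.Model F.Fiber x₀).contMDiffAt_section_iff hx).1
      (t.contMDiff.contMDiffAt (x := x))).mdifferentiableAt (by simp)
  change _ = L (s.localDeriv x u)
  refine Sect.vanishing_induction (p := fun s => mvfderiv 𝓘(ℝ, B)
    (fun y => (trivializationAt F.Model F.Fiber x₀ ⟨y, s y⟩).2) x u = L (s.localDeriv x u)) ?_ ?_ ?_ hs
  · have h2 : (0 : Sect F).localDeriv x = 0 := (Sect.localDerivₗ x).map_zero
    have h : (fun y => (trivializationAt F.Model F.Fiber x₀ ⟨y, (0 : Sect F) y⟩).2) =ᶠ[𝓝 x]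
        fun _ => 0 := by
      filter_upwards [(trivializationAt F.Model F.Fiber x₀).open_baseSet.mem_nhds hx] with y hy
      exact ((trivializationAt F.Model F.Fiber x₀).linear ℝ hy).map_zero
    rw [mvfderiv_congr h, h2, mvfderiv_const]
    simp
  · intro s t hs ht
    have h : (fun y => (trivializationAt F.Model F.Fiber x₀ ⟨y, (s + t) y⟩).2) =ᶠ[𝓝 x]
        (fun y => (trivializationAt F.Model F.Fiber x₀ ⟨y, s y⟩).2) +
        (fun y => (trivializationAt F.Model F.Fiber x₀ ⟨y, t y⟩).2) := by
      filter_upwards [(trivializationAt F.Model F.Fiber x₀).open_baseSet.mem_nhds hx] with y hy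
      exact ((trivializationAt F.Model F.Fiber x₀).linear ℝ hy).map_add _ _
    rw [mvfderiv_congr h, mvfderiv_add (hmd s) (hmd t), Sect.localDeriv_add]
    simp [hs, ht]
  · intro f e hf
    rw [mvfderiv_trivialization_smulFun f e x₀ hx u, Sect.localDeriv_smulFun, hf]
    simp only [zero_smul, zero_add, map_smul]
    rfl

namespace RelConn

variable {F : SmoothVB.{uB, uM, v₁, w₁} B M} {E : SmoothVB.{uB, uM, v₂, w₂} B M}
  (D : RelConn F E)

/-- For `f e` with `f x = 0` the Leibniz rule leaves `df · l(e)`. Thus `D` is a first-order operator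
with principal symbol `l`, and every comparison of `D` at a point goes through this formula. -/
theorem D_apply_of_eq_zero {s : Sect F} {x : M} (hs : s x = 0) (u : TangentSpace 𝓘(ℝ, B) x) :
    D.D s x u = D.l.app x (s.localDeriv x u) := by
  refine Sect.vanishing_induction
    (p := fun s => D.D s x u = D.l.app x (s.localDeriv x u)) ?_ ?_ ?_ hs
  · have h2 : (0 : Sect F).localDeriv x = 0 := (Sect.localDerivₗ x).map_zero
    simp [h2]
  · intro s t hs ht
    simp [Sect.localDeriv_add, hs, ht]
  · intro f e hf
    simp [D.leibniz, Sect.localDeriv_smulFun, hf]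

/-- Locality is not assumed; it follows because the difference has zero value and zero derivative at
`x`. -/
theorem D_congr {s t : Sect F} {x : M} (h : ∀ᶠ y in 𝓝 x, s y = t y) : D.D s x = D.D t x := by
  have h1 : ∀ᶠ y in 𝓝 x, (s - t) y = (0 : Sect F) y := by
    filter_upwards [h] with y hy
    simp [hy]
  have h2 : (0 : Sect F).localDeriv x = 0 := (Sect.localDerivₗ x).map_zero
  have h3 : D.D (s - t) x = 0 := by
    ext u
    rw [D.D_apply_of_eq_zero (by simpa using h1.self_of_nhds), Sect.localDeriv_congr h1, h2]
    simp
  rw [map_sub] at h3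
  exact sub_eq_zero.1 h3

/-- Expansion of `D` in terms of sections `b i`. -/
theorem D_apply_of_eventuallyEq_sum {ι : Type*} [Fintype ι] {s : Sect F} {x : M}
    {b : ι → Sect F} {c : ι → C^∞⟮𝓘(ℝ, B), M; 𝓘(ℝ, ℝ), ℝ⟯}
    (h : ∀ᶠ y in 𝓝 x, s y = ∑ i, c i y • b i y) (u : TangentSpace 𝓘(ℝ, B) x) :
    D.D s x u = ∑ i, (c i x • D.D (b i) x u + mvfderiv 𝓘(ℝ, B) (c i) x u • D.l.app x (b i x)) := by
  have h1 : D.D s x = D.D (∑ i, (b i).smulFun (c i)) x := D.D_congr (by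
    filter_upwards [h] with y hy
    rw [hy, Sect.sum_apply]
    rfl)
  rw [h1, map_sum, OneForm.sum_apply, _root_.sum_apply]
  simp [D.leibniz]

/-- Symbols are well defined. -/
theorem D_apply_eq_of_ker {s t : Sect F} (hs : ∀ y, D.l.app y (s y) = 0)
    (ht : ∀ y, D.l.app y (t y) = 0) {x : M} (h : s x = t x) : D.D s x = D.D t x := by
  have h0 : (s - t) x = 0 := by simp [h]
  have h1 : D.l.map (s - t) = 0 := by
    ext y
    simp [hs, ht]
  have h2 : (0 : Sect E).localDeriv x = 0 := (Sect.localDerivₗ x).map_zero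
  -- At a common value, `D(s - t)` is `l` of the derivative of `s - t`, hence the derivative of `l(s
  -- - t)`, which is identically zero.
  have h3 : D.D (s - t) x = 0 := by
    ext u
    rw [D.D_apply_of_eq_zero h0, ← D.l.localDeriv_map h0, h1, h2]
  rw [map_sub] at h3
  exact sub_eq_zero.1 h3

end RelConn

/-! ### Lie brackets of vector fields as derivations -/

theorem VField.contMDiff_mlieBracket (X Y : VField B M) :
    ContMDiff 𝓘(ℝ, B) (𝓘(ℝ, B).prod 𝓘(ℝ, B)) ∞
      (fun x => (TotalSpace.mk' B x (VectorField.mlieBracket 𝓘(ℝ, B) X Y x) :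
        TangentBundle 𝓘(ℝ, B) M)) := by
  intro x
  have h : IsManifold 𝓘(ℝ, B) (∞ + 1) M := ‹IsManifold 𝓘(ℝ, B) ∞ M›
  have : IsManifold 𝓘(ℝ, B) (minSmoothness ℝ 2) M := IsManifold.of_le (n := ∞) (by
    rw [minSmoothness_of_isRCLikeNormedField]
    norm_cast)
  exact ContMDiffAt.mlieBracket_vectorField (m := (⊤ : ℕ∞)) (n := (⊤ : ℕ∞))
    X.contMDiff.contMDiffAt Y.contMDiff.contMDiffAt (by simp)

/-- The Lie bracket of vector fields. -/
def VField.lie (X Y : VField B M) : VField B M where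
  toFun := VectorField.mlieBracket 𝓘(ℝ, B) X Y
  contMDiff_toFun := X.contMDiff_mlieBracket Y

/-- The vector field `f X`. -/
def VField.smulVF (X : VField B M) (f : C^∞⟮𝓘(ℝ, B), M; 𝓘(ℝ, ℝ), ℝ⟯) : VField B M where
  toFun x := f x • X x
  contMDiff_toFun := f.contMDiff.smul_section X.contMDiff

theorem mlieBracket_smulFun (X Y : VField B M) (f : C^∞⟮𝓘(ℝ, B), M; 𝓘(ℝ, ℝ), ℝ⟯) (x : M) :
    VectorField.mlieBracket 𝓘(ℝ, B) X (fun y => f y • Y y) x =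
      dirDeriv X f x • Y x + f x • VectorField.mlieBracket 𝓘(ℝ, B) X Y x := by
  have : IsManifold 𝓘(ℝ, B) 2 M := IsManifold.of_le (n := ∞) (by norm_cast)
  exact VectorField.mlieBracket_smul_right (f.contMDiff.mdifferentiable (by simp) x)
    (Y.contMDiff.mdifferentiable (by simp) x)

/-- Derived from the Jacobi identity: replacing `Z` by `f Z` in it and expanding with the product
rule isolates the action of `[X, Y]` on `f` as the coefficient of `Z`. -/
theorem mvfderiv_mlieBracket (X Y : VField B M) (f : C^∞⟮𝓘(ℝ, B), M; 𝓘(ℝ, ℝ), ℝ⟯) (x : M) :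
    mvfderiv 𝓘(ℝ, B) f x (VectorField.mlieBracket 𝓘(ℝ, B) X Y x) =
      dirDeriv X (dirDeriv Y f) x - dirDeriv Y (dirDeriv X f) x := by
  have : IsManifold 𝓘(ℝ, B) 2 M := IsManifold.of_le (n := ∞) (by norm_cast)
  -- In dimension zero no field is nonzero at `x`, but then all derivatives vanish.
  rcases subsingleton_or_nontrivial B with hB | hB
  · have h : ∀ (g : C^∞⟮𝓘(ℝ, B), M; 𝓘(ℝ, ℝ), ℝ⟯) (u : TangentSpace 𝓘(ℝ, B) x),
        mvfderiv 𝓘(ℝ, B) g x u = 0 := fun g u => by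
      have : u = 0 := @Subsingleton.elim _ hB u 0
      rw [this, map_zero]
    simp [h]
  obtain ⟨z, hz⟩ := exists_ne (0 : B)
  obtain ⟨Z, hZ⟩ := exists_vfield_apply_eq (x := x) (show TangentSpace 𝓘(ℝ, B) x from z)
  have hZ0 : Z x ≠ 0 := by rw [hZ]; exact hz
  have hmd : ∀ Y : VField B M, MDifferentiableAt 𝓘(ℝ, B) (𝓘(ℝ, B).prod 𝓘(ℝ, B))
      (fun y => (TotalSpace.mk' B y (Y y) : TangentBundle 𝓘(ℝ, B) M)) x := fun Y =>
    Y.contMDiff.mdifferentiable (by simp) x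
  have hsmul : ∀ X Y : VField B M, VectorField.mlieBracket 𝓘(ℝ, B) X (Y.smulVF f) =
      ((Y.smulVF (dirDeriv X f) : VField B M) : ∀ y, TangentSpace 𝓘(ℝ, B) y) +
        ((X.lie Y).smulVF f : VField B M) := by
    intro X Y
    funext y
    exact mlieBracket_smulFun X Y f y
  have hle : minSmoothness ℝ 2 ≤ (∞ : ℕ∞ω) := by
    rw [minSmoothness_of_isRCLikeNormedField]
    norm_cast
  have : IsManifold 𝓘(ℝ, B) (minSmoothness ℝ 3) M := IsManifold.of_le (n := ∞) (by
    rw [minSmoothness_of_isRCLikeNormedField]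
    norm_cast)
  have hJ : ∀ X Y Z : VField B M, _ := fun X Y Z =>
    VectorField.leibniz_identity_mlieBracket_apply (I := 𝓘(ℝ, B)) (x := x)
    (X.contMDiff.contMDiffAt.of_le hle) (Y.contMDiff.contMDiffAt.of_le hle)
    (Z.contMDiff.contMDiffAt.of_le hle)
  have hd : ∀ X Y : VField B M, VectorField.mlieBracket 𝓘(ℝ, B) X
      (VectorField.mlieBracket 𝓘(ℝ, B) Y (Z.smulVF f)) x =
      dirDeriv X (dirDeriv Y f) x • Z x + dirDeriv Y f x • VectorField.mlieBracket 𝓘(ℝ, B) X Z x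
      + (dirDeriv X f x • VectorField.mlieBracket 𝓘(ℝ, B) Y Z x +
      f x • VectorField.mlieBracket 𝓘(ℝ, B) X (VectorField.mlieBracket 𝓘(ℝ, B) Y Z) x) := by
    intro X Y
    rw [hsmul Y Z, VectorField.mlieBracket_add_right (hmd _) (hmd _)]
    exact congrArg₂ (· + ·) (mlieBracket_smulFun X Z (dirDeriv Y f) x)
      (mlieBracket_smulFun X (Y.lie Z) f x)
  -- Jacobi for `X, Y, f Z` minus `f` times Jacobi for `X, Y, Z`: the terms in `[X, Z]` and `[Y, Z]`
  -- cancel, and a multiple of `Z x ≠ 0` remains.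
  have h1 := hJ X Y (Z.smulVF f)
  have h2 := hJ X Y Z
  have h3 : VectorField.mlieBracket 𝓘(ℝ, B) (VectorField.mlieBracket 𝓘(ℝ, B) X Y)
      (Z.smulVF f) x = dirDeriv (X.lie Y) f x • Z x +
        f x • VectorField.mlieBracket 𝓘(ℝ, B) (VectorField.mlieBracket 𝓘(ℝ, B) X Y) Z x :=
    mlieBracket_smulFun (X.lie Y) Z f x
  rw [hd X Y, hd Y X, h3, h2, smul_add] at h1
  have h4 : (dirDeriv (X.lie Y) f x - (dirDeriv X (dirDeriv Y f) x - dirDeriv Y (dirDeriv X f) x)) •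
      Z x = 0 := by
    linear_combination (norm := module) (-1 : ℝ) • h1
  exact sub_eq_zero.1 ((smul_eq_zero.1 h4).resolve_right hZ0)

end Bump
end Derivatives
end

noncomputable section

section Coefficients

variable {B : Type uB} [NormedAddCommGroup B] [NormedSpace ℝ B]
  {M : Type uM} [TopologicalSpace M] [ChartedSpace B M] [IsManifold 𝓘(ℝ, B) ∞ M]

/-! ### Smoothness of coefficients -/

/-- The coefficients of a smooth vector-valued function with respect to linearly independent smooth
functions are smooth. -/
theorem contMDiffAt_coeff {ι : Type*} [Fintype ι] {W : Type*} [NormedAddCommGroup W]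
    [NormedSpace ℝ W] [FiniteDimensional ℝ W] {g : ι → M → W} {c : M → ι → ℝ} {h : M → W} {x : M}
    (hg : ∀ i, ContMDiffAt 𝓘(ℝ, B) 𝓘(ℝ, W) ∞ (g i) x) (hh : ContMDiffAt 𝓘(ℝ, B) 𝓘(ℝ, W) ∞ h x)
    (hli : LinearIndependent ℝ (fun i => g i x))
    (heq : ∀ᶠ y in 𝓝 x, h y = ∑ i, c y i • g i y) :
    ContMDiffAt 𝓘(ℝ, B) 𝓘(ℝ, ι → ℝ) ∞ c x := by
  classical
  have hker : LinearMap.ker (Fintype.linearCombination ℝ (fun i => g i x)) = ⊥ :=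
    LinearMap.ker_eq_bot.2 (linearIndependent_iff_injective_fintypeLinearCombination.1 hli)
  obtain ⟨L, hL⟩ := LinearMap.exists_leftInverse_of_injective _ hker
  -- `T y` composes the frame at `y` with a left inverse of the frame at `x`. It is the identity at
  -- `x`, hence invertible nearby, and `c y = (T y)⁻¹ (L' (h y))` is smooth.
  let L' : W →L[ℝ] (ι → ℝ) := LinearMap.toContinuousLinearMap L
  let T : M → ((ι → ℝ) →L[ℝ] (ι → ℝ)) := fun y =>
    ∑ i, (ContinuousLinearMap.proj (R := ℝ) (φ := fun _ : ι => ℝ) i).smulRight (L' (g i y))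
  have hT : ∀ y a, T y a = L' (∑ i, a i • g i y) := by
    intro y a
    simp [T]
  have hT1 : T x = 1 := by
    ext1 a
    rw [hT]
    exact congrArg (fun φ => φ a) hL
  have hTs : ContMDiffAt 𝓘(ℝ, B) 𝓘(ℝ, (ι → ℝ) →L[ℝ] (ι → ℝ)) ∞ T x := by
    refine ContMDiffAt.sum fun i _ => ?_
    have h1 : ContDiff ℝ ∞ (fun w : W =>
        (ContinuousLinearMap.proj (R := ℝ) (φ := fun _ : ι => ℝ) i).smulRight (L' w)) :=
      ((isBoundedBilinearMap_smulRight (𝕜 := ℝ) (E := ι → ℝ) (F := ι → ℝ)).contDiff).comp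
        (contDiff_const.prodMk L'.contDiff)
    exact h1.contMDiff.contMDiffAt.comp x (hg i)
  have hTi : ContMDiffAt 𝓘(ℝ, B) 𝓘(ℝ, (ι → ℝ) →L[ℝ] (ι → ℝ)) ∞ (fun y => Ring.inverse (T y)) x := by
    have h1 : ContDiffAt ℝ ∞ (Ring.inverse : ((ι → ℝ) →L[ℝ] (ι → ℝ)) → _) (T x) := by
      rw [hT1]
      exact contDiffAt_ringInverse ℝ (1 : ((ι → ℝ) →L[ℝ] (ι → ℝ))ˣ)
    exact h1.contMDiffAt.comp x hTs
  have hLh : ContMDiffAt 𝓘(ℝ, B) 𝓘(ℝ, ι → ℝ) ∞ (fun y => L' (h y)) x :=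
    L'.contMDiff.contMDiffAt.comp x hh
  refine (hTi.clm_apply hLh).congr_of_eventuallyEq ?_
  have hu : ∀ᶠ y in 𝓝 x, IsUnit (T y) := by
    have : {A : (ι → ℝ) →L[ℝ] (ι → ℝ) | IsUnit A} ∈ 𝓝 (T x) :=
      Units.isOpen.mem_nhds (by rw [hT1]; exact isUnit_one)
    exact hTs.continuousAt.eventually this
  filter_upwards [hu, heq] with y h1 h2
  rw [h2, ← hT, ← mul_apply_eq_comp, Ring.inverse_mul_cancel _ h1]
  rfl

/-- The coefficients of a smooth section with respect to linearly independent smooth sections are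
smooth. -/
theorem contMDiffAt_coeff_sect {K : SmoothVB.{uB, uM, v, w} B M} {ι : Type*} [Fintype ι]
    {b : ι → Sect K} {c : M → ι → ℝ} {s : ∀ y, K.Fiber y} {x : M}
    (hs : ContMDiffAt 𝓘(ℝ, B) (𝓘(ℝ, B).prod 𝓘(ℝ, K.Model)) ∞
      (fun y => TotalSpace.mk' K.Model y (s y)) x)
    (hli : LinearIndependent ℝ (fun i => b i x))
    (heq : ∀ᶠ y in 𝓝 x, s y = ∑ i, c y i • b i y) :
    ContMDiffAt 𝓘(ℝ, B) 𝓘(ℝ, ι → ℝ) ∞ c x := by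
  have hx : x ∈ (trivializationAt K.Model K.Fiber x).baseSet :=
    FiberBundle.mem_baseSet_trivializationAt' x
  refine contMDiffAt_coeff (g := fun i y => (trivializationAt K.Model K.Fiber x ⟨y, b i y⟩).2)
    (h := fun y => (trivializationAt K.Model K.Fiber x ⟨y, s y⟩).2)
    (fun i => (contMDiffAt_section x).1 (b i).contMDiff.contMDiffAt)
    ((contMDiffAt_section x).1 hs) ?_ ?_
  · exact hli.map' _ ((trivializationAt K.Model K.Fiber x).linearEquivAt ℝ x hx).ker
  · filter_upwards [heq, (trivializationAt K.Model K.Fiber x).open_baseSet.mem_nhds hx] with y h1 h2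
    let L := (trivializationAt K.Model K.Fiber x).linearEquivAt ℝ y h2
    have := congrArg L h1
    rw [map_sum] at this
    simp only [map_smul] at this
    exact this

theorem eventually_linearIndependent {K : SmoothVB.{uB, uM, v, w} B M} {ι : Type*} [Finite ι]
    {b : ι → Sect K} {x : M} (hli : LinearIndependent ℝ (fun i => b i x)) :
    ∀ᶠ y in 𝓝 x, LinearIndependent ℝ (fun i => b i y) := by
  have hx : x ∈ (trivializationAt K.Model K.Fiber x).baseSet :=
    FiberBundle.mem_baseSet_trivializationAt' x
  have h1 : LinearIndependent ℝ (fun i => (trivializationAt K.Model K.Fiber x ⟨x, b i x⟩).2) :=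
    hli.map' _ ((trivializationAt K.Model K.Fiber x).linearEquivAt ℝ x hx).ker
  have h2 : ContinuousAt (fun y i => (trivializationAt K.Model K.Fiber x ⟨y, b i y⟩).2) x :=
    continuousAt_pi.2 fun i =>
      ((contMDiffAt_section x).1 (b i).contMDiff.contMDiffAt).continuousAt
  filter_upwards [h2.eventually h1.eventually,
    (trivializationAt K.Model K.Fiber x).open_baseSet.mem_nhds hx] with y h1 h2
  exact LinearIndependent.of_comp
    ((trivializationAt K.Model K.Fiber x).linearEquivAt ℝ y h2).toLinearMap h1

section Bump

variable [FiniteDimensional ℝ B] [T2Space M]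

/-- Smooth coefficient functions of a section with respect to a local frame. -/
theorem exists_coeff {K : SmoothVB.{uB, uM, v, w} B M} {ι : Type*} [Fintype ι]
    {b : ι → Sect K} {x : M} (hli : LinearIndependent ℝ (fun i => b i x))
    (hcard : Fintype.card ι = finrank ℝ K.Model) (s : Sect K) :
    ∃ c : ι → C^∞⟮𝓘(ℝ, B), M; 𝓘(ℝ, ℝ), ℝ⟯, ∀ᶠ y in 𝓝 x, s y = ∑ i, c i y • b i y := by
  classical
  obtain ⟨U, hU, hUo, hxU⟩ := eventually_nhds_iff.1 (eventually_linearIndependent hli)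
  have h1 : ∀ y, ∃ a : ι → ℝ, y ∈ U → s y = ∑ i, a i • b i y := by
    intro y
    by_cases hy : y ∈ U
    · let β := basisOfLinearIndependentOfCardEqFinrank' _ (hU y hy)
        (by rw [hcard, K.finrank_fiber])
      refine ⟨β.repr (s y), fun _ => ?_⟩
      conv_lhs => rw [← β.sum_repr (s y)]
      simp [β]
    · exact ⟨0, fun h => (hy h).elim⟩
  choose c hc using h1
  have h2 : ContMDiffOn 𝓘(ℝ, B) 𝓘(ℝ, ι → ℝ) ∞ c U := fun y hy =>
    (contMDiffAt_coeff_sect (s := s) s.contMDiff.contMDiffAt (hU y hy)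
      (Filter.eventually_of_mem (hUo.mem_nhds hy) fun z hz => hc z hz)).contMDiffWithinAt
  have h3 : ∀ i, ∃ g : C^∞⟮𝓘(ℝ, B), M; 𝓘(ℝ, ℝ), ℝ⟯, ∀ᶠ y in 𝓝 x, g y = c y i := fun i =>
    exists_fun_eventuallyEq (B := B) hUo hxU
      ((ContinuousLinearMap.proj (R := ℝ) (φ := fun _ : ι => ℝ) i).contMDiff.comp_contMDiffOn h2)
  choose g hg using h3
  refine ⟨g, ?_⟩
  filter_upwards [Filter.eventually_all.2 hg, hUo.mem_nhds hxU] with y h1 h2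
  rw [hc y h2]
  simp [h1]

/-- Through every vector in the kernel of a fibrewise surjective bundle map there is a section of
the kernel. -/
theorem VBHom.exists_sect_ker {F : SmoothVB.{uB, uM, v₁, w₁} B M}
    {E : SmoothVB.{uB, uM, v₂, w₂} B M} (l : VBHom F E) {x : M}
    (hl : Function.Surjective (l.app x)) {e : F.Fiber x} (he : l.app x e = 0) :
    ∃ s : Sect F, (∀ y, l.app y (s y) = 0) ∧ s x = e := by
  let β := finBasis ℝ (E.Fiber x)
  choose t' ht' using fun i => hl (β i)
  choose t ht using fun i => exists_sect_apply_eq (t' i)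
  obtain ⟨s₀, hs₀⟩ := exists_sect_apply_eq e
  have hli : LinearIndependent ℝ (fun i => l.map (t i) x) := by
    have : (fun i => l.map (t i) x) = β := by
      funext i
      simp [ht, ht']
    rw [this]
    exact β.linearIndependent
  -- The sections `t i` lift a local frame of `E`. Subtracting from `s₀` the lift of `l(s₀)` puts it
  -- in the kernel near `x`; the coefficients of `l(s₀)` vanish at `x`, so the value there is
  -- unchanged. A bump function then makes the result global.
  obtain ⟨c, hc⟩ := exists_coeff hli (by simp [E.finrank_fiber]) (l.map s₀)
  obtain ⟨χ, h1, h2⟩ := exists_bump (B := B) hc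
  have hc0 : ∀ i, c i x = 0 := by
    have h3 := hc.self_of_nhds
    simp only [VBHom.map_apply, hs₀, he] at h3
    exact Fintype.linearIndependent_iff.1 hli _ h3.symm
  refine ⟨(s₀ - ∑ i, (t i).smulFun (c i)).smulFun χ, fun y => ?_, ?_⟩
  · by_cases hy : y ∈ tsupport χ
    · have h3 := h2 hy
      simp only [VBHom.map_apply, mem_ofPred_eq] at h3
      simp [Sect.sum_apply, h3]
    · simp [image_eq_zero_of_notMem_tsupport hy]
  · simp [h1.self_of_nhds, Sect.sum_apply, hc0, hs₀]

/-! ### Coordinates -/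

theorem mvfderiv_comp_apply' {W W' : Type*} [NormedAddCommGroup W] [NormedSpace ℝ W]
    [NormedAddCommGroup W'] [NormedSpace ℝ W'] {f : W → W'} {g : M → W} {x : M}
    (hf : DifferentiableAt ℝ f (g x)) (hg : MDifferentiableAt 𝓘(ℝ, B) 𝓘(ℝ, W) g x)
    (u : TangentSpace 𝓘(ℝ, B) x) :
    mvfderiv 𝓘(ℝ, B) (fun y => f (g y)) x u = fderiv ℝ f (g x) (mvfderiv 𝓘(ℝ, B) g x u) := by
  have h := mfderiv_comp_apply x hf.mdifferentiableAt hg u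
  rw [mfderiv_eq_fderiv] at h
  exact h

/-- A chart, extended to a global function, and its coordinate vector fields. -/
structure CoordSystem (U : Set M) (x₀ : M) where
  coord : C^∞⟮𝓘(ℝ, B), M; 𝓘(ℝ, B), B⟯
  field : B →ₗ[ℝ] VField B M
  isOpen : IsOpen U
  mem : x₀ ∈ U
  subset : U ⊆ (extChartAt 𝓘(ℝ, B) x₀).source
  coord_eq : ∀ y ∈ U, coord y = extChartAt 𝓘(ℝ, B) x₀ y
  coord_field : ∀ y ∈ U, ∀ u, mvfderiv 𝓘(ℝ, B) coord y (field u y) = u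
  field_coord : ∀ y ∈ U, ∀ u : TangentSpace 𝓘(ℝ, B) y,
    field (mvfderiv 𝓘(ℝ, B) coord y u) y = u

/-- In the preferred trivialization of the tangent bundle at `x₀`, the derivative of the chart is
the trivialization itself. The frame of that trivialization therefore consists of the coordinate
fields; chart and frame are cut off to global objects. -/
theorem exists_coordSystem (x₀ : M) : ∃ U : Set M, Nonempty (CoordSystem (B := B) U x₀) := by
  let e := trivializationAt B (TangentSpace 𝓘(ℝ, B)) x₀
  have hx : x₀ ∈ e.baseSet := FiberBundle.mem_baseSet_trivializationAt' x₀
  let β := finBasis ℝ B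
  have h := fun i => exists_sect_eventuallyEq (F := tangentVB B M) e.open_baseSet hx
    (e.contMDiffOn_localFrame_baseSet (I := 𝓘(ℝ, B)) ∞ β i)
  choose b hb using h
  have hsrc : IsOpen (extChartAt 𝓘(ℝ, B) x₀).source := isOpen_extChartAt_source x₀
  have hmem : x₀ ∈ (extChartAt 𝓘(ℝ, B) x₀).source := mem_extChartAt_source x₀
  have hsm : ContMDiffOn 𝓘(ℝ, B) 𝓘(ℝ, B) ∞ (extChartAt 𝓘(ℝ, B) x₀)
      (extChartAt 𝓘(ℝ, B) x₀).source := by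
    rw [extChartAt_source]
    exact contMDiffOn_extChartAt
  obtain ⟨ξ, hξ⟩ := exists_fun_eventuallyEq (B := B) hsrc hmem hsm
  have h2 : ∀ᶠ y in 𝓝 x₀, y ∈ e.baseSet ∧ y ∈ (extChartAt 𝓘(ℝ, B) x₀).source ∧
      (∀ i, b i y = e.localFrame β i y) ∧ ξ y = extChartAt 𝓘(ℝ, B) x₀ y := by
    filter_upwards [e.open_baseSet.mem_nhds hx, hsrc.mem_nhds hmem, Filter.eventually_all.2 hb, hξ]
      with y h1 h2 h3 h4
    exact ⟨h1, h2, h3, h4⟩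
  obtain ⟨U, hU, hUo, hxU⟩ := eventually_nhds_iff.1 h2
  let X : B →ₗ[ℝ] VField B M := β.constr ℝ b
  have hX : ∀ y ∈ U, ∀ u, X u y = e.symmL ℝ y u := by
    intro y hy u
    obtain ⟨h1, -, h3, -⟩ := hU y hy
    have h5 : (Sect.evalAt (F := tangentVB B M) y).comp X = (e.symmL ℝ y).toLinearMap := by
      refine β.ext fun i => ?_
      change X (β i) y = _
      rw [β.constr_basis, h3 i, e.localFrame_apply_of_mem_baseSet β h1, Trivialization.basisAt]
      simp only [Basis.map_apply]
      exact (e.symmL_apply h1 _).symm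
    exact congrArg (fun φ => φ u) h5
  have hd : ∀ y ∈ U, ∀ u, mvfderiv 𝓘(ℝ, B) ξ y u = e.continuousLinearMapAt ℝ y u := by
    intro y hy u
    obtain ⟨h1, h2, -, -⟩ := hU y hy
    have h3 : ξ =ᶠ[𝓝 y] extChartAt 𝓘(ℝ, B) x₀ :=
      Filter.eventually_of_mem (hUo.mem_nhds hy) fun z hz => (hU z hz).2.2.2
    rw [mvfderiv_congr h3, TangentBundle.continuousLinearMapAt_trivializationAt
      (by simpa using h2)]
    rfl
  refine ⟨U, ⟨⟨ξ, X, hUo, hxU, fun y hy => (hU y hy).2.1, fun y hy => (hU y hy).2.2.2, ?_, ?_⟩⟩⟩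
  · intro y hy u
    rw [hd y hy, hX y hy]
    exact e.continuousLinearMapAt_symmL (hU y hy).1 u
  · intro y hy u
    rw [hd y hy, hX y hy]
    exact e.symmL_continuousLinearMapAt (hU y hy).1 u

/-- A function with prescribed differential at a point. -/
theorem exists_fun_mvfderiv_eq {x : M} (a : TangentSpace 𝓘(ℝ, B) x →L[ℝ] ℝ) :
    ∃ f : C^∞⟮𝓘(ℝ, B), M; 𝓘(ℝ, ℝ), ℝ⟯, mvfderiv 𝓘(ℝ, B) f x = a := by
  obtain ⟨U, ⟨S⟩⟩ := exists_coordSystem (B := B) x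
  let A : B →L[ℝ] ℝ := LinearMap.toContinuousLinearMap
    (a.toLinearMap.comp ((Sect.evalAt (F := tangentVB B M) x).comp S.field))
  refine ⟨⟨fun y => A (S.coord y), A.contMDiff.comp S.coord.contMDiff⟩, ?_⟩
  ext u
  refine (mvfderiv_comp_apply' A.differentiableAt
    (S.coord.contMDiff.mdifferentiable (by simp) x) u).trans ?_
  rw [A.fderiv]
  change a (S.field (mvfderiv 𝓘(ℝ, B) S.coord x u) x) = a u
  rw [S.field_coord x S.mem]

/-- Linear functions of the coordinates have locally constant derivatives along coordinate fields,
so the bracket annihilates all of them. -/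
theorem mlieBracket_field {U : Set M} {x₀ : M} (S : CoordSystem (B := B) U x₀) (u v : B) {y : M}
    (hy : y ∈ U) : VectorField.mlieBracket 𝓘(ℝ, B) (S.field u) (S.field v) y = 0 := by
  have hS : ∀ y, MDifferentiableAt 𝓘(ℝ, B) 𝓘(ℝ, B) S.coord y :=
    S.coord.contMDiff.mdifferentiable (by simp)
  have key : mvfderiv 𝓘(ℝ, B) S.coord y
      (VectorField.mlieBracket 𝓘(ℝ, B) (S.field u) (S.field v) y) = 0 := by
    refine SeparatingDual.eq_zero_of_forall_dual_eq_zero (R := ℝ) fun a => ?_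
    let f : C^∞⟮𝓘(ℝ, B), M; 𝓘(ℝ, ℝ), ℝ⟯ :=
      ⟨fun y => a (S.coord y), a.contMDiff.comp S.coord.contMDiff⟩
    have h1 : ∀ (z : M) (w : TangentSpace 𝓘(ℝ, B) z),
        mvfderiv 𝓘(ℝ, B) f z w = a (mvfderiv 𝓘(ℝ, B) S.coord z w) := fun z w => by
      refine (mvfderiv_comp_apply' a.differentiableAt (hS z) w).trans ?_
      rw [a.fderiv]
    have h2 : ∀ v, (dirDeriv (S.field v) f : M → ℝ) =ᶠ[𝓝 y] fun _ => a v := fun v =>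
      Filter.eventually_of_mem (S.isOpen.mem_nhds hy) fun z hz => by
        simp only [dirDeriv_apply]
        rw [h1, S.coord_field z hz]
    have h3 := mvfderiv_mlieBracket (S.field u) (S.field v) f y
    rw [dirDeriv_apply, dirDeriv_apply, mvfderiv_congr (h2 v), mvfderiv_congr (h2 u),
      mvfderiv_const, mvfderiv_const, h1] at h3
    simpa using h3
  rw [← S.field_coord y hy (VectorField.mlieBracket 𝓘(ℝ, B) (S.field u) (S.field v) y), key,
    map_zero]
  rfl

end Bump
end Coefficients
end

/-! ### The curvature and the first prolongation -/

noncomputable section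

section Prolongation

variable {B : Type uB} [NormedAddCommGroup B] [NormedSpace ℝ B]
  {M : Type uM} [TopologicalSpace M] [ChartedSpace B M] [IsManifold 𝓘(ℝ, B) ∞ M]
  [FiniteDimensional ℝ B] [T2Space M]

instance finiteDimensional_tangentSpace (x : M) :
    FiniteDimensional ℝ (TangentSpace 𝓘(ℝ, B) x) := inferInstanceAs (FiniteDimensional ℝ B)

instance t2Space_tangentSpace (x : M) : T2Space (TangentSpace 𝓘(ℝ, B) x) :=
  inferInstanceAs (T2Space B)

namespace RelConn

/-! ### The curvature is tensorial -/

section Curvature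

variable {F : SmoothVB.{uB, uM, v₁, w₁} B M} {E : SmoothVB.{uB, uM, v₂, w₂} B M}
  (D : RelConn F E)

/-- The second derivatives of `f` cancel, since `X(Yf) - Y(Xf) = [X, Y]f`. -/
theorem curvature_dsmul (f : C^∞⟮𝓘(ℝ, B), M; 𝓘(ℝ, ℝ), ℝ⟯) (e : Sect F) (X Y : VField B M)
    (x : M) : D.curvature (OneForm.dsmul f e) X Y x =
      mvfderiv 𝓘(ℝ, B) f x (Y x) • D.D e x (X x) - mvfderiv 𝓘(ℝ, B) f x (X x) • D.D e x (Y x) := by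
  simp only [curvature, OneForm.along_dsmul, D.leibniz, OneForm.dsmul_apply, map_smul,
    mvfderiv_mlieBracket, dirDeriv_apply]
  module

/-- The defect `D α - l ∘ η`, evaluated along a vector field. -/
def defect (α : Sect F) (η : OneForm F) (X : VField B M) : Sect E :=
  (D.D α).along X - D.l.map (η.along X)

/-- For `α = f e` with `f x = 0` take `η = df ⊗ e`: its defect along `X` is `f D_X e`, whose
derivative at `x` along `Y` is `(Yf) D_X e`. The pair `(α, η)` has zero jet at `x` but need not lie
in `J¹_D F`; the formula measures its curvature by the failure to do so. -/
theorem exists_oneForm_curvature {α : Sect F} {x : M} (hα : α x = 0) :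
    ∃ η : OneForm F, η x = α.localDeriv x ∧ ∀ X Y : VField B M, D.curvature η X Y x =
      (D.defect α η X).localDeriv x (Y x) - (D.defect α η Y).localDeriv x (X x) := by
  refine Sect.vanishing_induction (p := fun α => ∃ η : OneForm F, η x = α.localDeriv x ∧
    ∀ X Y : VField B M, D.curvature η X Y x =
      (D.defect α η X).localDeriv x (Y x) - (D.defect α η Y).localDeriv x (X x)) ?_ ?_ ?_ hα
  · have h2 : (0 : Sect F).localDeriv x = 0 := (Sect.localDerivₗ x).map_zero
    have h3 : (0 : Sect E).localDeriv x = 0 := (Sect.localDerivₗ x).map_zero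
    have h4 : ∀ X, D.defect 0 0 X = 0 := fun X => by
      ext y
      simp [defect]
    refine ⟨0, by rw [h2]; rfl, fun X Y => ?_⟩
    have h := D.curvature_smul (0 : ℝ) (0 : OneForm F) X Y x
    rw [show (0 : ℝ) • (0 : OneForm F) = 0 from zero_smul ℝ (0 : OneForm F), zero_smul] at h
    simp [h, h3, h4]
  · rintro s t ⟨η, h1, h2⟩ ⟨η', h1', h2'⟩
    have h4 : ∀ X, D.defect (s + t) (η + η') X = D.defect s η X + D.defect t η' X := fun X => by
      ext y
      simp only [defect, map_add, ContMDiffSection.coe_add, ContMDiffSection.coe_sub,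
        Pi.add_apply, Pi.sub_apply, OneForm.along_apply, VBHom.map_apply, _root_.add_apply]
      abel
    refine ⟨η + η', ?_, fun X Y => ?_⟩
    · rw [Sect.localDeriv_add, ← h1, ← h1']
      rfl
    · rw [curvature_add, h2, h2', h4, h4, Sect.localDeriv_add, Sect.localDeriv_add]
      simp only [_root_.add_apply]
      abel
  · intro f e hf
    have h4 : ∀ X, D.defect (e.smulFun f) (OneForm.dsmul f e) X = ((D.D e).along X).smulFun f :=
      fun X => by
      ext y
      simp [defect, D.leibniz]
    refine ⟨OneForm.dsmul f e, ?_, fun X Y => ?_⟩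
    · ext u
      simp [Sect.localDeriv_smulFun, hf]
    · rw [curvature_dsmul, h4, h4, Sect.localDeriv_smulFun, Sect.localDeriv_smulFun, hf]
      simp

/-- The curvature at `x` of a section `(α, η)` of `J¹_D F` depends on its value at `x` only. -/
theorem curvature_eq_zero {α : Sect F} {η : OneForm F} {x : M} (hα : α x = 0)
    (hη : η x = α.localDeriv x)
    (h : ∀ᶠ y in 𝓝 x, ∀ u : TangentSpace 𝓘(ℝ, B) y, D.D α y u = D.l.app y (η y u))
    (X Y : VField B M) : D.curvature η X Y x = 0 := by
  obtain ⟨η', h1, h2⟩ := D.exists_oneForm_curvature hα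
  -- `η` differs from the model form `η'` by a form `θ` vanishing at `x`. Near `x` the defect of
  -- `η'` is `l ∘ θ`, so the curvature of `θ` at `x` cancels that of `η'`.
  obtain ⟨θ, rfl⟩ : ∃ θ, η = η' + θ := ⟨η - η', (add_sub_cancel η' η).symm⟩
  have hθ : θ x = 0 := by
    have : η' x + θ x = α.localDeriv x := hη
    rw [h1] at this
    simpa using this
  have h3 : ∀ Y : VField B M, ∀ u, D.D (θ.along Y) x u = (D.defect α η' Y).localDeriv x u := by
    intro Y u
    have h0 : θ.along Y x = 0 := by simp [hθ]
    rw [D.D_apply_of_eq_zero h0, ← D.l.localDeriv_map h0]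
    congr 1
    refine Sect.localDeriv_congr ?_
    filter_upwards [h] with y hy
    simp only [defect, ContMDiffSection.coe_sub, Pi.sub_apply, OneForm.along_apply,
      VBHom.map_apply, hy]
    simp
  rw [curvature_add, h2]
  simp only [curvature, h3, hθ]
  simp

end Curvature

/-! ### The kernel of the projection of the first prolongation -/

section Kernel

variable {F : SmoothVB.{uB, uM, v₁, w₁} B M} {E : SmoothVB.{uB, uM, v₂, w₂} B M}
  (D : RelConn F E)

/-- Write `A` as a sum of dual basis vectors times kernel vectors; extend the former to
differentials of functions and the latter to sections of `ker l`. -/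
theorem exists_oneForm_ker {x : M} (A : TangentSpace 𝓘(ℝ, B) x →L[ℝ] F.Fiber x)
    (hA : ∀ u, D.l.app x (A u) = 0) :
    ∃ ζ : OneForm F, (∀ (y : M) (u : TangentSpace 𝓘(ℝ, B) y), D.l.app y (ζ y u) = 0) ∧
      ζ x = A := by
  let β := finBasis ℝ (TangentSpace 𝓘(ℝ, B) x)
  choose s hs hsx using fun i => D.l.exists_sect_ker (D.surj x) (hA (β i))
  choose f hf using fun i => exists_fun_mvfderiv_eq (B := B)
    (LinearMap.toContinuousLinearMap (β.coord i))
  refine ⟨∑ i, OneForm.dsmul (f i) (s i), fun y u => ?_, ?_⟩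
  · rw [OneForm.sum_apply, _root_.sum_apply, map_sum]
    simp [hs]
  · ext u
    rw [OneForm.sum_apply, _root_.sum_apply]
    simp only [OneForm.dsmul_apply, hf, hsx]
    conv_rhs => rw [← β.sum_repr u, map_sum]
    simp

theorem IsSymbol.eq {x : M} {e : F.Fiber x} {φ ψ : TangentSpace 𝓘(ℝ, B) x →L[ℝ] E.Fiber x}
    (hφ : D.IsSymbol x e φ) (hψ : D.IsSymbol x e ψ) : φ = ψ := by
  obtain ⟨s, hs, hsx, rfl⟩ := hφ
  obtain ⟨t, ht, htx, rfl⟩ := hψ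
  exact D.D_apply_eq_of_ker hs ht (hsx.trans htx.symm)

theorem exists_isSymbol {x : M} {e : F.Fiber x} (he : D.l.app x e = 0) :
    ∃ φ, D.IsSymbol x e φ := by
  obtain ⟨s, hs, hsx⟩ := D.l.exists_sect_ker (D.surj x) he
  exact ⟨_, s, hs, hsx, rfl⟩

/-- The kernel of `pr` is `𝔤⁽¹⁾`. A kernel-valued form `ζ` with `ζ x = -A` gives the section `(0,
ζ)` of `J¹_D F` with jet `(0, A)`, and its curvature is `∂_D(A X) Y - ∂_D(A Y) X`. -/
theorem zero_mk_mem_prolSpace_iff {x : M} {A : TangentSpace 𝓘(ℝ, B) x →L[ℝ] F.Fiber x} :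
    ((0, A) : Jet1 F x) ∈ D.prolSpace x ↔ (∀ u, D.l.app x (A u) = 0) ∧
      ∀ u v, ∃ φ ψ, D.IsSymbol x (A u) φ ∧ D.IsSymbol x (A v) ψ ∧ φ v = ψ u := by
  have hneg : ∀ {e φ}, D.IsSymbol x e φ → D.IsSymbol x (-e) (-φ) := by
    rintro _ _ ⟨s, hs, rfl, rfl⟩
    exact ⟨-s, fun y => by simp [hs], by simp, by simp⟩
  have hcurv : ∀ ζ : OneForm F,
      (∀ (y : M) (u : TangentSpace 𝓘(ℝ, B) y), D.l.app y (ζ y u) = 0) → ζ x = -A →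
      ∀ (X Y : VField B M) φ ψ, D.IsSymbol x (A (X x)) φ → D.IsSymbol x (A (Y x)) ψ →
        D.curvature ζ X Y x = φ (Y x) - ψ (X x) := by
    intro ζ h1 h2 X Y φ ψ hφ hψ
    have h3 : ∀ Z : VField B M, D.IsSymbol x (-(A (Z x))) (D.D (ζ.along Z) x) := fun Z =>
      ⟨ζ.along Z, fun y => h1 y _, by simp [h2], rfl⟩
    rw [curvature, (h3 Y).eq D (hneg hψ), (h3 X).eq D (hneg hφ), h1]
    simp
    abel
  constructor
  · rintro ⟨α, η, h1, h2, h3⟩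
    have hα : α x = 0 := by simpa [spencerJet, Sect.jet1] using congrArg Prod.fst h2
    have hA : A = α.localDeriv x - η x := by
      have := congrArg Prod.snd h2
      simp only [spencerJet, Sect.jet1, Prod.mk_add_mk] at this
      rw [← this]
      abel
    have hlA : ∀ u, D.l.app x (A u) = 0 := by
      intro u
      have := D.D_apply_of_eq_zero hα u
      rw [h1] at this
      simp [hA, this]
    refine ⟨hlA, fun u v => ?_⟩
    obtain ⟨φ, hφ⟩ := D.exists_isSymbol (hlA u)
    obtain ⟨ψ, hψ⟩ := D.exists_isSymbol (hlA v)
    refine ⟨φ, ψ, hφ, hψ, ?_⟩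
    obtain ⟨X, rfl⟩ := exists_vfield_apply_eq u
    obtain ⟨Y, rfl⟩ := exists_vfield_apply_eq v
    obtain ⟨ζ, hζ1, hζ2⟩ := D.exists_oneForm_ker (-A) (fun u => by simp [hlA])
    -- Removing `ζ` leaves a section of `J¹_D F` with zero jet at `x`, which has no curvature there;
    -- so `η` and `ζ` have the same curvature at `x`.
    have h4 := D.curvature_eq_zero (α := α) (η := η - ζ) hα (by
      change η x - ζ x = _
      rw [hζ2, hA]
      abel) (Filter.Eventually.of_forall fun y u => by
        change _ = D.l.app y (η y u - ζ y u)
        simp [h1, hζ1]) X Y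
    have h5 := D.curvature_add (η - ζ) ζ X Y x
    rw [sub_add_cancel, h3, h4, zero_add, hcurv ζ hζ1 hζ2 X Y φ ψ hφ hψ] at h5
    exact sub_eq_zero.1 h5.symm
  · rintro ⟨hlA, h⟩
    obtain ⟨ζ, hζ1, hζ2⟩ := D.exists_oneForm_ker (-A) (fun u => by simp [hlA])
    have h2 : (0 : Sect F).localDeriv x = 0 := (Sect.localDerivₗ x).map_zero
    refine ⟨0, ζ, fun y u => by simp [hζ1], ?_, fun X Y => ?_⟩
    · simp [spencerJet, Sect.jet1, h2, hζ2]
    · obtain ⟨φ, ψ, hφ, hψ, h3⟩ := h (X x) (Y x)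
      rw [hcurv ζ hζ1 hζ2 X Y φ ψ hφ hψ, h3, sub_self]

end Kernel
end RelConn

end Prolongation
end

/-! ### Symmetric multilinear maps -/

namespace MultilinearMap

variable {V W : Type*} [AddCommGroup V] [Module ℝ V] [AddCommGroup W] [Module ℝ W] {n : ℕ}

/-- Invariance of a multilinear map under permutations of its arguments. -/
def IsSymm (T : MultilinearMap ℝ (fun _ : Fin n => V) W) : Prop :=
  ∀ (σ : Equiv.Perm (Fin n)) (m : Fin n → V), T (fun i => m (σ i)) = T m

theorem isSymm_of_fin_one (T : MultilinearMap ℝ (fun _ : Fin 1 => V) W) : T.IsSymm := by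
  intro σ m
  congr 1
  funext i
  rw [Subsingleton.elim (σ i) i]

theorem isSymm_of_adjacent {T : MultilinearMap ℝ (fun _ : Fin (n + 1) => V) W}
    (h : ∀ (i : Fin n) (m : Fin (n + 1) → V),
      T (fun j => m (Equiv.swap i.castSucc i.succ j)) = T m) : T.IsSymm := by
  intro σ
  have hσ : σ ∈ Submonoid.closure (Set.range fun i : Fin n => Equiv.swap i.castSucc i.succ) := by
    rw [Equiv.Perm.mclosure_swap_castSucc_succ]
    trivial
  induction hσ using Submonoid.closure_induction with
  | mem σ hσ =>
    obtain ⟨i, rfl⟩ := hσ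
    exact h i
  | one => exact fun m => rfl
  | mul σ τ _ _ h1 h2 =>
    intro m
    rw [← h1 m, ← h2 (fun i => m (σ i))]
    rfl

theorem IsSymm.curryLeft {T : MultilinearMap ℝ (fun _ : Fin (n + 1) => V) W} (h : T.IsSymm)
    (u : V) : IsSymm (T.curryLeft u) := by
  intro σ m
  rw [MultilinearMap.curryLeft_apply, MultilinearMap.curryLeft_apply,
    ← h (Equiv.Perm.decomposeFin.symm (0, σ)) (Fin.cons u m)]
  congr 1
  funext i
  refine Fin.cases ?_ (fun i => ?_) i <;> simp

theorem IsSymm.of_uncurryRight {S : MultilinearMap ℝ (fun _ : Fin n => V) (V →ₗ[ℝ] W)}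
    (h : IsSymm (n := n + 1) (MultilinearMap.uncurryRight (M := fun _ : Fin (n + 1) => V) S)) :
    S.IsSymm := by
  intro σ m
  ext v
  -- `σ` is extended to a permutation fixing the last index.
  have h1 := h (finSuccEquivLast.trans ((Equiv.optionCongr σ).trans finSuccEquivLast.symm))
    (Fin.snoc (α := fun _ => V) m v)
  rw [MultilinearMap.uncurryRight_apply, MultilinearMap.uncurryRight_apply] at h1
  have h2 : Fin.init (α := fun _ => V) (fun i => (Fin.snoc (α := fun _ => V) m v : Fin (n + 1) → V)
      ((finSuccEquivLast.trans ((Equiv.optionCongr σ).trans finSuccEquivLast.symm)) i)) =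
      fun i => m (σ i) := by
    funext i
    simp [Fin.init]
  rw [h2] at h1
  simpa using h1

theorem IsSymm.uncurryRight_swap {S : MultilinearMap ℝ (fun _ : Fin (n + 1) => V) (V →ₗ[ℝ] W)}
    (h : IsSymm (n := n + 2) (MultilinearMap.uncurryRight (M := fun _ : Fin (n + 2) => V) S))
    (m : Fin n → V) (u v : V) :
    S (Fin.snoc (α := fun _ => V) m u) v = S (Fin.snoc (α := fun _ => V) m v) u := by
  have h1 := h (Equiv.swap (Fin.last n).castSucc (Fin.last (n + 1)))
    (Fin.snoc (α := fun _ => V) (Fin.snoc (α := fun _ => V) m v) u)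
  rw [MultilinearMap.uncurryRight_apply, MultilinearMap.uncurryRight_apply] at h1
  have h2 : Fin.init (α := fun _ => V) (fun i =>
      (Fin.snoc (α := fun _ => V) (Fin.snoc (α := fun _ => V) m v) u : Fin (n + 2) → V)
      (Equiv.swap (Fin.last n).castSucc (Fin.last (n + 1)) i)) =
      Fin.snoc (α := fun _ => V) m u := by
    funext i
    refine Fin.lastCases ?_ (fun i => ?_) i
    · simp [Fin.init]
    · have h3 : i.castSucc.castSucc ≠ (Fin.last n).castSucc := by
        simp [Fin.ext_iff, i.2.ne]
      have h4 : i.castSucc.castSucc ≠ Fin.last (n + 1) := Fin.castSucc_ne_last _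
      simp [Fin.init, Equiv.swap_apply_of_ne_of_ne h3 h4]
  rw [h2] at h1
  simpa using h1

/-- Adjacent transpositions generate the symmetric group. Those that fix the last argument come from
the symmetry of `S`; the only other one is the exchange in `h`. -/
theorem IsSymm.uncurryRight {S : MultilinearMap ℝ (fun _ : Fin (n + 1) => V) (V →ₗ[ℝ] W)}
    (hS : S.IsSymm) (h : ∀ (m : Fin n → V) (u v : V),
      S (Fin.snoc (α := fun _ => V) m u) v = S (Fin.snoc (α := fun _ => V) m v) u) :
    IsSymm (n := n + 2) (MultilinearMap.uncurryRight (M := fun _ : Fin (n + 2) => V) S) := by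
  refine isSymm_of_adjacent fun i m => ?_
  rw [MultilinearMap.uncurryRight_apply, MultilinearMap.uncurryRight_apply]
  refine Fin.lastCases ?_ (fun i => ?_) i
  · obtain ⟨m', v, rfl⟩ : ∃ m' v, m = Fin.snoc (α := fun _ => V) m' v :=
      ⟨Fin.init m, m (Fin.last _), (Fin.snoc_init_self m).symm⟩
    obtain ⟨m, u, rfl⟩ : ∃ m u, m' = Fin.snoc (α := fun _ => V) m u :=
      ⟨Fin.init m', m' (Fin.last _), (Fin.snoc_init_self m').symm⟩
    have h2 : Fin.init (α := fun _ => V) (fun i =>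
        (Fin.snoc (α := fun _ => V) (Fin.snoc (α := fun _ => V) m u) v : Fin (n + 2) → V)
        (Equiv.swap (Fin.last n).castSucc (Fin.last n).succ i)) =
        Fin.snoc (α := fun _ => V) m v := by
      funext i
      refine Fin.lastCases ?_ (fun i => ?_) i
      · simp [Fin.init]
      · have h3 : i.castSucc.castSucc ≠ (Fin.last n).castSucc := by
          simp [Fin.ext_iff, i.2.ne]
        have h4 : i.castSucc.castSucc ≠ Fin.last (n + 1) := Fin.castSucc_ne_last _
        simp [Fin.init, Equiv.swap_apply_of_ne_of_ne h3 h4]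
    rw [h2]
    simpa using h m v u
  · have h1 : Fin.init (α := fun _ => V) (fun j =>
        m (Equiv.swap i.castSucc.castSucc i.castSucc.succ j)) =
        fun j => Fin.init (α := fun _ => V) m (Equiv.swap i.castSucc i.succ j) := by
      funext j
      simp only [Fin.init]
      rw [Fin.succ_castSucc, ← Fin.castSucc_injective (n + 1) |>.swap_apply]
    have h2 : Equiv.swap i.castSucc.castSucc i.castSucc.succ (Fin.last (n + 1)) =
        Fin.last (n + 1) := by
      refine Equiv.swap_apply_of_ne_of_ne (Fin.castSucc_ne_last _).symm ?_
      rw [Fin.succ_castSucc]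
      exact (Fin.castSucc_ne_last _).symm
    rw [h1, h2, hS]

end MultilinearMap

/-! ### Prolongation shifts the symbol spaces: `𝔤⁽ⁿ⁾(D⁽¹⁾) ≅ 𝔤⁽ⁿ⁺¹⁾(D)` -/

noncomputable section

section SymbolProlongation

variable {B : Type uB} [NormedAddCommGroup B] [NormedSpace ℝ B]
  {M : Type uM} [TopologicalSpace M] [ChartedSpace B M] [IsManifold 𝓘(ℝ, B) ∞ M]
  [FiniteDimensional ℝ B] [T2Space M]

namespace RelConn

variable {F : SmoothVB.{uB, uM, v₁, w₁} B M} {E : SmoothVB.{uB, uM, v₂, w₂} B M}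
  (D : RelConn F E)

/-- The kernel of `pr : P_D(F) → F` at `x`, as a space of linear maps. -/
def prolKer (x : M) : Submodule ℝ (TangentSpace 𝓘(ℝ, B) x →ₗ[ℝ] F.Fiber x) :=
  (D.prolSpace x).comap ((LinearMap.inr ℝ (F.Fiber x) (TangentSpace 𝓘(ℝ, B) x →L[ℝ] F.Fiber x)).comp
    (LinearMap.toContinuousLinearMap (𝕜 := ℝ) (E := TangentSpace 𝓘(ℝ, B) x)
      (F' := F.Fiber x)).toLinearMap)

theorem mem_prolKer_iff' {x : M} {A : TangentSpace 𝓘(ℝ, B) x →ₗ[ℝ] F.Fiber x} :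
    A ∈ D.prolKer x ↔ ((0, LinearMap.toContinuousLinearMap A) : Jet1 F x) ∈ D.prolSpace x :=
  Iff.rfl

theorem mem_prolKer_iff {x : M} {A : TangentSpace 𝓘(ℝ, B) x →ₗ[ℝ] F.Fiber x} :
    A ∈ D.prolKer x ↔ (∀ u, D.l.app x (A u) = 0) ∧
      ∀ u v, ∃ φ ψ, D.IsSymbol x (A u) φ ∧ D.IsSymbol x (A v) ψ ∧ φ v = ψ u := by
  rw [mem_prolKer_iff', zero_mk_mem_prolSpace_iff]
  rfl

/-- The recursive definition fixes first arguments, whereas passing from `D⁽¹⁾` to `D` appends a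
last one. This description treats all degrees alike: fixing all arguments but the last must give an
element of `𝔤⁽¹⁾`. -/
theorem mem_symbolProl_succ_iff {x : M} {n : ℕ}
    {T : MultilinearMap ℝ (fun _ : Fin (n + 1) => TangentSpace 𝓘(ℝ, B) x) (F.Fiber x)} :
    T ∈ D.symbolProl x (n + 1) ↔ T.IsSymm ∧
      ∀ m : Fin n → TangentSpace 𝓘(ℝ, B) x, T.curryRight m ∈ D.prolKer x := by
  induction n with
  | zero =>
    have h1 : T.IsSymm := T.isSymm_of_fin_one
    have h2 : ∀ (m : Fin 0 → TangentSpace 𝓘(ℝ, B) x) u, T.curryRight m u = T fun _ => u := by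
      intro m u
      rw [MultilinearMap.curryRight_apply]
      congr 1
    have h3 : ∀ m : Fin 1 → TangentSpace 𝓘(ℝ, B) x, m = fun _ => m 0 := fun m => by
      funext i
      rw [Subsingleton.elim i 0]
    simp only [mem_prolKer_iff, h2, h1, true_and]
    constructor
    · rintro ⟨h4, h5⟩ -
      exact ⟨fun u => h4 _, h5⟩
    · intro h
      obtain ⟨h4, h5⟩ := h Fin.elim0
      refine ⟨fun m => ?_, h5⟩
      rw [h3 m]
      exact h4 _
  | succ n ih =>
    have h1 : T ∈ D.symbolProl x (n + 1 + 1) ↔ T.IsSymm ∧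
      ∀ u, T.curryLeft u ∈ D.symbolProl x (n + 1) := Iff.rfl
    rw [h1]
    refine and_congr_right fun hT => ?_
    have h2 : ∀ u (m : Fin n → TangentSpace 𝓘(ℝ, B) x),
        MultilinearMap.curryRight (T.curryLeft u) m =
          T.curryRight (Fin.cons (α := fun _ => TangentSpace 𝓘(ℝ, B) x) u m) := by
      intro u m
      ext v
      simp only [MultilinearMap.curryRight_apply, MultilinearMap.curryLeft_apply]
      rw [← Fin.cons_snoc_eq_snoc_cons]
    constructor
    · intro h m
      have h3 := (ih.1 (h (m 0))).2 (Fin.tail m)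
      rw [h2] at h3
      rwa [Fin.cons_self_tail] at h3
    · intro h u
      refine ih.2 ⟨hT.curryLeft u, fun m => ?_⟩
      rw [h2]
      exact h _

theorem mem_symbolProl_zero_iff {x : M}
    {T : MultilinearMap ℝ (fun _ : Fin 0 => TangentSpace 𝓘(ℝ, B) x) (F.Fiber x)} :
    T ∈ D.symbolProl x 0 ↔ ∀ m, D.l.app x (T m) = 0 := Iff.rfl

/-- `𝔤⁽⁰⁾ = ker l`. -/
theorem finrank_symbolProl_zero (x : M) :
    finrank ℝ (D.symbolProl x 0) = finrank ℝ (LinearMap.ker (D.l.app x)) := by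
  let e := MultilinearMap.constLinearEquivOfIsEmpty ℝ ℝ
    (fun _ : Fin 0 => TangentSpace 𝓘(ℝ, B) x) (F.Fiber x)
  have h : D.symbolProl x 0 = (LinearMap.ker (D.l.app x)).map e.toLinearMap := by
    ext T
    rw [mem_symbolProl_zero_iff, Submodule.mem_map]
    constructor
    · intro h
      exact ⟨T 0, h 0, e.apply_symm_apply T⟩
    · rintro ⟨a, ha, rfl⟩ m
      exact ha
  rw [h]
  exact LinearEquiv.finrank_eq (e.submoduleMap _).symm

end RelConn

namespace RelConn

variable {K F E : SmoothVB.{uB, uM, v, w} B M} {D : RelConn F E} {D₁ : RelConn K F}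
  {Φ : ∀ x, K.Fiber x ≃ₗ[ℝ] D.prolSpace x}

/-- `Φ` carries a section `σ` to the section of `J¹F` with Spencer decomposition
`(l₁(σ), D₁(σ))`. -/
abbrev IsSpencerMap (D₁ : RelConn K F) (Φ : ∀ x, K.Fiber x ≃ₗ[ℝ] D.prolSpace x) : Prop :=
  ∀ (σ : Sect K) (x : M), (Φ x (σ x) : Jet1 F x) = spencerJet (D₁.l.map σ) (D₁.D σ) x

theorem prol_fst (hΦ : IsSpencerMap D₁ Φ) {x : M} (e : K.Fiber x) : (Φ x e : Jet1 F x).1 = D₁.l.app x e := by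
  obtain ⟨σ, rfl⟩ := exists_sect_apply_eq e
  rw [hΦ]
  simp [spencerJet, Sect.jet1]

/-- A section `σ` of the kernel of `pr` has Spencer decomposition `(0, D₁ σ)`, and `i(η) = (0, -η)`.
Up to this sign, the symbol of `D⁽¹⁾` is the inclusion of `𝔤⁽¹⁾` into `Hom(TM, F)`. -/
theorem prol_snd_of_isSymbol (hΦ : IsSpencerMap D₁ Φ) {x : M} {e : K.Fiber x}
    {φ : TangentSpace 𝓘(ℝ, B) x →L[ℝ] F.Fiber x} (h : D₁.IsSymbol x e φ) :
    (Φ x e : Jet1 F x).2 = -φ := by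
  obtain ⟨σ, h1, rfl, rfl⟩ := h
  have h2 : D₁.l.map σ = 0 := by
    ext y
    simp [h1]
  have h3 : (0 : Sect F).localDeriv x = 0 := (Sect.localDerivₗ x).map_zero
  rw [hΦ]
  simp [spencerJet, Sect.jet1, h2, h3]

variable (Φ) in
/-- The linear part of a point of the prolongation. -/
def prolPart (x : M) : K.Fiber x →ₗ[ℝ] (TangentSpace 𝓘(ℝ, B) x →ₗ[ℝ] F.Fiber x) :=
  (ContinuousLinearMap.coeLM ℝ).comp ((LinearMap.snd ℝ _ _).comp
    ((D.prolSpace x).subtype.comp (Φ x).toLinearMap))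

theorem prolPart_apply {x : M} (e : K.Fiber x) (u : TangentSpace 𝓘(ℝ, B) x) :
    prolPart Φ x e u = (Φ x e : Jet1 F x).2 u := rfl

theorem prolPart_mem (hΦ : IsSpencerMap D₁ Φ) {x : M} {e : K.Fiber x} (he : D₁.l.app x e = 0) :
    prolPart Φ x e ∈ D.prolKer x := by
  rw [mem_prolKer_iff']
  convert! (Φ x e).2 using 1
  exact Prod.ext ((prol_fst hΦ e).trans he).symm rfl

theorem eq_zero_of_prolPart (hΦ : IsSpencerMap D₁ Φ) {x : M} {e : K.Fiber x} (he : D₁.l.app x e = 0)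
    (h : prolPart Φ x e = 0) : e = 0 := by
  have h1 : (Φ x e : Jet1 F x) = 0 := by
    refine Prod.ext ((prol_fst hΦ e).trans he) ?_
    ext u
    exact congrArg (fun φ => φ u) h
  exact (Φ x).map_eq_zero_iff.1 (Subtype.ext h1)

theorem exists_prolPart_eq (hΦ : IsSpencerMap D₁ Φ) {x : M} (A : D.prolKer x) :
    D₁.l.app x ((Φ x).symm ⟨_, A.2⟩) = 0 ∧ prolPart Φ x ((Φ x).symm ⟨_, A.2⟩) = A := by
  constructor
  · rw [← prol_fst hΦ, LinearEquiv.apply_symm_apply]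
    rfl
  · ext u
    rw [prolPart_apply, LinearEquiv.apply_symm_apply]
    rfl

/-- Since the symbol of `D₁` is minus `prolPart`, the symbol condition becomes plain symmetry in the
two vectors. -/
theorem mem_prolKer_prol_iff (hΦ : IsSpencerMap D₁ Φ) {x : M} {A : TangentSpace 𝓘(ℝ, B) x →ₗ[ℝ] K.Fiber x} :
    A ∈ D₁.prolKer x ↔ (∀ u, D₁.l.app x (A u) = 0) ∧
      ∀ u v, prolPart Φ x (A u) v = prolPart Φ x (A v) u := by
  rw [mem_prolKer_iff]
  refine and_congr_right fun hA => forall_congr' fun u => forall_congr' fun v => ?_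
  constructor
  · rintro ⟨φ, ψ, hφ, hψ, h⟩
    rw [prolPart_apply, prolPart_apply, prol_snd_of_isSymbol hΦ hφ, prol_snd_of_isSymbol hΦ hψ]
    simp [h]
  · intro h
    obtain ⟨φ, hφ⟩ := D₁.exists_isSymbol (hA u)
    obtain ⟨ψ, hψ⟩ := D₁.exists_isSymbol (hA v)
    rw [prolPart_apply, prolPart_apply, prol_snd_of_isSymbol hΦ hφ,
      prol_snd_of_isSymbol hΦ hψ] at h
    exact ⟨φ, ψ, hφ, hψ, by simpa using h⟩

variable (Φ) in
/-- The map `𝔤⁽ⁿ⁾(D⁽¹⁾) → 𝔤⁽ⁿ⁺¹⁾(D)`, on all multilinear maps. -/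
def symbolShift (x : M) (n : ℕ) :
    MultilinearMap ℝ (fun _ : Fin n => TangentSpace 𝓘(ℝ, B) x) (K.Fiber x) →ₗ[ℝ]
      MultilinearMap ℝ (fun _ : Fin (n + 1) => TangentSpace 𝓘(ℝ, B) x) (F.Fiber x) :=
  (multilinearCurryRightEquiv ℝ (fun _ : Fin (n + 1) => TangentSpace 𝓘(ℝ, B) x)
    (F.Fiber x)).symm.toLinearMap.comp (LinearMap.compMultilinearMapₗ ℝ (prolPart Φ x))

theorem symbolShift_eq {x : M} {n : ℕ}
    (T : MultilinearMap ℝ (fun _ : Fin n => TangentSpace 𝓘(ℝ, B) x) (K.Fiber x)) :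
    symbolShift Φ x n T = MultilinearMap.uncurryRight
      (M := fun _ : Fin (n + 1) => TangentSpace 𝓘(ℝ, B) x)
      ((prolPart Φ x).compMultilinearMap T) := rfl

theorem curryRight_symbolShift {x : M} {n : ℕ}
    (T : MultilinearMap ℝ (fun _ : Fin n => TangentSpace 𝓘(ℝ, B) x) (K.Fiber x))
    (m : Fin n → TangentSpace 𝓘(ℝ, B) x) :
    (symbolShift Φ x n T).curryRight m = prolPart Φ x (T m) := by
  rw [symbolShift_eq, MultilinearMap.curry_uncurryRight]
  rfl

theorem symbolProl_apply_ker (D : RelConn F E) {x : M} {n : ℕ}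
    {T : MultilinearMap ℝ (fun _ : Fin n => TangentSpace 𝓘(ℝ, B) x) (F.Fiber x)}
    (hT : T ∈ D.symbolProl x n) (m : Fin n → TangentSpace 𝓘(ℝ, B) x) : D.l.app x (T m) = 0 := by
  cases n with
  | zero => exact hT m
  | succ n =>
    have h := ((D.mem_prolKer_iff).1 ((D.mem_symbolProl_succ_iff.1 hT).2 (Fin.init m))).1
      (m (Fin.last n))
    rw [MultilinearMap.curryRight_apply, Fin.snoc_init_self] at h
    exact h

/-- The membership in `𝔤⁽¹⁾(D)` after fixing the first arguments is automatic for kernel-valued `T`,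
so only symmetry is at stake. Symmetry of the shifted map in all arguments amounts to symmetry of
`T` together with exchange of the last two arguments, and the latter is the condition of
`mem_prolKer_prol_iff`. -/
theorem mem_symbolProl_prol_iff (hΦ : IsSpencerMap D₁ Φ) {x : M} {n : ℕ}
    {T : MultilinearMap ℝ (fun _ : Fin n => TangentSpace 𝓘(ℝ, B) x) (K.Fiber x)}
    (hT : ∀ m, D₁.l.app x (T m) = 0) :
    T ∈ D₁.symbolProl x n ↔ symbolShift Φ x n T ∈ D.symbolProl x (n + 1) := by
  have h1 : ∀ m, (symbolShift Φ x n T).curryRight m ∈ D.prolKer x := fun m => by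
    rw [curryRight_symbolShift]
    exact prolPart_mem hΦ (hT m)
  rw [mem_symbolProl_succ_iff]
  cases n with
  | zero => exact iff_of_true hT ⟨MultilinearMap.isSymm_of_fin_one _, h1⟩
  | succ n =>
    rw [mem_symbolProl_succ_iff, and_iff_left h1, symbolShift_eq]
    simp only [mem_prolKer_prol_iff hΦ, MultilinearMap.curryRight_apply]
    constructor
    · rintro ⟨h2, h3⟩
      refine MultilinearMap.IsSymm.uncurryRight (fun σ m => ?_) fun m => (h3 m).2
      exact congrArg (prolPart Φ x) (h2 σ m)
    · intro h
      refine ⟨fun σ m => ?_, fun m => ⟨fun u => hT _, h.uncurryRight_swap m⟩⟩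
      have h2 := h.of_uncurryRight σ m
      rw [← sub_eq_zero]
      refine eq_zero_of_prolPart hΦ (by simp [hT]) ?_
      rw [map_sub, sub_eq_zero]
      exact h2

theorem finrank_symbolProl_prol (hΦ : IsSpencerMap D₁ Φ) (x : M) (n : ℕ) :
    finrank ℝ (D₁.symbolProl x n) = finrank ℝ (D.symbolProl x (n + 1)) := by
  let J := (symbolShift Φ x n).restrict (p := D₁.symbolProl x n) (q := D.symbolProl x (n + 1))
    fun T hT => (mem_symbolProl_prol_iff hΦ (symbolProl_apply_ker D₁ hT)).1 hT
  refine (LinearEquiv.ofBijective J ⟨?_, ?_⟩).finrank_eq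
  · rw [← LinearMap.ker_eq_bot, LinearMap.ker_eq_bot']
    rintro ⟨T, hT⟩ h
    have h1 : symbolShift Φ x n T = 0 := congrArg Subtype.val h
    refine Subtype.ext (MultilinearMap.ext fun m => ?_)
    refine eq_zero_of_prolPart hΦ (symbolProl_apply_ker D₁ hT m) ?_
    rw [← curryRight_symbolShift, h1]
    rfl
  · rintro ⟨T, hT⟩
    have h1 := (D.mem_symbolProl_succ_iff.1 hT).2
    -- For surjectivity: fixing all arguments of `T` but the last gives elements of `𝔤⁽¹⁾`, which
    -- `Φ⁻¹` turns into vectors of the kernel of `l₁`.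
    let H : D.prolKer x →ₗ[ℝ] K.Fiber x := (Φ x).symm.toLinearMap.comp
      (LinearMap.restrict (p := D.prolKer x) (q := D.prolSpace x)
        ((LinearMap.inr ℝ (F.Fiber x) (TangentSpace 𝓘(ℝ, B) x →L[ℝ] F.Fiber x)).comp
        (LinearMap.toContinuousLinearMap (𝕜 := ℝ) (E := TangentSpace 𝓘(ℝ, B) x)
        (F' := F.Fiber x)).toLinearMap) fun A hA => hA)
    let S : MultilinearMap ℝ (fun _ : Fin n => TangentSpace 𝓘(ℝ, B) x) (K.Fiber x) :=
      H.compMultilinearMap (MultilinearMap.codRestrict (M₁ := fun _ : Fin n => TangentSpace 𝓘(ℝ, B) x)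
        T.curryRight (D.prolKer x) h1)
    have hS1 : ∀ m, D₁.l.app x (S m) = 0 := fun m => (exists_prolPart_eq hΦ ⟨_, h1 m⟩).1
    have hS2 : symbolShift Φ x n S = T := by
      rw [← T.uncurry_curryRight, symbolShift_eq]
      congr 1
      exact MultilinearMap.ext fun m => (exists_prolPart_eq hΦ ⟨_, h1 m⟩).2
    exact ⟨⟨S, (mem_symbolProl_prol_iff hΦ hS1).2 (by rw [hS2]; exact hT)⟩, Subtype.ext hS2⟩

theorem finrank_symbolProl_of_isProlongation {D : RelConn F E} {k : ℕ}
    {F' E' : SmoothVB.{uB, uM, v, w} B M} {D' : RelConn F' E'} (h : D.IsProlongation k D') (x : M)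
    (n : ℕ) : finrank ℝ (D'.symbolProl x n) = finrank ℝ (D.symbolProl x (n + k)) := by
  induction h generalizing n with
  | zero => rfl
  | succ _ h ih =>
    obtain ⟨Φ, hΦ⟩ := h
    rw [finrank_symbolProl_prol hΦ, ih, Nat.add_right_comm]
    rfl

theorem finrank_fiber_eq_add (D : RelConn F E) (x : M) :
    finrank ℝ (F.Fiber x) = finrank ℝ (E.Fiber x) + finrank ℝ (D.symbolProl x 0) := by
  rw [finrank_symbolProl_zero, ← (D.l.app x).finrank_range_add_finrank_ker,
    LinearMap.range_eq_top.2 (D.surj x), finrank_top]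

/-- Each projection is onto the preceding prolongation, and by the shift the kernel of the `j`-th
one has the dimension of `𝔤⁽ʲ⁾(D)`. -/
theorem finrank_fiber_of_isProlongation {D : RelConn F E} {k : ℕ}
    {F' E' : SmoothVB.{uB, uM, v, w} B M} {D' : RelConn F' E'} (h : D.IsProlongation k D') (x : M) :
    finrank ℝ (F'.Fiber x) = finrank ℝ (F.Fiber x) +
      ∑ i ∈ Finset.range k, finrank ℝ (D.symbolProl x (i + 1)) := by
  induction h with
  | zero => simp
  | succ hp h ih =>
    rw [finrank_fiber_eq_add, finrank_symbolProl_of_isProlongation (hp.succ h), ih,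
      Finset.sum_range_succ, add_assoc, zero_add]

end RelConn
end SymbolProlongation
end

/-! ### Solutions of `D` and of its first prolongation -/

noncomputable section

section Solutions

variable {B : Type uB} [NormedAddCommGroup B] [NormedSpace ℝ B]
  {M : Type uM} [TopologicalSpace M] [ChartedSpace B M] [IsManifold 𝓘(ℝ, B) ∞ M]

/-- The derivative of a section in a trivialization, as a linear map. -/
def Sect.trivDerivₗ {F : SmoothVB.{uB, uM, v, w} B M} (x₀ : M) {x : M}
    (hx : x ∈ (trivializationAt F.Model F.Fiber x₀).baseSet) (u : TangentSpace 𝓘(ℝ, B) x) :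
    Sect F →ₗ[ℝ] F.Model where
  toFun s := mvfderiv 𝓘(ℝ, B) (fun y => (trivializationAt F.Model F.Fiber x₀ ⟨y, s y⟩).2) x u
  map_add' s t := by
    have hmd : ∀ t : Sect F, MDifferentiableAt 𝓘(ℝ, B) 𝓘(ℝ, F.Model)
        (fun y => (trivializationAt F.Model F.Fiber x₀ ⟨y, t y⟩).2) x := fun t =>
      (((trivializationAt F.Model F.Fiber x₀).contMDiffAt_section_iff hx).1
        (t.contMDiff.contMDiffAt (x := x))).mdifferentiableAt (by simp)
    have h : (fun y => (trivializationAt F.Model F.Fiber x₀ ⟨y, (s + t) y⟩).2) =ᶠ[𝓝 x]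
        (fun y => (trivializationAt F.Model F.Fiber x₀ ⟨y, s y⟩).2) +
        (fun y => (trivializationAt F.Model F.Fiber x₀ ⟨y, t y⟩).2) := by
      filter_upwards [(trivializationAt F.Model F.Fiber x₀).open_baseSet.mem_nhds hx] with y hy
      exact ((trivializationAt F.Model F.Fiber x₀).linear ℝ hy).map_add _ _
    rw [mvfderiv_congr h, mvfderiv_add (hmd s) (hmd t)]
    rfl
  map_smul' c s := by
    have h := mvfderiv_trivialization_smulFun (ContMDiffMap.const c) s x₀ hx u
    have h1 : mvfderiv 𝓘(ℝ, B) (ContMDiffMap.const c : C^∞⟮𝓘(ℝ, B), M; 𝓘(ℝ, ℝ), ℝ⟯) x u = 0 := by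
      have := mvfderiv_const (I := 𝓘(ℝ, B)) (x := x) c
      exact congrArg (fun φ => φ u) this
    rw [h1, zero_smul, add_zero] at h
    exact h

section Bump

variable [FiniteDimensional ℝ B] [T2Space M]

theorem contMDiffAt_mvfderiv {W : Type*} [NormedAddCommGroup W] [NormedSpace ℝ W]
    [FiniteDimensional ℝ W] {f : M → W} {U : Set M} (hU : IsOpen U) {x : M} (hx : x ∈ U)
    (hf : ContMDiffOn 𝓘(ℝ, B) 𝓘(ℝ, W) ∞ f U) (X : VField B M) :
    ContMDiffAt 𝓘(ℝ, B) 𝓘(ℝ, W) ∞ (fun y => mvfderiv 𝓘(ℝ, B) f y (X y)) x := by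
  obtain ⟨g, hg⟩ := exists_fun_eventuallyEq (B := B) hU hx hf
  refine (dirDeriv X g).contMDiff.contMDiffAt.congr_of_eventuallyEq ?_
  filter_upwards [hg.eventually_nhds] with y hy
  rw [dirDeriv_apply, mvfderiv_congr hy]

namespace RelConn

variable {K F E : SmoothVB.{uB, uM, v, w} B M} {D : RelConn F E} {D₁ : RelConn K F}
  {Φ : ∀ x, K.Fiber x ≃ₗ[ℝ] D.prolSpace x}

theorem mem_Sol_iff (D : RelConn F E) {s : Sect F} : s ∈ D.Sol ↔ D.D s = 0 := LinearMap.mem_ker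

/-- If `D₁ σ = 0` then `Φ(σ)` is the jet of `l₁(σ)`, and it lies in `P_D(F)`, hence in `J¹_D F`.
Concretely, with `(α, η)` representing this jet at `x`, the section `α - l₁(σ)` vanishes at `x` with
derivative `η x`, so `D(α - l₁(σ)) = l ∘ η = D α` there. -/
theorem map_mem_Sol (hΦ : IsSpencerMap D₁ Φ) {σ : Sect K} (hσ : σ ∈ D₁.Sol) :
    D₁.l.map σ ∈ D.Sol := by
  rw [mem_Sol_iff] at hσ ⊢
  ext x u
  obtain ⟨α, η, h1, h2, -⟩ := (Φ x (σ x)).2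
  rw [hΦ, hσ] at h2
  have hα : (α - D₁.l.map σ) x = 0 := by
    have := congrArg Prod.fst h2
    simp only [spencerJet, Sect.jet1, Prod.mk_add_mk, add_zero] at this
    simp [this]
  have hη : (α - D₁.l.map σ).localDeriv x = η x := by
    have := congrArg Prod.snd h2
    simp only [spencerJet, Sect.jet1, Prod.mk_add_mk] at this
    have h3 : (α - D₁.l.map σ).localDeriv x = α.localDeriv x - (D₁.l.map σ).localDeriv x :=
      (Sect.localDerivₗ x).map_sub _ _
    have h4 : (0 : OneForm F) x = 0 := rfl
    rw [h4, neg_zero, add_zero] at this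
    rw [h3, ← this]
    abel
  have h3 := D.D_apply_of_eq_zero hα u
  rw [hη, ← h1, map_sub] at h3
  simpa using h3

theorem eq_zero_of_map_eq_zero (hΦ : IsSpencerMap D₁ Φ) {σ : Sect K} (hσ : σ ∈ D₁.Sol)
    (h : D₁.l.map σ = 0) : σ = 0 := by
  rw [mem_Sol_iff] at hσ
  ext x
  have h1 := hΦ σ x
  have h3 : (0 : Sect F).localDeriv x = 0 := (Sect.localDerivₗ x).map_zero
  rw [hσ, h] at h1
  refine (Φ x).map_eq_zero_iff.1 (Subtype.ext (h1.trans ?_))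
  simp [spencerJet, Sect.jet1, h3]

theorem spencerJet_mem_prolSpace {s : Sect F} (hs : s ∈ D.Sol) (x : M) :
    spencerJet s 0 x ∈ D.prolSpace x := by
  rw [mem_Sol_iff] at hs
  refine ⟨s, 0, fun y u => by simp [hs], rfl, fun X Y => ?_⟩
  have h := D.curvature_smul (0 : ℝ) (0 : OneForm F) X Y x
  rwa [show (0 : ℝ) • (0 : OneForm F) = 0 from zero_smul ℝ (0 : OneForm F), zero_smul] at h

/-- The section of the prolongation determined by the one-jets of a solution is smooth. -/
theorem contMDiff_prol_symm (hΦ : IsSpencerMap D₁ Φ) {s : Sect F} (hs : s ∈ D.Sol) :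
    ContMDiff 𝓘(ℝ, B) (𝓘(ℝ, B).prod 𝓘(ℝ, K.Model)) ∞ (fun x =>
      TotalSpace.mk' K.Model x ((Φ x).symm ⟨_, spencerJet_mem_prolSpace hs x⟩)) := by
  intro x₀
  set k : ∀ x, K.Fiber x := fun x => (Φ x).symm ⟨_, spencerJet_mem_prolSpace hs x⟩ with hk
  let τ := trivializationAt F.Model F.Fiber x₀
  have hx₀ : x₀ ∈ τ.baseSet := FiberBundle.mem_baseSet_trivializationAt' x₀
  obtain ⟨e, U, hUo, hxU, hU⟩ := K.exists_frame x₀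
  obtain ⟨U', ⟨S⟩⟩ := exists_coordSystem (B := B) x₀
  let β := finBasis ℝ B
  have h1 : ∀ y, ∃ a : Fin (finrank ℝ K.Model) → ℝ, y ∈ U → k y = ∑ i, a i • e i y := by
    intro y
    by_cases hy : y ∈ U
    · let b := basisOfLinearIndependentOfCardEqFinrank' _ (hU y hy) (by simp [K.finrank_fiber])
      refine ⟨b.repr (k y), fun _ => ?_⟩
      conv_lhs => rw [← b.sum_repr (k y)]
      simp [b]
    · exact ⟨0, fun h => (hy h).elim⟩
  choose c hc using h1
  let sec : (Fin (finrank ℝ K.Model) → ℝ) → Sect K := fun a => ∑ i, a i • e i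
  have hsec : ∀ a y, sec a y = ∑ i, a i • e i y := fun a y => Sect.sum_apply _ _ _
  have hτ : ∀ t : Sect F, ContMDiffOn 𝓘(ℝ, B) 𝓘(ℝ, F.Model) ∞ (fun y => (τ ⟨y, t y⟩).2) τ.baseSet :=
    fun t y hy => ((τ.contMDiffAt_section_iff hy).1
      (t.contMDiff.contMDiffAt (x := y))).contMDiffWithinAt
  -- `G σ` and `H` are `Φ(σ)` and `j¹s` in the fixed trivialization at `x₀`; the data of `Jet1` use
  -- a trivialization that moves with the point and are unsuitable for testing smoothness.
  let G : Sect K → M → F.Model × (Fin (finrank ℝ B) → F.Model) := fun σ y =>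
    ((τ ⟨y, D₁.l.map σ y⟩).2, fun a =>
      mvfderiv 𝓘(ℝ, B) (fun z => (τ ⟨z, D₁.l.map σ z⟩).2) y (S.field (β a) y) -
        (τ ⟨y, (D₁.D σ).along (S.field (β a)) y⟩).2)
  let H : M → F.Model × (Fin (finrank ℝ B) → F.Model) := fun y =>
    ((τ ⟨y, s y⟩).2, fun a => mvfderiv 𝓘(ℝ, B) (fun z => (τ ⟨z, s z⟩).2) y (S.field (β a) y))
  have hGs : ∀ σ, ContMDiffAt 𝓘(ℝ, B) 𝓘(ℝ, F.Model × (Fin (finrank ℝ B) → F.Model)) ∞ (G σ) x₀ := by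
    intro σ
    refine ((hτ _).contMDiffAt (τ.open_baseSet.mem_nhds hx₀)).prodMk_space
      (contMDiffAt_pi_space.2 fun a => ?_)
    exact (contMDiffAt_mvfderiv τ.open_baseSet hx₀ (hτ _) _).sub
      ((hτ _).contMDiffAt (τ.open_baseSet.mem_nhds hx₀))
  have hHs : ContMDiffAt 𝓘(ℝ, B) 𝓘(ℝ, F.Model × (Fin (finrank ℝ B) → F.Model)) ∞ H x₀ := by
    refine ((hτ _).contMDiffAt (τ.open_baseSet.mem_nhds hx₀)).prodMk_space
      (contMDiffAt_pi_space.2 fun a => ?_)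
    exact contMDiffAt_mvfderiv τ.open_baseSet hx₀ (hτ _) _
  have hGsum : ∀ y ∈ τ.baseSet, ∀ a : Fin (finrank ℝ K.Model) → ℝ,
      G (sec a) y = ∑ i, a i • G (e i) y := by
    intro y hy a
    let L := τ.linearEquivAt ℝ y hy
    let P : Sect K →ₗ[ℝ] F.Model × (Fin (finrank ℝ B) → F.Model) := LinearMap.prod
      (L.toLinearMap.comp ((Sect.evalAt y).comp D₁.l.mapₗ))
      (LinearMap.pi fun j => (Sect.trivDerivₗ x₀ hy (S.field (β j) y)).comp D₁.l.mapₗ -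
        L.toLinearMap.comp ((LinearMap.applyₗ (S.field (β j) y)).comp
          ((ContinuousLinearMap.coeLM ℝ).comp ((OneForm.evalAt y).comp D₁.D))))
    have hP : ∀ σ, G σ y = P σ := fun σ => rfl
    rw [hP, map_sum]
    simp [hP]
  -- A change of trivialization alters derivatives by a term depending on the value. It drops out
  -- for `l₁(σ) - t`, which vanishes at `y`.
  have key : ∀ y ∈ τ.baseSet, y ∈ U' → ∀ (σ : Sect K) (t : Sect F), D₁.l.map σ y = t y →
      (((D₁.l.map σ).localDeriv y - D₁.D σ y = t.localDeriv y) ↔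
      ∀ a, mvfderiv 𝓘(ℝ, B) (fun z => (τ ⟨z, D₁.l.map σ z⟩).2) y (S.field (β a) y) -
        (τ ⟨y, (D₁.D σ).along (S.field (β a)) y⟩).2 =
        mvfderiv 𝓘(ℝ, B) (fun z => (τ ⟨z, t z⟩).2) y (S.field (β a) y)) := by
    intro y hy hyU σ t hst
    let L := τ.linearEquivAt ℝ y hy
    have h0 : (D₁.l.map σ - t) y = 0 := by
      change D₁.l.map σ y - t y = 0
      rw [hst, sub_self]
    have h2 := fun u => Sect.mvfderiv_trivialization x₀ hy h0 u
    have h3 : ∀ u, mvfderiv 𝓘(ℝ, B) (fun z => (τ ⟨z, D₁.l.map σ z⟩).2) y u -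
        mvfderiv 𝓘(ℝ, B) (fun z => (τ ⟨z, t z⟩).2) y u =
        L ((D₁.l.map σ).localDeriv y u - t.localDeriv y u) := fun u => by
      have h4 : (D₁.l.map σ - t).localDeriv y = (D₁.l.map σ).localDeriv y - t.localDeriv y :=
        (Sect.localDerivₗ y).map_sub _ _
      have h5 := h2 u
      rw [h4] at h5
      exact ((Sect.trivDerivₗ x₀ hy u).map_sub _ _).symm.trans h5
    have h6 : ∀ u, (τ ⟨y, D₁.D σ y u⟩).2 = L (D₁.D σ y u) := fun u => rfl
    constructor
    · intro h a
      have h7 := h3 (S.field (β a) y)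
      rw [← h] at h7
      simp only [OneForm.along_apply, h6]
      rw [sub_eq_iff_eq_add, ← sub_eq_iff_eq_add', h7]
      simp
    · intro h
      let A := (D₁.l.map σ).localDeriv y - D₁.D σ y - t.localDeriv y
      have h8 : ∀ a, A (S.field (β a) y) = 0 := by
        intro a
        have h7 := h3 (S.field (β a) y)
        have h9 := h a
        simp only [OneForm.along_apply, h6] at h9
        rw [sub_eq_iff_eq_add, ← sub_eq_iff_eq_add', h7] at h9
        have h10 := L.injective h9
        simp only [A, _root_.sub_apply]
        rw [← h10]
        abel
      have h9 : (A.toLinearMap.comp ((Sect.evalAt (F := tangentVB B M) y).comp S.field)) = 0 :=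
        β.ext h8
      refine sub_eq_zero.1 (?_ : A = 0)
      ext u
      rw [← S.field_coord y hyU u]
      exact LinearMap.congr_fun h9 (mvfderiv 𝓘(ℝ, B) S.coord y u)
  have hsp : ∀ (σ : Sect K) (t : Sect F) (y : M), spencerJet (D₁.l.map σ) (D₁.D σ) y =
      spencerJet t 0 y ↔ D₁.l.map σ y = t y ∧
        (D₁.l.map σ).localDeriv y - D₁.D σ y = t.localDeriv y := by
    intro σ t y
    have h4 : (0 : OneForm F) y = 0 := rfl
    simp only [spencerJet, Sect.jet1, Prod.mk_add_mk, add_zero, Prod.mk.injEq, h4, neg_zero,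
      sub_eq_add_neg]
  have hcs : ContMDiffAt 𝓘(ℝ, B) 𝓘(ℝ, Fin (finrank ℝ K.Model) → ℝ) ∞ c x₀ := by
    -- The coefficients solve the linear system `H = ∑ cᵢ G(eᵢ)`, whose columns are independent at
    -- `x₀` because `Φ` is injective.
    refine contMDiffAt_coeff (g := fun i => G (e i)) (h := H) (fun i => hGs _) hHs ?_ ?_
    · rw [Fintype.linearIndependent_iff]
      intro a ha
      rw [← hGsum x₀ hx₀] at ha
      have h2 : D₁.l.map (sec a) x₀ = (0 : Sect F) x₀ := by
        have := congrArg Prod.fst ha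
        exact (τ.linearEquivAt ℝ x₀ hx₀).map_eq_zero_iff.1 this
      have h3 := (hsp (sec a) 0 x₀).2 ⟨h2, (key x₀ hx₀ S.mem (sec a) 0 h2).2 fun j => by
        have h4 := congrFun (congrArg Prod.snd ha) j
        refine h4.trans ?_
        exact ((Sect.trivDerivₗ x₀ hx₀ (S.field (β j) x₀)).map_zero).symm⟩
      rw [← hΦ] at h3
      have h5 : spencerJet (0 : Sect F) 0 x₀ = 0 := by
        have h3 : (0 : Sect F).localDeriv x₀ = 0 := (Sect.localDerivₗ x₀).map_zero
        simp [spencerJet, Sect.jet1, h3]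
      have h4 : sec a x₀ = 0 := (Φ x₀).map_eq_zero_iff.1 (Subtype.ext (h3.trans h5))
      rw [hsec] at h4
      exact Fintype.linearIndependent_iff.1 (hU x₀ hxU) a h4
    · filter_upwards [τ.open_baseSet.mem_nhds hx₀, hUo.mem_nhds hxU,
        S.isOpen.mem_nhds S.mem] with y h2 h3 h4
      rw [← hGsum y h2]
      -- The coefficients may be frozen at `y`: `Φ` at `y` only sees the value of the section at
      -- `y`.
      have h5 : sec (c y) y = k y := by rw [hsec, hc y h3]
      have h6 := hΦ (sec (c y)) y
      rw [h5, hk] at h6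
      simp only [LinearEquiv.apply_symm_apply] at h6
      obtain ⟨h7, h8⟩ := (hsp _ _ _).1 h6.symm
      refine Prod.ext ?_ (funext fun a => ?_)
      · change (τ ⟨y, s y⟩).2 = (τ ⟨y, D₁.l.map (sec (c y)) y⟩).2
        rw [h7]
      · exact ((key y h2 h4 _ _ h7).1 h8 a).symm
  have h2 : ContMDiffAt 𝓘(ℝ, B) (𝓘(ℝ, B).prod 𝓘(ℝ, K.Model)) ∞
      (fun y => TotalSpace.mk' K.Model y (∑ i, c y i • e i y)) x₀ :=
    ContMDiffAt.sum_section fun i _ => ContMDiffAt.smul_section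
      ((ContinuousLinearMap.proj (R := ℝ) (φ := fun _ => ℝ) i).contMDiff.contMDiffAt.comp x₀ hcs)
      (e i).contMDiff.contMDiffAt
  refine h2.congr_of_eventuallyEq ?_
  filter_upwards [hUo.mem_nhds hxU] with y hy
  rw [← hc y hy]

/-- The lift is `Φ⁻¹(j¹s)`. Comparing its Spencer decomposition `(l₁ σ, D₁ σ)` with `(s, 0)` gives
both claims. -/
theorem exists_mem_Sol_map_eq (hΦ : IsSpencerMap D₁ Φ) {s : Sect F} (hs : s ∈ D.Sol) :
    ∃ σ ∈ D₁.Sol, D₁.l.map σ = s := by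
  let σ : Sect K := ⟨_, contMDiff_prol_symm hΦ hs⟩
  have h1 : ∀ x, spencerJet (D₁.l.map σ) (D₁.D σ) x = spencerJet s 0 x := fun x => by
    rw [← hΦ]
    exact congrArg Subtype.val ((Φ x).apply_symm_apply _)
  have h2 : D₁.l.map σ = s := by
    ext x
    have := congrArg Prod.fst (h1 x)
    simpa [spencerJet, Sect.jet1] using this
  refine ⟨σ, ?_, h2⟩
  rw [mem_Sol_iff]
  ext1 x
  have := congrArg Prod.snd (h1 x)
  rw [h2] at this
  simpa [spencerJet, Sect.jet1] using this

end RelConn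
end Bump
end Solutions
end

/-! ### Parallel sections of a flat connection form on a normed space -/

noncomputable section

section FlatODE

set_option maxSynthPendingDepth 3

open Metric

variable {B V : Type*} [NormedAddCommGroup B] [NormedSpace ℝ B]
  [NormedAddCommGroup V] [NormedSpace ℝ V]

/-- The quadratic remainder comes from a Lipschitz bound on the derivative. One constant `C` serves
all estimates, and `C * r ≤ 1 / 2` lets the radial equation be solved up to time one. -/
theorem ContDiffAt.exists_taylor_bounds {W : Type*} [NormedAddCommGroup W] [NormedSpace ℝ W]
    {A : B → W} (hA : ContDiffAt ℝ ∞ A 0) :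
    ∃ r > 0, ∃ C ≥ 0, r ≤ 1 ∧ C * r ≤ 1 / 2 ∧ ∀ z ∈ ball (0 : B) r, DifferentiableAt ℝ A z ∧
      ‖A z‖ ≤ C ∧ ‖fderiv ℝ A z‖ ≤ C ∧ ∀ z' ∈ ball (0 : B) r,
        ‖A z' - A z - fderiv ℝ A z (z' - z)‖ ≤ C * ‖z' - z‖ ^ 2 := by
  have h1 : ContDiffAt ℝ 1 (fderiv ℝ A) 0 := hA.fderiv_right (m := 1) (by norm_cast)
  obtain ⟨K, t, ht, hK⟩ := h1.exists_lipschitzOnWith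
  have h2 : ∀ᶠ z in 𝓝 (0 : B), ‖A z‖ < ‖A 0‖ + 1 :=
    hA.continuousAt.norm.eventually (gt_mem_nhds (lt_add_one _))
  have h3 : ∀ᶠ z in 𝓝 (0 : B), ‖fderiv ℝ A z‖ < ‖fderiv ℝ A 0‖ + 1 :=
    h1.continuousAt.norm.eventually (gt_mem_nhds (lt_add_one _))
  have h4 : ∀ᶠ z in 𝓝 (0 : B), DifferentiableAt ℝ A z := by
    filter_upwards [((hA.of_le (m := 1) (by norm_cast)).eventually (by simp))] with z hz
    exact hz.differentiableAt (by simp)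
  obtain ⟨r, hr, h⟩ := Metric.eventually_nhds_iff_ball.1 (h2.and (h3.and (h4.and ht)))
  set C : ℝ := (‖A 0‖ + 1) + (‖fderiv ℝ A 0‖ + 1) + K with hC
  have hC0 : 0 < C := by positivity
  refine ⟨min r (min 1 (1 / (2 * C))), by positivity, C, hC0.le,
    (min_le_right _ _).trans (min_le_left _ _), ?_, fun z hz => ?_⟩
  · calc C * min r (min 1 (1 / (2 * C))) ≤ C * (1 / (2 * C)) := by
          gcongr
          exact (min_le_right _ _).trans (min_le_right _ _)
      _ = 1 / 2 := by field_simp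
  · have hsub := ball_subset_ball (x := (0 : B)) (min_le_left r (min 1 (1 / (2 * C))))
    obtain ⟨a1, a2, a3, a4⟩ := h z (hsub hz)
    have n1 := norm_nonneg (A 0)
    have n2 := norm_nonneg (fderiv ℝ A 0)
    have n3 := K.coe_nonneg
    refine ⟨a3, by linarith, by linarith, fun z' hz' => ?_⟩
    have hcv : Convex ℝ (ball (0 : B) r ∩ closedBall z ‖z' - z‖) :=
      (convex_ball _ _).inter (convex_closedBall _ _)
    have := hcv.norm_image_sub_le_of_norm_fderiv_le' (𝕜 := ℝ) (f := A) (φ := fderiv ℝ A z)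
      (C := K * ‖z' - z‖) (x := z) (y := z') (fun y hy => (h y hy.1).2.2.1) (fun y hy => ?_)
      ⟨hsub hz, by simp⟩ ⟨hsub hz', by simp [dist_eq_norm]⟩
    · refine this.trans ?_
      have : (K : ℝ) ≤ C := by linarith
      calc K * ‖z' - z‖ * ‖z' - z‖ = K * ‖z' - z‖ ^ 2 := by ring
        _ ≤ _ := by gcongr
    · refine (hK.norm_sub_le (h y hy.1).2.2.2 a4).trans ?_
      gcongr
      simpa [dist_eq_norm] using hy.2

/-- The radial parallel transport equation. -/
theorem exists_radial_solution [CompleteSpace V] {A : B → B →L[ℝ] V →L[ℝ] V} {r C : ℝ}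
    (hC : 0 ≤ C) (hCr : C * r ≤ 1 / 2) (hA : ContinuousOn A (ball 0 r))
    (hA' : ∀ z ∈ ball (0 : B) r, ‖A z‖ ≤ C) {x : B} (hx : x ∈ ball (0 : B) r) (c : V) :
    ∃ S : ℝ → V, S 0 = c ∧ ∀ t ∈ Icc (0 : ℝ) 1,
      HasDerivWithinAt S (-(A (t • x) x (S t))) (Icc 0 1) t := by
  have hx' : ‖x‖ < r := by simpa using hx
  have hmem : ∀ t ∈ Icc (0 : ℝ) 1, t • x ∈ ball (0 : B) r := fun t ht => by
    rw [mem_ball_zero_iff, norm_smul, Real.norm_of_nonneg ht.1]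
    exact (mul_le_of_le_one_left (norm_nonneg _) ht.2).trans_lt hx'
  have hb : ∀ t ∈ Icc (0 : ℝ) 1, ‖A (t • x) x‖ ≤ 1 / 2 := fun t ht =>
    ((A (t • x)).le_of_opNorm_le (hA' _ (hmem t ht)) x).trans
      ((mul_le_mul_of_nonneg_left hx'.le hC).trans hCr)
  -- On the ball of radius `‖c‖` around `c` the speed is at most `1/2 * 2‖c‖ = ‖c‖`, so the solution
  -- cannot leave it before time one.
  have hPL : IsPicardLindelof (fun t y => -(A (t • x) x y)) (tmin := 0) (tmax := 1)
      ⟨0, by simp⟩ c ‖c‖₊ 0 ‖c‖₊ 1 := by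
    refine ⟨fun t ht => ?_, fun y _ => ?_, fun t ht y hy => ?_, by simp⟩
    · refine (LipschitzWith.of_dist_le_mul fun y y' => ?_).lipschitzOnWith
      rw [dist_eq_norm, dist_eq_norm, neg_sub_neg, ← map_sub, norm_sub_rev y y']
      refine ((A (t • x) x).le_of_opNorm_le (hb t ht) _).trans ?_
      gcongr
      norm_num
    · have h1 : ContinuousOn (fun t : ℝ => A (t • x)) (Icc 0 1) :=
        hA.comp (by fun_prop) hmem
      exact ((h1.clm_apply continuousOn_const).clm_apply continuousOn_const).neg
    · rw [norm_neg]
      refine ((A (t • x) x).le_of_opNorm_le (hb t ht) _).trans ?_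
      have h2 : ‖y‖ ≤ ‖c‖ + ‖c‖ := by
        have := mem_closedBall_iff_norm.1 hy
        have h3 := norm_le_norm_add_norm_sub' y c
        simp only [coe_nnnorm] at this
        linarith
      simp only [coe_nnnorm]
      linarith
  exact hPL.exists_eq_forall_mem_Icc_hasDerivWithinAt₀

/-- The value of parallel transport along rays is differentiable, with the expected derivative. -/
theorem hasFDerivAt_radial_solution {A : B → B →L[ℝ] V →L[ℝ] V} {r C : ℝ} (hr1 : r ≤ 1)
    (hC : 0 ≤ C)
    (hA : ∀ z ∈ ball (0 : B) r, DifferentiableAt ℝ A z ∧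
      ‖A z‖ ≤ C ∧ ‖fderiv ℝ A z‖ ≤ C ∧ ∀ z' ∈ ball (0 : B) r,
        ‖A z' - A z - fderiv ℝ A z (z' - z)‖ ≤ C * ‖z' - z‖ ^ 2)
    (hflat : ∀ z ∈ ball (0 : B) r, ∀ u v c, fderiv ℝ A z u v c - fderiv ℝ A z v u c +
      A z u (A z v c) - A z v (A z u c) = 0)
    {S : B → ℝ → V} {c : V} (hS0 : ∀ x ∈ ball (0 : B) r, S x 0 = c)
    (hS : ∀ x ∈ ball (0 : B) r, ∀ t ∈ Icc (0 : ℝ) 1,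
      HasDerivWithinAt (S x) (-(A (t • x) x (S x t))) (Icc 0 1) t)
    {x : B} (hx : x ∈ ball (0 : B) r) :
    HasFDerivAt (fun y => S y 1) (-((A x).flip (S x 1))) x := by
  have hmem : ∀ x ∈ ball (0 : B) r, ∀ t ∈ Icc (0 : ℝ) 1, t • x ∈ ball (0 : B) r := by
    intro x hx t ht
    rw [mem_ball_zero_iff] at hx ⊢
    rw [norm_smul, Real.norm_of_nonneg ht.1]
    exact (mul_le_of_le_one_left (norm_nonneg _) ht.2).trans_lt hx
  have hScont : ContinuousOn (S x) (Icc 0 1) := fun t ht => (hS x hx t ht).continuousWithinAt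
  obtain ⟨N, hN⟩ := (isCompact_Icc.image_of_continuousOn hScont).isBounded.exists_norm_le
  have hN' : ∀ t ∈ Icc (0 : ℝ) 1, ‖S x t‖ ≤ N := fun t ht => hN _ (mem_image_of_mem _ ht)
  have hN0 : 0 ≤ N := (norm_nonneg _).trans (hN' 0 (by simp))
  set C' : ℝ := (2 * C + 2 * C * C) * N with hC'
  have key : ∀ y ∈ ball (0 : B) r,
      ‖S y 1 - S x 1 + A x (y - x) (S x 1)‖ ≤ gronwallBound 0 C (C' * ‖y - x‖ ^ 2) 1 := by
    intro y hy
    set h := y - x with hh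
    have hyx : y = x + h := by simp [hh]
    -- `w` is the error of the expected first-order expansion at time `t`. Flatness makes it satisfy
    -- a linear equation with a source of order `‖h‖²`, so Grönwall gives `w 1 = O(‖h‖²)`.
    let w : ℝ → V := fun t => S y t - S x t + t • A (t • x) h (S x t)
    let w' : ℝ → V := fun t => -(A (t • y) y (S y t)) + A (t • x) x (S x t) +
      (A (t • x) h (S x t) + t • (fderiv ℝ A (t • x) x h (S x t) -
        A (t • x) h (A (t • x) x (S x t))))
    have hw : ∀ t ∈ Icc (0 : ℝ) 1, HasDerivWithinAt w (w' t) (Icc 0 1) t := by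
      intro t ht
      have e1 : HasDerivWithinAt (fun t : ℝ => A (t • x)) (fderiv ℝ A (t • x) x) (Icc 0 1) t := by
        have e0 : HasDerivAt (fun t : ℝ => t • x) x t := by
          simpa using (hasDerivAt_id t).smul_const x
        exact ((hA _ (hmem x hx t ht)).1.hasFDerivAt.comp_hasDerivAt t e0).hasDerivWithinAt
      have e2 : HasDerivWithinAt (fun t : ℝ => A (t • x) h) (fderiv ℝ A (t • x) x h) (Icc 0 1) t := by
        simpa using e1.clm_apply (hasDerivWithinAt_const t (Icc 0 1) h)
      have e3 := e2.clm_apply (hS x hx t ht)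
      have e4 := ((hS y hy t ht).sub (hS x hx t ht)).add ((hasDerivWithinAt_id t _).smul e3)
      refine e4.congr_deriv ?_
      simp only [w', id, map_neg]
      module
    have hw0 : ‖w 0‖ ≤ 0 := by simp [w, hS0 x hx, hS0 y hy]
    have hb : ∀ t ∈ Ico (0 : ℝ) 1, ‖w' t‖ ≤ C * ‖w t‖ + C' * ‖h‖ ^ 2 := by
      intro t ht'
      have ht : t ∈ Icc (0 : ℝ) 1 := ⟨ht'.1, ht'.2.le⟩
      have hzx := hmem x hx t ht
      have hzy := hmem y hy t ht
      obtain ⟨-, b1, b2, b3⟩ := hA _ hzx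
      have b4 := b3 _ hzy
      have b5 := (hA _ hzy).2.1
      have hd : t • y - t • x = t • h := by rw [hh, smul_sub]
      rw [hd] at b4
      have hth : ‖t • h‖ ≤ ‖h‖ := by
        rw [norm_smul, Real.norm_of_nonneg ht.1]
        exact mul_le_of_le_one_left (norm_nonneg _) ht.2
      have hy1 : ‖y‖ ≤ 1 := (mem_ball_zero_iff.1 hy).le.trans hr1
      have hx1 : ‖x‖ ≤ 1 := (mem_ball_zero_iff.1 hx).le.trans hr1
      let R := A (t • y) - A (t • x) - fderiv ℝ A (t • x) (t • h)
      have hR : ‖R‖ ≤ C * ‖h‖ ^ 2 := b4.trans (by gcongr)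
      have hf := hflat _ hzx x h (S x t)
      -- Flatness (`e5`) exchanges the roles of `x` and `h` in the derivative of `A`, after which
      -- all terms of first order in `h` are absorbed in `w` or in the Taylor remainder `R`.
      have hid : w' t = -(A (t • y) y (w t)) - R y (S x t) - t • fderiv ℝ A (t • x) h h (S x t)
          + t • (A (t • y) y (A (t • x) h (S x t)) - A (t • x) x (A (t • x) h (S x t))) := by
        have e5 : fderiv ℝ A (t • x) x h (S x t) - A (t • x) h (A (t • x) x (S x t)) =
            fderiv ℝ A (t • x) h x (S x t) - A (t • x) x (A (t • x) h (S x t)) := by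
          rw [← sub_eq_zero, ← hf]
          abel
        simp only [w', e5, w, R, _root_.sub_apply, map_sub, map_add, map_smul,
          _root_.smul_apply]
        have e6 : ∀ L : B →L[ℝ] V →L[ℝ] V, L y (S x t) = L x (S x t) + L h (S x t) := by
          intro L
          rw [hyx, map_add, _root_.add_apply]
        rw [e6 (A (t • x)), e6 (fderiv ℝ A (t • x) h)]
        module
      have c1 : ‖A (t • y) y‖ ≤ C := ((A (t • y)).le_of_opNorm_le b5 y).trans
        (mul_le_of_le_one_right hC hy1)
      have c2 : ‖R y (S x t)‖ ≤ C * ‖h‖ ^ 2 * N := by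
        refine ((R y).le_of_opNorm_le ((R.le_of_opNorm_le hR y).trans
          (mul_le_of_le_one_right (by positivity) hy1)) _).trans ?_
        gcongr
        exact hN' t ht
      have c3 : ‖t • fderiv ℝ A (t • x) h h (S x t)‖ ≤ C * ‖h‖ ^ 2 * N := by
        rw [norm_smul, Real.norm_of_nonneg ht.1]
        refine (mul_le_of_le_one_left (norm_nonneg _) ht.2).trans ?_
        have e8 : ‖fderiv ℝ A (t • x) h h‖ ≤ C * ‖h‖ ^ 2 :=
          ((fderiv ℝ A (t • x) h).le_of_opNorm_le
            ((fderiv ℝ A (t • x)).le_of_opNorm_le b2 h) h).trans_eq (by ring)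
        refine ((fderiv ℝ A (t • x) h h).le_of_opNorm_le e8 _).trans ?_
        gcongr
        exact hN' t ht
      have c4 : ‖A (t • x) h (S x t)‖ ≤ C * ‖h‖ * N := by
        refine ((A (t • x) h).le_of_opNorm_le ((A (t • x)).le_of_opNorm_le b1 h) _).trans ?_
        gcongr
        exact hN' t ht
      have c5 : ‖A (t • y) y - A (t • x) x‖ ≤ 2 * C * ‖h‖ := by
        have e7 : A (t • y) y - A (t • x) x = (A (t • y) - A (t • x)) x + A (t • y) h := by
          nth_rw 2 [hyx]
          rw [map_add, _root_.sub_apply]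
          abel
        have hAA : ‖A (t • y) - A (t • x)‖ ≤ C * ‖h‖ := by
          have := (convex_ball (0 : B) r).norm_image_sub_le_of_norm_fderiv_le (𝕜 := ℝ) (f := A)
            (fun z hz => (hA z hz).1) (fun z hz => (hA z hz).2.2.1) hzx hzy
          rw [hd] at this
          exact this.trans (by gcongr)
        rw [e7]
        have := (A (t • y)).le_of_opNorm_le b5 h
        have h8 := ((A (t • y) - A (t • x)).le_of_opNorm_le hAA x).trans
          (mul_le_of_le_one_right (by positivity) hx1)
        have := norm_add_le ((A (t • y) - A (t • x)) x) (A (t • y) h)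
        linarith
      have c6 : ‖t • (A (t • y) y (A (t • x) h (S x t)) - A (t • x) x (A (t • x) h (S x t)))‖ ≤
          2 * C * C * ‖h‖ ^ 2 * N := by
        rw [norm_smul, Real.norm_of_nonneg ht.1]
        refine (mul_le_of_le_one_left (norm_nonneg _) ht.2).trans ?_
        rw [← _root_.sub_apply]
        refine ((A (t • y) y - A (t • x) x).le_of_opNorm_le c5 _).trans ?_
        calc _ ≤ 2 * C * ‖h‖ * (C * ‖h‖ * N) := by gcongr
          _ = _ := by ring
      have c7 : ‖A (t • y) y (w t)‖ ≤ C * ‖w t‖ := (A (t • y) y).le_of_opNorm_le c1 _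
      rw [hid]
      calc _ ≤ ‖A (t • y) y (w t)‖ + ‖R y (S x t)‖ + ‖t • fderiv ℝ A (t • x) h h (S x t)‖ +
            ‖t • (A (t • y) y (A (t • x) h (S x t)) - A (t • x) x (A (t • x) h (S x t)))‖ := by
            refine (norm_add_le _ _).trans (add_le_add_left ?_ _)
            refine (norm_sub_le _ _).trans (add_le_add_left ?_ _)
            refine (norm_sub_le _ _).trans (add_le_add_left ?_ _)
            rw [norm_neg]
        _ ≤ C * ‖w t‖ + C * ‖h‖ ^ 2 * N + C * ‖h‖ ^ 2 * N + 2 * C * C * ‖h‖ ^ 2 * N := by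
            gcongr
        _ = _ := by rw [hC']; ring
    have := norm_le_gronwallBound_of_norm_deriv_right_le (f := w) (f' := w')
      (fun t ht => (hw t ht).continuousWithinAt) (fun t ht => ?_) hw0 hb 1 (by simp)
    · simpa [w] using this
    · exact (hw t ⟨ht.1, ht.2.le⟩).mono_of_mem_nhdsWithin
        (Icc_mem_nhdsGE_of_mem ht)
  -- With zero initial error the Grönwall bound is linear in the source term.
  have hg : ∃ G : ℝ, ∀ ε, gronwallBound 0 C ε 1 = G * ε := by
    by_cases h0 : C = 0
    · exact ⟨1, fun ε => by simp [h0, gronwallBound_K0]⟩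
    · exact ⟨(Real.exp C - 1) / C, fun ε => by
        rw [gronwallBound_of_K_ne_0 h0]
        ring_nf⟩
  obtain ⟨G, hG⟩ := hg
  refine .of_isLittleO ?_
  have hO : (fun y => S y 1 - S x 1 - (-((A x).flip (S x 1))) (y - x)) =O[𝓝 x]
      fun y => ‖y - x‖ ^ 2 := by
    refine Asymptotics.IsBigO.of_bound (G * C') ?_
    filter_upwards [isOpen_ball.mem_nhds hx] with y hy
    have := key y hy
    rw [hG] at this
    simp only [ContinuousLinearMap.flip_apply, neg_apply, sub_neg_eq_add]
    refine this.trans_eq ?_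
    rw [Real.norm_of_nonneg (by positivity)]
    ring
  exact hO.trans_isLittleO (Asymptotics.isLittleO_pow_sub_sub x (by norm_num))

/-- Bootstrapping: the equation expresses the derivative of `s` through `A` and `s`, so each order
of regularity of `s` yields the next. -/
theorem contDiffOn_of_hasFDerivAt_flat {A : B → B →L[ℝ] V →L[ℝ] V} {U : Set B} (hU : IsOpen U)
    (hA : ContDiffOn ℝ ∞ A U) {s : B → V}
    (hs : ∀ z ∈ U, HasFDerivAt s (-((A z).flip (s z))) z) : ContDiffOn ℝ ∞ s U := by
  refine contDiffOn_infty.2 fun n => ?_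
  induction n with
  | zero => exact contDiffOn_zero.2 fun z hz => (hs z hz).continuousAt.continuousWithinAt
  | succ n ih =>
    refine (contDiffOn_succ_iff_fderiv_of_isOpen hU).2
      ⟨fun z hz => (hs z hz).differentiableAt.differentiableWithinAt,
        fun h => (WithTop.natCast_ne_top n h).elim, ?_⟩
    have h : ContDiffOn ℝ n (fun z => -((A z).flip (s z))) U := by
      have h1 : ContDiffOn ℝ n (fun z => (A z).flip) U :=
        (ContinuousLinearMap.flipₗᵢ ℝ B V V).toContinuousLinearEquiv.contDiff.comp_contDiffOn
          (hA.of_le (by norm_cast; exact le_top))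
      exact (h1.clm_apply ih).neg
    exact h.congr fun z hz => (hs z hz).fderiv

/-- Local existence of parallel sections for a flat connection form. -/
theorem exists_hasFDerivAt_of_flat [CompleteSpace V] {A : B → B →L[ℝ] V →L[ℝ] V} {U : Set B}
    (hU : IsOpen U) {z₀ : B} (hz₀ : z₀ ∈ U) (hA : ContDiffOn ℝ ∞ A U)
    (hflat : ∀ z ∈ U, ∀ u v c, fderiv ℝ A z u v c - fderiv ℝ A z v u c +
      A z u (A z v c) - A z v (A z u c) = 0) :
    ∃ W : Set B, IsOpen W ∧ z₀ ∈ W ∧ W ⊆ U ∧ ∀ c : V, ∃ s : B → V, s z₀ = c ∧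
      ContDiffOn ℝ ∞ s W ∧ ∀ z ∈ W, HasFDerivAt s (-((A z).flip (s z))) z := by
  let A' : B → B →L[ℝ] V →L[ℝ] V := fun x => A (x + z₀)
  have hA' : ContDiffAt ℝ ∞ A' 0 := by
    have h1 : ContDiffAt ℝ ∞ A (0 + z₀) := by
      rw [zero_add]
      exact hA.contDiffAt (hU.mem_nhds hz₀)
    exact h1.comp 0 (by fun_prop)
  obtain ⟨r, hr, C, hC, hr1, hCr, hb⟩ := hA'.exists_taylor_bounds
  obtain ⟨R, hR, hRU⟩ := Metric.isOpen_iff.1 hU z₀ hz₀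
  set ρ := min r R with hρ
  have hρ0 : 0 < ρ := lt_min hr hR
  have hsub := ball_subset_ball (x := (0 : B)) (min_le_left r R)
  have hb' : ∀ z ∈ ball (0 : B) ρ, DifferentiableAt ℝ A' z ∧
      ‖A' z‖ ≤ C ∧ ‖fderiv ℝ A' z‖ ≤ C ∧ ∀ z' ∈ ball (0 : B) ρ,
        ‖A' z' - A' z - fderiv ℝ A' z (z' - z)‖ ≤ C * ‖z' - z‖ ^ 2 := fun z hz => by
    obtain ⟨h1, h2, h3, h4⟩ := hb z (hsub hz)
    exact ⟨h1, h2, h3, fun z' hz' => h4 z' (hsub hz')⟩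
  have hmemU : ∀ z ∈ ball (0 : B) ρ, z + z₀ ∈ U := fun z hz => hRU (by
    rw [mem_ball_iff_norm, add_sub_cancel_right]
    exact (mem_ball_zero_iff.1 hz).trans_le (min_le_right _ _))
  have hflat' : ∀ z ∈ ball (0 : B) ρ, ∀ u v c, fderiv ℝ A' z u v c - fderiv ℝ A' z v u c +
      A' z u (A' z v c) - A' z v (A' z u c) = 0 := fun z hz u v c => by
    have h1 : fderiv ℝ A' z = fderiv ℝ A (z + z₀) := fderiv_comp_add_right z₀
    rw [h1]
    exact hflat _ (hmemU z hz) u v c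
  have hW : ∀ z ∈ ball z₀ ρ, z - z₀ ∈ ball (0 : B) ρ := fun z hz => by
    rwa [mem_ball_zero_iff, ← mem_ball_iff_norm]
  refine ⟨ball z₀ ρ, isOpen_ball, mem_ball_self hρ0,
    fun z hz => by simpa using hmemU _ (hW z hz), fun c => ?_⟩
  have h1 : ∀ x, ∃ S : ℝ → V, x ∈ ball (0 : B) ρ → S 0 = c ∧ ∀ t ∈ Icc (0 : ℝ) 1,
      HasDerivWithinAt S (-(A' (t • x) x (S t))) (Icc 0 1) t := fun x => by
    by_cases hx : x ∈ ball (0 : B) ρ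
    · obtain ⟨S, hS⟩ := exists_radial_solution hC
        ((mul_le_mul_of_nonneg_left (min_le_left _ _) hC).trans hCr)
        (fun z hz => (hb' z hz).1.continuousAt.continuousWithinAt) (fun z hz => (hb' z hz).2.1) hx c
      exact ⟨S, fun _ => hS⟩
    · exact ⟨0, fun h => (hx h).elim⟩
  choose S hS using h1
  have h2 : ∀ z ∈ ball z₀ ρ, HasFDerivAt (fun z => S (z - z₀) 1)
      (-((A z).flip (S (z - z₀) 1))) z := fun z hz => by
    have h3 := hasFDerivAt_radial_solution ((min_le_left _ _).trans hr1) hC hb' hflat'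
      (fun x hx => (hS x hx).1) (fun x hx => (hS x hx).2) (hW z hz)
    have h4 : A' (z - z₀) = A z := by simp [A']
    rw [h4] at h3
    exact h3.comp z ((hasFDerivAt_id z).sub_const z₀)
  refine ⟨fun z => S (z - z₀) 1, ?_, contDiffOn_of_hasFDerivAt_flat isOpen_ball
    (hA.mono fun z hz => by simpa using hmemU _ (hW z hz)) h2, h2⟩
  -- The ray to the centre is constant, so transport along it keeps the initial value.
  obtain ⟨h5, h6⟩ := hS 0 (by simpa using hρ0)
  have h7 : ∀ t ∈ Icc (0 : ℝ) 1, HasDerivWithinAt (S 0) 0 (Icc 0 1) t := fun t ht => by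
    simpa using h6 t ht
  have := constant_of_has_deriv_right_zero (fun t ht => (h7 t ht).continuousWithinAt)
    (fun t ht => (h7 t ⟨ht.1, ht.2.le⟩).mono_of_mem_nhdsWithin (Icc_mem_nhdsGE_of_mem ht)) 1 (by simp)
  simp [this, h5]

end FlatODE
end

/-! ### From local to global parallel sections -/

noncomputable section

section Covering

/-- A family of local identifications of the fibres with a fixed set, with locally constant
transition functions over a simply connected space, has sections through every point which are
locally constant in the local identifications. -/
theorem exists_locallyConstant_section {X V : Type*} {K : X → Type*} [TopologicalSpace X]
    [SimplyConnectedSpace X] [LocallyPathConnectedSpace X] {U : X → Set X}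
    (hU : ∀ x, IsOpen (U x)) (hxU : ∀ x, x ∈ U x) (g : ∀ _ y : X, V → K y) (h : ∀ _ y : X, K y → V)
    (hgh : ∀ i, ∀ y ∈ U i, ∀ e, g i y (h i y e) = e) (hhg : ∀ i, ∀ y ∈ U i, ∀ c, h i y (g i y c) = c)
    (hloc : ∀ i j, ∀ z ∈ U i ∩ U j, ∀ c, ∀ᶠ y in 𝓝 z, h j y (g i y c) = h j z (g i z c))
    (x₀ : X) (e : K x₀) :
    ∃ σ : ∀ y, K y, σ x₀ = e ∧ ∀ i, ∀ z ∈ U i, ∀ᶠ y in 𝓝 z, h i y (σ y) = h i z (σ z) := by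
  -- With discrete fibre, locally constant transition functions are continuous and glue to a
  -- covering space of `X`.
  let _ : TopologicalSpace V := ⊥
  have : DiscreteTopology V := ⟨rfl⟩
  let Z : FiberBundleCore X X V :=
    { baseSet := U
      isOpen_baseSet := hU
      indexAt := id
      mem_baseSet_at := hxU
      coordChange := fun i j y c => h j y (g i y c)
      coordChange_self := fun i y hy c => hhg i y hy c
      continuousOn_coordChange := by
        rintro i j ⟨z, c⟩ ⟨hz, -⟩
        refine ContinuousAt.continuousWithinAt ?_
        refine (continuousAt_const (y := h j z (g i z c))).congr ?_
        have h1 : ∀ᶠ p : X × V in 𝓝 (z, c), p.2 = c :=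
          ((isOpen_discrete {c}).preimage continuous_snd).mem_nhds rfl
        filter_upwards [continuousAt_fst.eventually (hloc i j z hz c), h1] with p hp hpc
        rw [hpc]
        exact hp.symm
      coordChange_comp := fun i j k y hy c => by rw [hgh j y hy.1.2] }
  have hcov : IsCoveringMap Z.proj :=
    IsCoveringMap.mk _ (fun _ => V) Z.localTrivAt Z.mem_localTrivAt_baseSet
  -- Simple connectedness lets the identity of `X` lift through the covering.
  obtain ⟨s, ⟨hs1, hs2⟩, -⟩ := hcov.existsUnique_continuousMap_lifts (ContinuousMap.id X) x₀
    (⟨x₀, h x₀ x₀ e⟩ : Z.TotalSpace) rfl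
  have hs3 : ∀ y, (s y).1 = y := fun y => congrFun hs2 y
  let c : X → V := fun y => (s y).2
  refine ⟨fun y => g y y (c y), ?_, fun i z hz => ?_⟩
  · have : c x₀ = h x₀ x₀ e := by
      change (s x₀).2 = _
      rw [hs1]
    change g x₀ x₀ (c x₀) = e
    rw [this, hgh x₀ x₀ (hxU x₀)]
  · have h1 : ContinuousAt (fun y => (Z.localTriv i (s y)).2) z := by
      refine continuousAt_snd.comp (ContinuousAt.comp (f := s) (x := z) ?_ s.continuous.continuousAt)
      refine (Z.localTriv i).continuousOn.continuousAt ((Z.localTriv i).open_source.mem_nhds ?_)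
      rw [Z.mem_localTriv_source]
      change (s z).1 ∈ U i
      rwa [hs3]
    have h2 : ∀ y, (Z.localTriv i (s y)).2 = h i y (g y y (c y)) := fun y => by
      change h i (s y).1 (g (s y).1 (s y).1 (c y)) = _
      rw [hs3]
    simp only [h2] at h1
    have h3 := h1.eventually (show {h i z (g z z (c z))} ∈ 𝓝 _ by simp [nhds_discrete])
    exact h3

end Covering

section Parallel

variable {B : Type uB} [NormedAddCommGroup B] [NormedSpace ℝ B]
  {M : Type uM} [TopologicalSpace M] [ChartedSpace B M] [IsManifold 𝓘(ℝ, B) ∞ M]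

theorem Sect.sum_smul_apply {F : SmoothVB.{uB, uM, v, w} B M} {ι : Type*} [Fintype ι] (c : ι → ℝ)
    (b : ι → Sect F) (x : M) : (∑ i, c i • b i) x = ∑ i, c i • b i x :=
  Sect.sum_apply _ _ _

theorem eventually_eq_of_mvfderiv_eq_zero {W : Type*} [NormedAddCommGroup W] [NormedSpace ℝ W]
    {f : M → W} {x : M} (hf : ∀ᶠ y in 𝓝 x, MDifferentiableAt 𝓘(ℝ, B) 𝓘(ℝ, W) f y ∧
      mvfderiv 𝓘(ℝ, B) f y = 0) : ∀ᶠ y in 𝓝 x, f y = f x := by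
  let φ := extChartAt 𝓘(ℝ, B) x
  have h1 : ∀ᶠ z in 𝓝 (φ x), HasFDerivAt (f ∘ φ.symm) (0 : B →L[ℝ] W) z := by
    have h2 : ∀ᶠ z in 𝓝 (φ x), MDifferentiableAt 𝓘(ℝ, B) 𝓘(ℝ, W) f (φ.symm z) ∧
        mvfderiv 𝓘(ℝ, B) f (φ.symm z) = 0 := by
      refine Filter.Tendsto.eventually (f := φ.symm) (l₂ := 𝓝 x) ?_ hf
      have := continuousAt_extChartAt_symm (I := 𝓘(ℝ, B)) x
      rwa [ContinuousAt, extChartAt_to_inv] at this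
    filter_upwards [h2, extChartAt_target_mem_nhds (I := 𝓘(ℝ, B)) x] with z ⟨h3, h4⟩ hz
    have h5 : MDifferentiableAt 𝓘(ℝ, B) 𝓘(ℝ, B) φ.symm z :=
      (((contMDiffOn_extChartAt_symm (I := 𝓘(ℝ, B)) (n := ∞) x).contMDiffAt
        ((isOpen_extChartAt_target x).mem_nhds hz))).mdifferentiableAt (by simp)
    have h6 : mfderiv 𝓘(ℝ, B) 𝓘(ℝ, W) f (φ.symm z) = 0 := by
      ext u
      exact congrArg (fun A => A u) h4
    have h7 := mfderiv_comp z h3 h5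
    have h8 : MDifferentiableAt 𝓘(ℝ, B) 𝓘(ℝ, W) (f ∘ φ.symm) z := h3.comp z h5
    rw [h6, mfderiv_eq_fderiv] at h7
    have h9 : fderiv ℝ (f ∘ φ.symm) z = 0 := by
      rw [h7]
      exact ContinuousLinearMap.zero_comp _
    rw [← h9]
    exact h8.differentiableAt.hasFDerivAt
  obtain ⟨r, hr, h2⟩ := Metric.eventually_nhds_iff_ball.1 h1
  have h3 : ∀ z ∈ Metric.ball (φ x) r, f (φ.symm z) = f x := fun z hz => by
    have := (convex_ball (φ x) r).norm_image_sub_le_of_norm_hasFDerivWithin_le (𝕜 := ℝ)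
      (f := f ∘ φ.symm) (C := 0)
      (fun y hy => (h2 y hy).hasFDerivWithinAt) (fun y _ => by simp)
      (Metric.mem_ball_self hr) hz
    rw [zero_mul, norm_le_zero_iff, sub_eq_zero] at this
    simpa [φ] using this
  filter_upwards [(continuousAt_extChartAt (I := 𝓘(ℝ, B)) x).preimage_mem_nhds
    (Metric.ball_mem_nhds _ hr), extChartAt_source_mem_nhds (I := 𝓘(ℝ, B)) x] with y hy hys
  rw [← h3 _ hy]
  exact congrArg f (φ.left_inv hys).symm

variable [FiniteDimensional ℝ B] [T2Space M]

namespace RelConn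

variable {K : SmoothVB.{uB, uM, v₁, w₁} B M} {E : SmoothVB.{uB, uM, v₂, w₂} B M}

/-- A frame of parallel sections over `U`. -/
structure IsParallelFrame (D : RelConn K E) (U : Set M)
    (e : Fin (finrank ℝ K.Model) → Sect K) : Prop where
  isOpen : IsOpen U
  linearIndependent : ∀ y ∈ U, LinearIndependent ℝ (fun i => e i y)
  parallel : ∀ i, ∀ y ∈ U, D.D (e i) y = 0

variable {D : RelConn K E} {U : Set M} {e : Fin (finrank ℝ K.Model) → Sect K}

theorem IsParallelFrame.parallel_sum (he : D.IsParallelFrame U e)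
    (c : Fin (finrank ℝ K.Model) → ℝ) {y : M} (hy : y ∈ U) : D.D (∑ i, c i • e i) y = 0 := by
  rw [map_sum, OneForm.sum_apply]
  refine Finset.sum_eq_zero fun i _ => ?_
  rw [map_smul, ContMDiffSection.coe_smul, Pi.smul_apply, he.parallel i y hy, smul_zero]

/-- Parallel sections have locally constant coefficients in a parallel frame. -/
theorem IsParallelFrame.exists_eventually_eq (he : D.IsParallelFrame U e)
    (hl : ∀ x, Function.Injective (D.l.app x)) {x : M} (hx : x ∈ U) {s : Sect K}
    (hs : ∀ᶠ y in 𝓝 x, D.D s y = 0) :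
    ∃ c : Fin (finrank ℝ K.Model) → ℝ, ∀ᶠ y in 𝓝 x, s y = ∑ i, c i • e i y := by
  obtain ⟨c, hc⟩ := exists_coeff (he.linearIndependent x hx) (by simp) s
  refine ⟨fun i => c i x, ?_⟩
  have h1 : ∀ i, ∀ᶠ y in 𝓝 x, c i y = c i x := fun i => by
    refine eventually_eq_of_mvfderiv_eq_zero (B := B) ?_
    filter_upwards [hc.eventually_nhds, hs, he.isOpen.mem_nhds hx] with y h2 h3 h4
    refine ⟨(c i).contMDiff.contMDiffAt.mdifferentiableAt (by simp), ?_⟩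
    ext u
    -- As the frame is parallel, `D s = l(∑ dcⱼ eⱼ)`; injectivity of `l` then gives `dcⱼ = 0`.
    have h5 := D.D_apply_of_eventuallyEq_sum h2 u
    rw [h3] at h5
    have h6 : D.l.app y (∑ j, mvfderiv 𝓘(ℝ, B) (c j) y u • e j y) = 0 := by
      rw [map_sum]
      simp only [map_smul]
      refine Eq.trans ?_ h5.symm
      refine Finset.sum_congr rfl fun j _ => ?_
      rw [he.parallel j y h4]
      simp
    have h7 := hl y (h6.trans (map_zero _).symm)
    exact Fintype.linearIndependent_iff.1 (he.linearIndependent y h4) _ h7 i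
  filter_upwards [hc, Filter.eventually_all.2 h1] with y h2 h3
  rw [h2]
  exact Finset.sum_congr rfl fun i _ => by rw [h3]

/-- Coefficients in a parallel frame are locally constant, so the zero set of a solution is open and
closed. -/
theorem eq_zero_of_mem_Sol [PreconnectedSpace M]
    (hl : ∀ x, Function.Injective (D.l.app x))
    (hfr : ∀ x, ∃ U e, x ∈ U ∧ D.IsParallelFrame U e) {s : Sect K} (hs : s ∈ D.Sol) {x₀ : M}
    (hx₀ : s x₀ = 0) : s = 0 := by
  have hs' : D.D s = 0 := hs
  have key : ∀ z, ∀ᶠ y in 𝓝 z, s y = 0 → ∀ᶠ y' in 𝓝 z, s y' = 0 := fun z => by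
    obtain ⟨U, e, hz, he⟩ := hfr z
    obtain ⟨c, hc⟩ := he.exists_eventually_eq hl hz (s := s)
      (Filter.Eventually.of_forall fun y => by rw [hs']; rfl)
    filter_upwards [hc, he.isOpen.mem_nhds hz] with y h1 h2 h3
    rw [h1] at h3
    have h4 := Fintype.linearIndependent_iff.1 (he.linearIndependent y h2) _ h3
    filter_upwards [hc] with y' h5
    simp [h5, h4]
  have hclopen : IsClopen {y | s y = 0} := by
    refine ⟨?_, ?_⟩
    · refine isClosed_of_closure_subset fun z hz => ?_
      obtain ⟨y, h1, h2⟩ := (mem_closure_iff_frequently.1 hz).and_eventually (key z) |>.exists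
      exact (h2 h1).self_of_nhds
    · refine isOpen_iff_mem_nhds.2 fun z hz => ?_
      exact (key z).self_of_nhds hz
  have := hclopen.eq_univ ⟨x₀, hx₀⟩
  ext y
  exact (this ▸ mem_univ y : y ∈ {y | s y = 0})

/-- The coordinates in the parallel frames have locally constant transition functions, so
`exists_locallyConstant_section` applies. Near each point the resulting section is a constant
combination of a parallel frame, hence smooth and parallel. -/
theorem exists_mem_Sol_apply_eq [SimplyConnectedSpace M]
    (hl : ∀ x, Function.Injective (D.l.app x))
    (hfr : ∀ x, ∃ U e, x ∈ U ∧ D.IsParallelFrame U e) (x₀ : M) (k : K.Fiber x₀) :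
    ∃ s ∈ D.Sol, s x₀ = k := by
  have : LocallyPathConnectedSpace M := ChartedSpace.locallyPathConnectedSpace B M
  choose U e hxU he using hfr
  have hb : ∀ i, ∀ y ∈ U i, ∃ b : Basis (Fin (finrank ℝ K.Model)) ℝ (K.Fiber y),
      ∀ j, b j = e i j y := fun i y hy =>
    ⟨basisOfLinearIndependentOfCardEqFinrank' _ ((he i).linearIndependent y hy)
      (by simp [K.finrank_fiber]), fun j => by simp⟩
  classical
  let g : ∀ _ y : M, (Fin (finrank ℝ K.Model) → ℝ) → K.Fiber y := fun i y c => ∑ j, c j • e i j y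
  let h : ∀ _ y : M, K.Fiber y → (Fin (finrank ℝ K.Model) → ℝ) := fun i y k =>
    if hy : y ∈ U i then (hb i y hy).choose.repr k else 0
  have hgh : ∀ i, ∀ y ∈ U i, ∀ k, g i y (h i y k) = k := fun i y hy k => by
    simp only [g, h, dif_pos hy]
    conv_rhs => rw [← (hb i y hy).choose.sum_repr k]
    simp only [(hb i y hy).choose_spec]
  have hhg : ∀ i, ∀ y ∈ U i, ∀ c, h i y (g i y c) = c := fun i y hy c => by
    have h0 : g i y c = (hb i y hy).choose.equivFun.symm c := by
      rw [Basis.equivFun_symm_apply]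
      exact Finset.sum_congr rfl fun j _ => by rw [(hb i y hy).choose_spec]
    rw [h0]
    simp only [h, dif_pos hy]
    exact (hb i y hy).choose.equivFun.apply_symm_apply c
  have hloc : ∀ i j, ∀ z ∈ U i ∩ U j, ∀ c, ∀ᶠ y in 𝓝 z, h j y (g i y c) = h j z (g i z c) := by
    intro i j z hz c
    obtain ⟨c', hc'⟩ := (he j).exists_eventually_eq hl hz.2 (s := ∑ m, c m • e i m) (by
      filter_upwards [(he i).isOpen.mem_nhds hz.1] with y hy
      exact (he i).parallel_sum c hy)
    have h5 : ∀ᶠ y in 𝓝 z, h j y (g i y c) = c' := by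
      filter_upwards [hc', (he j).isOpen.mem_nhds hz.2] with y h6 h7
      rw [← hhg j y h7 c']
      congr 1
      rw [← show _ = g j y c' from h6]
      exact (Sect.sum_smul_apply _ _ _).symm
    filter_upwards [h5] with y h6
    rw [h6, h5.self_of_nhds]
  obtain ⟨σ, h1, h2⟩ := exists_locallyConstant_section (fun i => (he i).isOpen) hxU g h hgh hhg
    hloc x₀ k
  have h3 : ∀ z, ∀ᶠ y in 𝓝 z, σ y = (∑ j, h z z (σ z) j • e z j : Sect K) y := fun z => by
    filter_upwards [h2 z z (hxU z), (he z).isOpen.mem_nhds (hxU z)] with y h4 h5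
    rw [← hgh z y h5 (σ y), h4]
    exact (Sect.sum_smul_apply _ _ _).symm
  let s : Sect K := ⟨σ, fun z =>
    (∑ j, h z z (σ z) j • e z j : Sect K).contMDiff.contMDiffAt.congr_of_eventuallyEq (by
      filter_upwards [h3 z] with y hy
      rw [hy])⟩
  refine ⟨s, ?_, h1⟩
  rw [Sol, LinearMap.mem_ker]
  ext1 z
  rw [D.D_congr (h3 z)]
  exact (he z).parallel_sum _ (hxU z)

end RelConn
end Parallel
end

/-! ### Flatness and local parallel frames -/

noncomputable section

section LocalParallel

set_option maxSynthPendingDepth 3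

variable {B : Type uB} [NormedAddCommGroup B] [NormedSpace ℝ B]
  {M : Type uM} [TopologicalSpace M] [ChartedSpace B M] [IsManifold 𝓘(ℝ, B) ∞ M]
  [FiniteDimensional ℝ B] [T2Space M]

namespace RelConn

variable {K : SmoothVB.{uB, uM, v₁, w₁} B M} {E : SmoothVB.{uB, uM, v₂, w₂} B M}
  {D : RelConn K E}

/-- Surjectivity supplies a section of `J¹_D F` with the same value at `x` and no curvature there.
For injective `l`, `D α = l ∘ η` forces equal values to give equal jets, and the curvature depends
on the jet only. -/
theorem curvature_eq_zero_of_prolSurjective (hl : ∀ x, Function.Injective (D.l.app x))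
    (hP : D.ProlSurjective) {α : Sect K} {η : OneForm K} {x : M}
    (h : ∀ᶠ y in 𝓝 x, ∀ u : TangentSpace 𝓘(ℝ, B) y, D.D α y u = D.l.app y (η y u))
    (X Y : VField B M) : D.curvature η X Y x = 0 := by
  obtain ⟨_, ⟨α', η', h1, rfl, h3⟩, h4⟩ := hP x (α x)
  have h5 : α' x = α x := by simpa [spencerJet, Sect.jet1] using h4
  have h6 : (α - α') x = 0 := by simp [h5]
  have h7 : ∀ᶠ y in 𝓝 x, ∀ u : TangentSpace 𝓘(ℝ, B) y,
      D.D (α - α') y u = D.l.app y ((η - η') y u) := by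
    filter_upwards [h] with y hy u
    simp [hy, h1]
  have h8 : (η - η') x = (α - α').localDeriv x := by
    ext u
    refine hl x ?_
    rw [← D.D_apply_of_eq_zero h6, h7.self_of_nhds]
  have h9 := D.curvature_eq_zero h6 h8 h7 X Y
  have h10 := D.curvature_add (η - η') η' X Y x
  rwa [sub_add_cancel, h9, h3, add_zero] at h10

theorem finrank_model_eq (hl : ∀ x, Function.Injective (D.l.app x)) (x : M) :
    finrank ℝ K.Model = finrank ℝ E.Model := by
  rw [← K.finrank_fiber x, ← E.finrank_fiber x]
  exact (LinearEquiv.ofBijective _ ⟨hl x, D.surj x⟩).finrank_eq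

variable {ι : Type*} [Fintype ι] [DecidableEq ι]

/-- Over `W`, the relative connection `D` has connection form `Θ` with respect to the frame `b` and
the coordinate vector fields of `S`. -/
structure IsConnForm (D : RelConn K E) {U : Set M} {x₀ : M} (S : CoordSystem (B := B) U x₀) (b : ι → Sect K)
    (W : Set M) (Θ : M → B →L[ℝ] (ι → ℝ) →L[ℝ] (ι → ℝ)) : Prop where
  isOpen : IsOpen W
  mem : x₀ ∈ W
  subset : W ⊆ U
  contMDiff : ContMDiff 𝓘(ℝ, B) 𝓘(ℝ, B →L[ℝ] (ι → ℝ) →L[ℝ] (ι → ℝ)) ∞ Θ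
  linearIndependent : ∀ y ∈ W, LinearIndependent ℝ (fun i => b i y)
  apply_eq : ∀ y ∈ W, ∀ i u,
    D.D (b i) y (S.field u y) = ∑ m, Θ y u (Pi.single i 1) m • D.l.app y (b m y)

theorem exists_isConnForm (hl : ∀ x, Function.Injective (D.l.app x)) (x₀ : M) :
    ∃ (U : Set M) (S : CoordSystem (B := B) U x₀) (b : Fin (finrank ℝ K.Model) → Sect K) (W : Set M)
      (Θ : M → B →L[ℝ] (Fin (finrank ℝ K.Model) → ℝ) →L[ℝ] (Fin (finrank ℝ K.Model) → ℝ)),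
      D.IsConnForm S b W Θ := by
  obtain ⟨b, U₁, hU₁, hx₁, hb⟩ := K.exists_frame x₀
  obtain ⟨U, ⟨S⟩⟩ := exists_coordSystem (B := B) x₀
  let β := finBasis ℝ B
  have hlb : LinearIndependent ℝ (fun i => D.l.map (b i) x₀) :=
    (hb x₀ hx₁).map' _ (LinearMap.ker_eq_bot.2 (hl x₀))
  have hcoef : ∀ a j, ∃ c : Fin (finrank ℝ K.Model) → C^∞⟮𝓘(ℝ, B), M; 𝓘(ℝ, ℝ), ℝ⟯, ∀ᶠ y in 𝓝 x₀,
      (D.D (b j)).along (S.field (β a)) y = ∑ m, c m y • D.l.map (b m) y := fun a j =>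
    exists_coeff hlb (by simp [finrank_model_eq hl x₀]) _
  choose Γ hΓ using hcoef
  let T : Fin (finrank ℝ B) → Fin (finrank ℝ K.Model) → Fin (finrank ℝ K.Model) →
      B →L[ℝ] (Fin (finrank ℝ K.Model) → ℝ) →L[ℝ] (Fin (finrank ℝ K.Model) → ℝ) := fun a j m =>
    (LinearMap.toContinuousLinearMap (β.coord a)).smulRight
      ((ContinuousLinearMap.proj (R := ℝ) (φ := fun _ => ℝ) j).smulRight (Pi.single m 1))
  have hT : ∀ a j m u c m', T a j m u c m' = β.coord a u * (c j * (Pi.single m 1 : _ → ℝ) m') := by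
    intros
    simp [T]
  have hev : ∀ᶠ y in 𝓝 x₀, (y ∈ U₁ ∧ y ∈ U) ∧ ∀ a j,
      (D.D (b j)).along (S.field (β a)) y = ∑ m, Γ a j m y • D.l.map (b m) y :=
    ((hU₁.eventually_mem hx₁).and (S.isOpen.eventually_mem S.mem)).and
      (Filter.eventually_all.2 fun a => Filter.eventually_all.2 fun j => hΓ a j)
  obtain ⟨W, hW, hWo, hxW⟩ := eventually_nhds_iff.1 hev
  refine ⟨U, S, b, W, fun y => ∑ a, ∑ j, ∑ m, Γ a j m y • T a j m, hWo, hxW,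
    fun y hy => (hW y hy).1.2, ?_, fun y hy => hb y (hW y hy).1.1, fun y hy i u => ?_⟩
  · refine ContMDiff.sum fun a _ => ContMDiff.sum fun j _ => ContMDiff.sum fun m _ => ?_
    exact (Γ a j m).contMDiff.smul contMDiff_const
  · have h1 : S.field u y = ∑ a, β.coord a u • S.field (β a) y := by
      have h2 := congrArg (fun v => S.field v y) (β.sum_repr u)
      simp only [map_sum, map_smul] at h2
      rw [← h2]
      exact Sect.sum_smul_apply (F := tangentVB B M) _ _ _
    rw [h1, map_sum]
    have h3 : ∀ a, D.D (b i) y (S.field (β a) y) = ∑ m, Γ a i m y • D.l.app y (b m y) :=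
      fun a => (hW y hy).2 a i
    simp only [map_smul, h3, _root_.sum_apply, _root_.smul_apply, Finset.sum_apply, Pi.smul_apply,
      hT, smul_eq_mul]
    simp only [Finset.smul_sum]
    rw [Finset.sum_comm]
    refine Finset.sum_congr rfl fun m _ => ?_
    rw [Finset.sum_smul]
    refine Finset.sum_congr rfl fun a _ => ?_
    rw [Finset.sum_eq_single i (fun j _ hj => Finset.sum_eq_zero fun m' _ => by simp [hj])
      (by simp), Finset.sum_eq_single m (fun m' _ hm => by simp [hm.symm]) (by simp)]
    simp [smul_smul, mul_comm]

variable {U : Set M} {x₀ : M} {S : CoordSystem (B := B) U x₀} {b : ι → Sect K} {W : Set M}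
  {Θ : M → B →L[ℝ] (ι → ℝ) →L[ℝ] (ι → ℝ)}

theorem IsConnForm.D_apply (hΘ : D.IsConnForm S b W Θ) {s : Sect K}
    {c : ι → C^∞⟮𝓘(ℝ, B), M; 𝓘(ℝ, ℝ), ℝ⟯} {y : M} (hy : y ∈ W)
    (hs : ∀ᶠ z in 𝓝 y, s z = ∑ i, c i z • b i z) (u : B) :
    D.D s y (S.field u y) = D.l.app y (∑ m, (Θ y u (fun i => c i y) m +
      mvfderiv 𝓘(ℝ, B) (c m) y (S.field u y)) • b m y) := by
  rw [D.D_apply_of_eventuallyEq_sum hs, Finset.sum_add_distrib, map_sum]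
  simp only [add_smul, map_add, map_smul, Finset.sum_add_distrib]
  congr 1
  simp only [hΘ.apply_eq y hy, Finset.smul_sum]
  rw [Finset.sum_comm]
  refine Finset.sum_congr rfl fun m _ => ?_
  have h1 : Θ y u (fun i => c i y) = ∑ i, c i y • Θ y u (Pi.single i 1) := by
    conv_lhs => rw [pi_eq_sum_univ' (fun i => c i y), map_sum]
    simp [map_smul]
  rw [h1, Finset.sum_apply, Finset.sum_smul]
  simp [smul_smul]

/-- The coefficients of the connection form. -/
def IsConnForm.coeff (hΘ : D.IsConnForm S b W Θ) (u : B) (c : ι → ℝ) (i : ι) :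
    C^∞⟮𝓘(ℝ, B), M; 𝓘(ℝ, ℝ), ℝ⟯ where
  val y := Θ y u c i
  property :=
    ((ContinuousLinearMap.proj (R := ℝ) (φ := fun _ : ι => ℝ) i).comp
      ((ContinuousLinearMap.apply ℝ (ι → ℝ) c).comp
        (ContinuousLinearMap.apply ℝ ((ι → ℝ) →L[ℝ] (ι → ℝ)) u))).contMDiff.comp hΘ.contMDiff

theorem IsConnForm.coeff_apply (hΘ : D.IsConnForm S b W Θ) (u : B) (c : ι → ℝ) (i : ι) (y : M) :
    hΘ.coeff u c i y = Θ y u c i := rfl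

/-- The components of the coordinate functions. -/
def CoordSystem.comp (S : CoordSystem (B := B) U x₀) (a : B →L[ℝ] ℝ) : C^∞⟮𝓘(ℝ, B), M; 𝓘(ℝ, ℝ), ℝ⟯ where
  val y := a (S.coord y)
  property := a.contMDiff.comp S.coord.contMDiff

theorem CoordSystem.mvfderiv_comp (S : CoordSystem (B := B) U x₀) (a : B →L[ℝ] ℝ) {y : M} (hy : y ∈ U)
    (u : B) : mvfderiv 𝓘(ℝ, B) (CoordSystem.comp S a) y (S.field u y) = a u := by
  have h := mvfderiv_comp_apply' (B := B) (f := a) (g := S.coord) (x := y) a.differentiableAt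
    (S.coord.contMDiff.contMDiffAt.mdifferentiableAt (by simp)) (S.field u y)
  rw [S.coord_field y hy, a.fderiv] at h
  exact h

/-- The connection form of a relative connection with surjective prolongation is flat. -/
theorem IsConnForm.flat (hΘ : D.IsConnForm S b W Θ) (hl : ∀ x, Function.Injective (D.l.app x))
    (hP : D.ProlSurjective) {y : M} (hy : y ∈ W) (u u' : B) (c : ι → ℝ) (m : ι) :
    mvfderiv 𝓘(ℝ, B) (hΘ.coeff u' c m) y (S.field u y) -
      mvfderiv 𝓘(ℝ, B) (hΘ.coeff u c m) y (S.field u' y) +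
      Θ y u (Θ y u' c) m - Θ y u' (Θ y u c) m = 0 := by
  let β := finBasis ℝ B
  let s : Sect K := ∑ i, c i • b i
  let t : B → Sect K := fun v => ∑ i, (b i).smulFun (hΘ.coeff v c i)
  have ht : ∀ v z, t v z = ∑ i, hΘ.coeff v c i z • b i z := fun v z => Sect.sum_apply _ _ _
  -- `η` is the covariant derivative of the section `s` with constant coefficients, so that `(s, η)`
  -- lies in `J¹_D K` near `y` and its curvature is that of the connection applied to `c`.
  let η : OneForm K := ∑ a, OneForm.dsmul
    (CoordSystem.comp S (LinearMap.toContinuousLinearMap (β.coord a))) (t (β a))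
  have hη : ∀ z ∈ W, ∀ v, η z (S.field v z) = t v z := by
    intro z hz v
    simp only [η, OneForm.sum_apply, _root_.sum_apply, OneForm.dsmul_apply,
      CoordSystem.mvfderiv_comp S _ (hΘ.subset hz), ht, hΘ.coeff_apply]
    simp only [Finset.smul_sum]
    rw [Finset.sum_comm]
    refine Finset.sum_congr rfl fun i _ => ?_
    have h1 : Θ z v c i = ∑ a, β.coord a v * Θ z (β a) c i := by
      conv_lhs => rw [← β.sum_repr v, map_sum]
      simp [_root_.sum_apply, Finset.sum_apply]
    rw [h1, Finset.sum_smul]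
    exact Finset.sum_congr rfl fun a _ => by rw [smul_smul]; rfl
  have hs : ∀ z, ∀ᶠ z' in 𝓝 z, s z' = ∑ i, (ContMDiffMap.const (c i) :
      C^∞⟮𝓘(ℝ, B), M; 𝓘(ℝ, ℝ), ℝ⟯) z' • b i z' := fun z =>
    Filter.Eventually.of_forall fun z' => Sect.sum_smul_apply _ _ _
  have hD : ∀ᶠ z in 𝓝 y, ∀ w : TangentSpace 𝓘(ℝ, B) z, D.D s z w = D.l.app z (η z w) := by
    filter_upwards [hΘ.isOpen.mem_nhds hy] with z hz w
    obtain ⟨v, rfl⟩ : ∃ v, S.field v z = w := ⟨_, S.field_coord z (hΘ.subset hz) w⟩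
    rw [hΘ.D_apply hz (hs z), hη z hz, ht]
    congr 1
    refine Finset.sum_congr rfl fun i _ => ?_
    have h1 : mvfderiv 𝓘(ℝ, B) (ContMDiffMap.const (c i) : C^∞⟮𝓘(ℝ, B), M; 𝓘(ℝ, ℝ), ℝ⟯) z
        (S.field v z) = 0 := by
      have := mvfderiv_const (I := 𝓘(ℝ, B)) (x := z) (c i)
      exact congrArg (fun φ => φ (S.field v z)) this
    rw [h1, add_zero]
    rfl
  have hcurv := curvature_eq_zero_of_prolSurjective hl hP hD (S.field u) (S.field u')
  have halong : ∀ v v', D.D (η.along (S.field v)) y (S.field v' y) =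
      D.l.app y (∑ m, (Θ y v' (Θ y v c) m +
        mvfderiv 𝓘(ℝ, B) (hΘ.coeff v c m) y (S.field v' y)) • b m y) := by
    intro v v'
    refine hΘ.D_apply (c := fun i => hΘ.coeff v c i) hy ?_ v'
    filter_upwards [hΘ.isOpen.mem_nhds hy] with z hz
    rw [OneForm.along_apply, hη z hz, ht]
  -- Coordinate fields commute, so the bracket term disappears and the coefficients of the frame can
  -- be compared.
  rw [curvature, mlieBracket_field S u u' (hΘ.subset hy), map_zero, map_zero, sub_zero, halong,
    halong, ← map_sub, ← Finset.sum_sub_distrib] at hcurv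
  simp only [← sub_smul] at hcurv
  have h1 := Fintype.linearIndependent_iff.1 (hΘ.linearIndependent y hy) _
    (hl y (hcurv.trans (map_zero _).symm)) m
  linarith

/-- In a chart the connection form is flat, so parallel coefficient vectors exist with every initial
value. Those starting at the standard basis give sections agreeing with the frame `b` at `x₀`, hence
independent nearby. -/
theorem exists_isParallelFrame (hl : ∀ x, Function.Injective (D.l.app x))
    (hP : D.ProlSurjective) (x₀ : M) : ∃ U e, x₀ ∈ U ∧ D.IsParallelFrame U e := by
  obtain ⟨U, S, b, W, Θ, hΘ⟩ := exists_isConnForm hl x₀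
  let φ := extChartAt 𝓘(ℝ, B) x₀
  let O : Set B := φ.target ∩ φ.symm ⁻¹' W
  have hO : IsOpen O :=
    (continuousOn_extChartAt_symm x₀).isOpen_inter_preimage (isOpen_extChartAt_target x₀) hΘ.isOpen
  have hx₀O : φ x₀ ∈ O := ⟨mem_extChartAt_target x₀, by
    simpa [φ] using hΘ.mem⟩
  have hcoord : ∀ y ∈ W, S.coord y = φ y := fun y hy => S.coord_eq y (hΘ.subset hy)
  have hΘc : ∀ y ∈ W, Θ (φ.symm (S.coord y)) = Θ y := fun y hy => by
    rw [hcoord y hy, φ.left_inv (S.subset (hΘ.subset hy))]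
  let A := fun z => Θ (φ.symm z)
  have hA : ContDiffOn ℝ ∞ A O :=
    ((hΘ.contMDiff.comp_contMDiffOn (contMDiffOn_extChartAt_symm x₀)).mono
      inter_subset_left).contDiffOn
  have hflat : ∀ z ∈ O, ∀ u v c, fderiv ℝ A z u v c - fderiv ℝ A z v u c +
      A z u (A z v c) - A z v (A z u c) = 0 := by
    intro z hz u v c
    have hy : φ.symm z ∈ W := hz.2
    have hzc : S.coord (φ.symm z) = z := by rw [hcoord _ hy, φ.right_inv hz.1]
    have hAd : DifferentiableAt ℝ A z := (hA.contDiffAt (hO.mem_nhds hz)).differentiableAt (by simp)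
    -- On `W` the coefficients are functions of the chart, and the coordinate field of `u` is mapped
    -- to the constant vector `u`.
    have key : ∀ u v m, mvfderiv 𝓘(ℝ, B) (hΘ.coeff v c m) (φ.symm z) (S.field u (φ.symm z)) =
        fderiv ℝ A z u v c m := by
      intro u v m
      let Λ := (ContinuousLinearMap.proj (R := ℝ) (φ := fun _ : Fin (finrank ℝ K.Model) => ℝ) m).comp
        ((ContinuousLinearMap.apply ℝ (Fin (finrank ℝ K.Model) → ℝ) c).comp
          (ContinuousLinearMap.apply ℝ ((Fin (finrank ℝ K.Model) → ℝ) →L[ℝ] _) v))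
      have h1 : HasFDerivAt (fun z => Λ (A z)) (Λ.comp (fderiv ℝ A z)) z :=
        Λ.hasFDerivAt.comp z hAd.hasFDerivAt
      have h2 : (hΘ.coeff v c m : M → ℝ) =ᶠ[𝓝 (φ.symm z)] fun y => Λ (A (S.coord y)) := by
        filter_upwards [hΘ.isOpen.mem_nhds hy] with y' hy'
        change Θ y' v c m = Θ (φ.symm (S.coord y')) v c m
        rw [hΘc y' hy']
      rw [mvfderiv_congr h2, mvfderiv_comp_apply' (B := B) (f := fun z => Λ (A z)) (g := S.coord)
        (by rw [hzc]; exact h1.differentiableAt)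
        (S.coord.contMDiff.contMDiffAt.mdifferentiableAt (by simp)), hzc, h1.fderiv,
        S.coord_field _ (hΘ.subset hy)]
      rfl
    ext m
    have := hΘ.flat hl hP hy u v c m
    rw [key, key] at this
    exact this
  obtain ⟨O', hO', hx', -, hsol⟩ := exists_hasFDerivAt_of_flat hO hx₀O hA hflat
  choose s hs0 hs1 hs2 using hsol
  let W' : Set M := W ∩ S.coord ⁻¹' O'
  have hW' : IsOpen W' := hΘ.isOpen.inter (hO'.preimage S.coord.contMDiff.continuous)
  have hxW' : x₀ ∈ W' := ⟨hΘ.mem, by rw [mem_preimage, hcoord _ hΘ.mem]; exact hx'⟩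
  have hf : ∀ i j, ∃ f : C^∞⟮𝓘(ℝ, B), M; 𝓘(ℝ, ℝ), ℝ⟯, ∀ᶠ y in 𝓝 x₀,
      f y = s (Pi.single i 1) (S.coord y) j := fun i j => by
    refine exists_fun_eventuallyEq (B := B) hW' hxW' ?_
    have h1 : ContMDiffOn 𝓘(ℝ, B) 𝓘(ℝ, Fin (finrank ℝ K.Model) → ℝ) ∞
        (fun y => s (Pi.single i 1) (S.coord y)) W' :=
      (hs1 _).contMDiffOn.comp S.coord.contMDiff.contMDiffOn fun y hy => hy.2
    exact (ContinuousLinearMap.proj (R := ℝ) (φ := fun _ : Fin (finrank ℝ K.Model) => ℝ)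
      j).contMDiff.comp_contMDiffOn h1
  choose f hf using hf
  let e : Fin (finrank ℝ K.Model) → Sect K := fun i => ∑ j, (b j).smulFun (f i j)
  have he : ∀ i y, e i y = ∑ j, f i j y • b j y := fun i y => Sect.sum_apply _ _ _
  have he0 : ∀ i, e i x₀ = b i x₀ := fun i => by
    rw [he, Finset.sum_eq_single i]
    · rw [(hf i i).self_of_nhds, hcoord _ hΘ.mem, hs0]
      simp
    · intro j _ hj
      rw [(hf i j).self_of_nhds, hcoord _ hΘ.mem, hs0]
      simp [hj]
    · simp
  have hli : ∀ᶠ y in 𝓝 x₀, LinearIndependent ℝ (fun i => e i y) := by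
    refine eventually_linearIndependent ?_
    simp only [he0]
    exact hΘ.linearIndependent x₀ hΘ.mem
  have hpar : ∀ᶠ y in 𝓝 x₀, ∀ i, D.D (e i) y = 0 := by
    have h1 : ∀ᶠ y in 𝓝 x₀, ∀ i j, f i j y = s (Pi.single i 1) (S.coord y) j :=
      Filter.eventually_all.2 fun i => Filter.eventually_all.2 fun j => hf i j
    filter_upwards [h1.eventually_nhds, hW'.mem_nhds hxW'] with y h2 hy i
    ext w
    obtain ⟨u, rfl⟩ : ∃ u, S.field u y = w := ⟨_, S.field_coord y (hΘ.subset hy.1) w⟩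
    rw [hΘ.D_apply hy.1 (Filter.Eventually.of_forall (he i))]
    have h3 : (fun j => f i j y) = s (Pi.single i 1) (S.coord y) :=
      funext fun j => h2.self_of_nhds i j
    have h4 : ∀ m, mvfderiv 𝓘(ℝ, B) (f i m) y (S.field u y) =
        -(Θ y u (s (Pi.single i 1) (S.coord y)) m) := by
      intro m
      let Λ := ContinuousLinearMap.proj (R := ℝ) (φ := fun _ : Fin (finrank ℝ K.Model) => ℝ) m
      have h5 := Λ.hasFDerivAt.comp (S.coord y) (hs2 (Pi.single i 1) _ hy.2)
      have h6 : (f i m : M → ℝ) =ᶠ[𝓝 y] fun y => (Λ ∘ s (Pi.single i 1)) (S.coord y) := by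
        filter_upwards [h2] with y' h7
        exact h7 i m
      rw [mvfderiv_congr h6, mvfderiv_comp_apply' (B := B) h5.differentiableAt
        (S.coord.contMDiff.contMDiffAt.mdifferentiableAt (by simp)), h5.fderiv,
        S.coord_field _ (hΘ.subset hy.1)]
      change -(Θ (φ.symm (S.coord y)) u _ m) = _
      rw [hΘc y hy.1]
    rw [h3]
    simp [h4]
  obtain ⟨N, hN, hNo, hxN⟩ := eventually_nhds_iff.1 (hli.and hpar)
  exact ⟨N, e, hxN, hNo, fun y hy => (hN y hy).1, fun i y hy => (hN y hy).2 i⟩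

end RelConn
end LocalParallel
end

/-! ### Global solutions, ranks and the trivializing bundle map -/

noncomputable section

section Global

variable {B : Type uB} [NormedAddCommGroup B] [NormedSpace ℝ B]
  {M : Type uM} [TopologicalSpace M] [ChartedSpace B M] [IsManifold 𝓘(ℝ, B) ∞ M]

/-- The identity bundle map. -/
def VBHom.id (F : SmoothVB.{uB, uM, v, w} B M) : VBHom F F where
  app _ := LinearMap.id
  smooth := contMDiff_id

/-- The composition of bundle maps. -/
def VBHom.comp {K F E : SmoothVB.{uB, uM, v, w} B M} (ψ : VBHom F E) (φ : VBHom K F) :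
    VBHom K E where
  app x := (ψ.app x).comp (φ.app x)
  smooth := ψ.smooth.comp φ.smooth

/-- The bundle map `(x, a) ↦ ∑ aᵢ sᵢ(x)` determined by finitely many sections. -/
def Sect.framing {F : SmoothVB.{uB, uM, v, w} B M} {r : ℕ} (s : Fin r → Sect F) :
    VBHom (trivialVB B M (Fin r → ℝ)) F where
  app x := Fintype.linearCombination ℝ (fun i => s i x)
  smooth := by
    intro q₀
    refine contMDiffAt_totalSpace.2 ⟨contMDiff_proj _ |>.contMDiffAt, ?_⟩
    have hq₀ := FiberBundle.mem_baseSet_trivializationAt' (F := F.Model) (E := F.Fiber) q₀.1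
    have h1 : ∀ i, ContMDiffAt (𝓘(ℝ, B).prod 𝓘(ℝ, Fin r → ℝ)) 𝓘(ℝ, ℝ) ∞
        (fun q : TotalSpace (Fin r → ℝ) (Bundle.Trivial M (Fin r → ℝ)) =>
          (show Fin r → ℝ from q.2) i) q₀ := fun i => by
      have h2 : ContMDiffAt (𝓘(ℝ, B).prod 𝓘(ℝ, Fin r → ℝ)) 𝓘(ℝ, Fin r → ℝ) ∞
          (fun q : TotalSpace (Fin r → ℝ) (Bundle.Trivial M (Fin r → ℝ)) =>
            (show Fin r → ℝ from q.2)) q₀ :=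
        (contMDiffAt_totalSpace.1 (contMDiffAt_id (x := q₀)
          (I := 𝓘(ℝ, B).prod 𝓘(ℝ, Fin r → ℝ)) (n := ∞))).2
      exact (ContinuousLinearMap.proj (R := ℝ) (φ := fun _ : Fin r => ℝ)
        i).contMDiff.contMDiffAt.comp q₀ h2
    have h3 : ∀ i, ContMDiffAt (𝓘(ℝ, B).prod 𝓘(ℝ, Fin r → ℝ)) 𝓘(ℝ, F.Model) ∞
        (fun q : TotalSpace (Fin r → ℝ) (Bundle.Trivial M (Fin r → ℝ)) =>
          (trivializationAt F.Model F.Fiber q₀.1 ⟨q.1, s i q.1⟩).2) q₀ := fun i =>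
      ((contMDiffAt_section q₀.1).1 (s i).contMDiff.contMDiffAt).comp q₀
        (contMDiff_proj _ |>.contMDiffAt)
    refine (ContMDiffAt.sum (t := Finset.univ) fun i _ =>
      (h1 i).smul (h3 i)).congr_of_eventuallyEq ?_
    have hc : ContinuousAt (fun q : TotalSpace (Fin r → ℝ) (Bundle.Trivial M (Fin r → ℝ)) => q.1)
      q₀ := (FiberBundle.continuous_proj _ _).continuousAt
    filter_upwards [hc.preimage_mem_nhds
      ((trivializationAt F.Model F.Fiber q₀.1).open_baseSet.mem_nhds hq₀)] with q hq
    have h4 : ∀ e, (trivializationAt F.Model F.Fiber q₀.1 ⟨q.1, e⟩).2 =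
      (trivializationAt F.Model F.Fiber q₀.1).linearEquivAt ℝ q.1 hq e := fun e => rfl
    simp only [h4, Fintype.linearCombination_apply, map_sum, map_smul]
    exact Finset.sum_congr rfl fun i _ => rfl

theorem Sect.framing_apply {F : SmoothVB.{uB, uM, v, w} B M} {r : ℕ} (s : Fin r → Sect F) (x : M)
    (a : Fin r → ℝ) : (Sect.framing s).app x a = ∑ i, a i • s i x := rfl

/-- The components of a section of a trivial bundle. -/
def Sect.component {r : ℕ} (α : Sect (trivialVB B M (Fin r → ℝ))) (i : Fin r) :
    C^∞⟮𝓘(ℝ, B), M; 𝓘(ℝ, ℝ), ℝ⟯ where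
  val x := (show Fin r → ℝ from α x) i
  property := (ContinuousLinearMap.proj (R := ℝ) (φ := fun _ : Fin r => ℝ) i).contMDiff.comp
    (trivialSect_contMDiff (Fin r → ℝ) α)

theorem Sect.framing_map {F : SmoothVB.{uB, uM, v, w} B M} {r : ℕ} (s : Fin r → Sect F)
    (α : Sect (trivialVB B M (Fin r → ℝ))) :
    (Sect.framing s).map α = ∑ i, (s i).smulFun (α.component i) := by
  ext x
  rw [Sect.sum_apply]
  rfl

theorem mem_Sol_flatConn_iff {V : Type v} [NormedAddCommGroup V] [NormedSpace ℝ V]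
    [FiniteDimensional ℝ V] [PreconnectedSpace M] {α : Sect (trivialVB B M V)} :
    α ∈ (flatConn B M V).Sol ↔ ∃ c : V, ∀ x, α x = c := by
  constructor
  · intro h
    have h1 : ∀ x, mvfderiv 𝓘(ℝ, B) (fun y => (α y : V)) x = 0 := fun x =>
      congrArg (fun η : OneForm (trivialVB B M V) => η x) h
    have h2 : IsLocallyConstant (fun y => (α y : V)) := (IsLocallyConstant.iff_eventually_eq _).2
      fun x => eventually_eq_of_mvfderiv_eq_zero (B := B) (Filter.Eventually.of_forall fun y =>
        ⟨(trivialSect_contMDiff V α).mdifferentiable (by simp) y, h1 y⟩)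
    by_cases hM : Nonempty M
    · obtain ⟨x₀⟩ := hM
      exact ⟨α x₀, fun x => h2.apply_eq_of_preconnectedSpace x x₀⟩
    · exact ⟨0, fun x => (hM ⟨x⟩).elim⟩
  · rintro ⟨c, hc⟩
    rw [RelConn.Sol, LinearMap.mem_ker]
    ext1 x
    have h3 : (fun y => (α y : V)) = fun _ => c := funext hc
    change mvfderiv 𝓘(ℝ, B) (fun y => (α y : V)) x = 0
    rw [h3]
    exact mvfderiv_const c

variable [FiniteDimensional ℝ B] [T2Space M]

theorem Sect.mvfderiv_component {r : ℕ} (α : Sect (trivialVB B M (Fin r → ℝ))) (i : Fin r) (x : M)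
    (u : TangentSpace 𝓘(ℝ, B) x) : mvfderiv 𝓘(ℝ, B) (α.component i) x u =
      (show Fin r → ℝ from (flatConn B M (Fin r → ℝ)).D α x u) i := by
  have h := mvfderiv_comp_apply' (B := B)
    (f := ContinuousLinearMap.proj (R := ℝ) (φ := fun _ : Fin r => ℝ) i)
    (g := fun y => (α y : Fin r → ℝ)) (x := x) (ContinuousLinearMap.differentiableAt _)
    ((trivialSect_contMDiff (Fin r → ℝ) α).mdifferentiable (by simp) x) u
  rw [ContinuousLinearMap.fderiv] at h
  exact h

namespace RelConn

section

variable {F : SmoothVB.{uB, uM, v, w} B M} {E : SmoothVB.{uB, uM, v₂, w₂} B M} {D : RelConn F E}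

/-- As `D sᵢ = 0`, the Leibniz rule leaves only `∑ dαᵢ · l(sᵢ)`. -/
theorem isFlatMorphism_framing {r : ℕ} {s : Fin r → Sect F} (hs : ∀ i, s i ∈ D.Sol) :
    IsFlatMorphism (Sect.framing s) D := by
  intro α x u
  have h1 : ∀ᶠ y in 𝓝 x, (Sect.framing s).map α y = ∑ i, α.component i y • s i y :=
    Filter.Eventually.of_forall fun y => rfl
  have hs' : ∀ i, D.D (s i) = 0 := hs
  rw [D.D_apply_of_eventuallyEq_sum h1, Sect.framing_apply, map_sum]
  refine Finset.sum_congr rfl fun i _ => ?_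
  rw [map_smul, Sect.mvfderiv_component, hs']
  simp

theorem bijOn_framing [PreconnectedSpace M] {r : ℕ} (σ : Basis (Fin r) ℝ D.Sol) :
    Set.BijOn (Sect.framing (fun i => (σ i : Sect F))).map (flatConn B M (Fin r → ℝ)).Sol D.Sol := by
  have hconst : ∀ (α : Sect (trivialVB B M (Fin r → ℝ))) (c : Fin r → ℝ), (∀ x, α x = c) →
      (Sect.framing (fun i => (σ i : Sect F))).map α = (∑ i, c i • σ i : D.Sol) := by
    intro α c hc
    ext x
    have h1 : ((∑ i, c i • σ i : D.Sol) : Sect F) = ∑ i, c i • (σ i : Sect F) := by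
      simp
    rw [h1, Sect.sum_smul_apply, VBHom.map_apply, hc, Sect.framing_apply]
  refine ⟨fun α hα => ?_, fun α hα α' hα' h => ?_, fun t ht => ?_⟩
  · obtain ⟨c, hc⟩ := mem_Sol_flatConn_iff.1 hα
    rw [hconst α c hc]
    exact Subtype.coe_prop _
  · obtain ⟨c, hc⟩ := mem_Sol_flatConn_iff.1 hα
    obtain ⟨c', hc'⟩ := mem_Sol_flatConn_iff.1 hα'
    rw [hconst α c hc, hconst α' c' hc'] at h
    have h2 : σ.equivFun.symm c = σ.equivFun.symm c' := by
      rw [Basis.equivFun_symm_apply, Basis.equivFun_symm_apply]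
      exact Subtype.ext h
    have h3 := σ.equivFun.symm.injective h2
    ext1 x
    rw [hc, hc', h3]
  · let c := σ.equivFun ⟨t, ht⟩
    refine ⟨trivialSect (ContMDiffMap.const c), mem_Sol_flatConn_iff.2 ⟨c, fun x => rfl⟩, ?_⟩
    rw [hconst _ c fun x => rfl]
    exact congrArg Subtype.val (σ.sum_equivFun ⟨t, ht⟩)

theorem surjective_framing {r : ℕ} (σ : Basis (Fin r) ℝ D.Sol)
    (hD : ∀ x (e : F.Fiber x), ∃ s ∈ D.Sol, s x = e) (x : M) :
    Function.Surjective ((Sect.framing (fun i => (σ i : Sect F))).app x) := by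
  intro e
  obtain ⟨s, hs, rfl⟩ := hD x e
  refine ⟨σ.equivFun ⟨s, hs⟩, ?_⟩
  rw [Sect.framing_apply, ← Sect.sum_smul_apply]
  have h1 := congrArg Subtype.val (σ.sum_equivFun ⟨s, hs⟩)
  rw [AddSubmonoidClass.coe_finsetSum] at h1
  exact congrArg (fun t : Sect F => t x) h1

end

section

variable {F E : SmoothVB.{uB, uM, v, w} B M} {D : RelConn F E}

/-- Solutions of a prolongation correspond to solutions of the original relative connection. -/
theorem IsProlongation.exists_projection {k : ℕ} {F' E' : SmoothVB.{uB, uM, v, w} B M}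
    {D' : RelConn F' E'} (h : D.IsProlongation k D') :
    ∃ φ : VBHom F' F, (∀ x, Function.Surjective (φ.app x)) ∧ Set.BijOn φ.map D'.Sol D.Sol := by
  induction h with
  | zero => exact ⟨VBHom.id F, fun x => Function.surjective_id, Set.bijOn_id _⟩
  | @succ k F' E' K D' D₁ _ h ih =>
    obtain ⟨φ, h1, h2⟩ := ih
    obtain ⟨Φ, hΦ⟩ := h
    have h5 : Set.BijOn D₁.l.map D₁.Sol D'.Sol := by
      refine ⟨?_, ?_, ?_⟩
      · exact fun σ hσ => map_mem_Sol hΦ hσ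
      · intro σ hσ τ hτ hst
        have h3 : D₁.l.map (σ - τ) = 0 := by
          have := D₁.l.mapₗ.map_sub σ τ
          exact this.trans (sub_eq_zero.2 hst)
        exact sub_eq_zero.1 (eq_zero_of_map_eq_zero hΦ (D₁.Sol.sub_mem hσ hτ) h3)
      · intro s hs
        obtain ⟨σ, h3, h4⟩ := exists_mem_Sol_map_eq hΦ hs
        exact ⟨σ, h3, h4⟩
    exact ⟨φ.comp D₁.l, fun x => (h1 x).comp (D₁.surj x), (h2.comp h5).congr fun s _ => rfl⟩

/-- The kernel of the map `l` of `D⁽ᵏ⁾` has the dimension of `𝔤⁽ᵏ⁾(D) = 0`. -/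
theorem IsProlongation.injective_of_isOrder {k : ℕ} {F' E' : SmoothVB.{uB, uM, v, w} B M}
    {D' : RelConn F' E'} (h : D.IsProlongation k D') (hk : D.IsOrder k) (x : M) :
    Function.Injective (D'.l.app x) := by
  have h1 := finrank_symbolProl_of_isProlongation h x 0
  have h2 : finrank ℝ (D.symbolProl x (0 + k)) = 0 := by
    rw [zero_add, hk.1 x]
    exact finrank_bot ℝ _
  rw [h2, finrank_symbolProl_zero] at h1
  -- Needed because `finrank` is also zero for infinite-dimensional spaces.
  have := F'.finiteDimensional_fiber x
  exact LinearMap.ker_eq_bot.1 (Submodule.finrank_eq_zero.1 h1)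

/-- The rank formula sums `𝔤⁽ⁱ⁾` over `1 ≤ i ≤ k`; the last term vanishes when `k > 0`, and for `k =
0` both sums are empty. -/
theorem IsProlongation.finrank_eq {k : ℕ} {F' E' : SmoothVB.{uB, uM, v, w} B M}
    {D' : RelConn F' E'} (h : D.IsProlongation k D') (hk : D.IsOrder k) (x : M) :
    finrank ℝ F'.Model = finrank ℝ (F.Fiber x) +
      ∑ i ∈ Finset.Ico 1 k, finrank ℝ (D.symbolProl x i) := by
  rw [← F'.finrank_fiber x, finrank_fiber_of_isProlongation h x]
  congr 1
  rcases Nat.eq_zero_or_pos k with rfl | hk0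
  · simp
  · have h2 : finrank ℝ (D.symbolProl x k) = 0 := by
      rw [hk.1 x]
      exact finrank_bot ℝ _
    rw [Finset.range_eq_Ico, Finset.sum_Ico_add' (fun i => finrank ℝ (D.symbolProl x i)) 0 k 1,
      zero_add, Finset.sum_Ico_succ_top hk0, h2, add_zero]

end

/-- Over a simply connected manifold, solutions of a flat connection relative to an isomorphism are
determined by their value at a point, which is arbitrary. -/
theorem exists_linearEquiv_Sol [SimplyConnectedSpace M]
    {K : SmoothVB.{uB, uM, v₁, w₁} B M} {E : SmoothVB.{uB, uM, v₂, w₂} B M} {D : RelConn K E}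
    (hl : ∀ x, Function.Injective (D.l.app x)) (hP : D.ProlSurjective) (x : M) :
    ∃ e : D.Sol ≃ₗ[ℝ] K.Fiber x, ∀ s, e s = (s : Sect K) x := by
  refine ⟨LinearEquiv.ofBijective ((Sect.evalAt x).comp D.Sol.subtype) ⟨?_, ?_⟩, fun s => rfl⟩
  · refine (injective_iff_map_eq_zero _).2 fun s hs => Subtype.ext ?_
    exact eq_zero_of_mem_Sol hl (exists_isParallelFrame hl hP) s.2 (x₀ := x) hs
  · intro e
    obtain ⟨s, hs, hse⟩ := exists_mem_Sol_apply_eq hl (exists_isParallelFrame hl hP) x e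
    exact ⟨⟨s, hs⟩, hse⟩

/-- Solutions of `D'` are identified with a fibre of `F'` by evaluation and with solutions of `D` by
projection. A vector of `F` is lifted to `F'`, extended to a solution there and projected back. -/
theorem IsProlongation.exists_basis_Sol [SimplyConnectedSpace M]
    {F E : SmoothVB.{uB, uM, v, w} B M} {D : RelConn F E} {k : ℕ}
    {F' E' : SmoothVB.{uB, uM, v, w} B M} {D' : RelConn F' E'} (h : D.IsProlongation k D')
    (hk : D.IsOrder k) (hP : D'.ProlSurjective) :
    Nonempty (Basis (Fin (finrank ℝ F'.Model)) ℝ D.Sol) ∧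
      ∀ x (e : F.Fiber x), ∃ s ∈ D.Sol, s x = e := by
  have hl := h.injective_of_isOrder hk
  obtain ⟨φ, h1, h2⟩ := h.exists_projection
  refine ⟨?_, fun x e => ?_⟩
  · obtain ⟨x₀⟩ : Nonempty M := inferInstance
    obtain ⟨ε, -⟩ := exists_linearEquiv_Sol hl hP x₀
    let τ : D'.Sol ≃ₗ[ℝ] D.Sol := LinearEquiv.ofBijective
      (φ.mapₗ.restrict (fun s hs => h2.mapsTo hs))
      ⟨fun s t hst => Subtype.ext (h2.injOn s.2 t.2 (congrArg Subtype.val hst)), fun t => by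
        obtain ⟨s, hs, hst⟩ := h2.surjOn t.2
        exact ⟨⟨s, hs⟩, Subtype.ext hst⟩⟩
    have := F'.finiteDimensional_fiber x₀
    exact ⟨(finBasisOfFinrankEq ℝ _ (F'.finrank_fiber x₀)).map (ε.symm.trans τ)⟩
  · obtain ⟨e', rfl⟩ := h1 x e
    obtain ⟨ε, hε⟩ := exists_linearEquiv_Sol hl hP x
    refine ⟨φ.map (ε.symm e' : D'.Sol), h2.mapsTo (ε.symm e').2, ?_⟩
    rw [VBHom.map_apply, ← hε, LinearEquiv.apply_symm_apply]

end RelConn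
end Global
end

/-! ### Lie algebroids, Spencer operators and the action algebroid -/

noncomputable section

section Algebroid

variable {B : Type uB} [NormedAddCommGroup B] [NormedSpace ℝ B] [FiniteDimensional ℝ B]
  {M : Type uM} [TopologicalSpace M] [ChartedSpace B M] [IsManifold 𝓘(ℝ, B) ∞ M]

theorem LieBracketOn.skew {L : Type*} [AddCommGroup L] [Module ℝ L] (b : LieBracketOn L) (x y : L) :
    b.br x y = -b.br y x := by
  have h := b.self (x + y)
  simp only [map_add, LinearMap.add_apply, b.self, zero_add, add_zero] at h
  exact eq_neg_of_add_eq_zero_right h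

/-- The bracket on a subspace closed under the bracket. -/
def LieBracketOn.restrict {L : Type*} [AddCommGroup L] [Module ℝ L] (b : LieBracketOn L)
    (p : Submodule ℝ L) (hp : ∀ x ∈ p, ∀ y ∈ p, b.br x y ∈ p) : LieBracketOn p where
  br := LinearMap.mk₂ ℝ (fun x y => ⟨b.br x y, hp x x.2 y y.2⟩)
    (fun x x' y => Subtype.ext (by simp)) (fun c x y => Subtype.ext (by simp))
    (fun x y y' => Subtype.ext (by simp)) (fun c x y => Subtype.ext (by simp))
  self x := Subtype.ext (b.self x)
  jacobi x y z := Subtype.ext (b.jacobi x y z)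

/-- The bracket transported along a linear equivalence. -/
def LieBracketOn.transport {L L' : Type*} [AddCommGroup L] [Module ℝ L] [AddCommGroup L']
    [Module ℝ L'] (b : LieBracketOn L) (e : L ≃ₗ[ℝ] L') : LieBracketOn L' where
  br := LinearMap.mk₂ ℝ (fun x y => e (b.br (e.symm x) (e.symm y)))
    (fun x x' y => by simp) (fun c x y => by simp) (fun x y y' => by simp) (fun c x y => by simp)
  self x := by simp [b.self]
  jacobi x y z := by
    simp only [LinearMap.mk₂_apply, LinearEquiv.symm_apply_apply, ← map_add]
    rw [b.jacobi]

namespace LieAlgebroid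

variable {A : SmoothVB.{uB, uM, v, w} B M} (S : LieAlgebroid A)

theorem br_smulFun (α β : Sect A) (f : C^∞⟮𝓘(ℝ, B), M; 𝓘(ℝ, ℝ), ℝ⟯) :
    S.lie.br α (β.smulFun f) =
      (S.lie.br α β).smulFun f + β.smulFun (dirDeriv (S.anchor.map α) f) := by
  ext x
  exact S.leibniz α β f x

theorem br_sum_smulFun {ι : Type*} [Fintype ι] (α : Sect A) (b : ι → Sect A)
    (f : ι → C^∞⟮𝓘(ℝ, B), M; 𝓘(ℝ, ℝ), ℝ⟯) (x : M) :
    S.lie.br α (∑ i, (b i).smulFun (f i)) x = ∑ i, (f i x • S.lie.br α (b i) x +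
      mvfderiv 𝓘(ℝ, B) (f i) x (S.anchor.app x (α x)) • b i x) := by
  rw [map_sum, Sect.sum_apply]
  exact Finset.sum_congr rfl fun i _ => S.leibniz α (b i) (f i) x

variable [T2Space M]

/-- The anchor of a Lie algebroid is compatible with the brackets. -/
theorem anchor_br (α β : Sect A) (x : M) :
    S.anchor.app x (S.lie.br α β x) = VectorField.mlieBracket 𝓘(ℝ, B)
      (fun y => S.anchor.app y (α y)) (fun y => S.anchor.app y (β y)) x := by
  by_cases hA : ∃ e : A.Fiber x, e ≠ 0
  · obtain ⟨e, he⟩ := hA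
    obtain ⟨γ, rfl⟩ := exists_sect_apply_eq e
    -- As for vector fields, the Jacobi identity for `α, β, f γ` minus `f` times that for `α, β, γ`
    -- leaves a multiple of `γ x ≠ 0`, whose coefficient compares the two sides on `f`.
    have key : ∀ f : C^∞⟮𝓘(ℝ, B), M; 𝓘(ℝ, ℝ), ℝ⟯,
        mvfderiv 𝓘(ℝ, B) f x (S.anchor.app x (S.lie.br α β x)) =
          mvfderiv 𝓘(ℝ, B) f x (VectorField.mlieBracket 𝓘(ℝ, B)
            (fun y => S.anchor.app y (α y)) (fun y => S.anchor.app y (β y)) x) := by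
      intro f
      have h1 := mvfderiv_mlieBracket (S.anchor.map α) (S.anchor.map β) f x
      have h2 := congrArg (fun s : Sect A => s x) (S.lie.jacobi α β (γ.smulFun f))
      have h3 := congrArg (fun s : Sect A => s x) (S.lie.jacobi α β γ)
      simp only [br_smulFun, map_add, ContMDiffSection.coe_add, Pi.add_apply,
        Sect.smulFun_apply] at h2 h3
      rw [h3] at h2
      have h4 : (dirDeriv (S.anchor.map (S.lie.br α β)) f x -
          (dirDeriv (S.anchor.map α) (dirDeriv (S.anchor.map β) f) x -
            dirDeriv (S.anchor.map β) (dirDeriv (S.anchor.map α) f) x)) • γ x = 0 := by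
        linear_combination (norm := module) -h2
      have h5 := (smul_eq_zero.1 h4).resolve_right he
      rw [← h1, sub_eq_zero] at h5
      exact h5
    let b := finBasis ℝ (TangentSpace 𝓘(ℝ, B) x)
    refine b.ext_elem fun i => ?_
    obtain ⟨f, hf⟩ := exists_fun_mvfderiv_eq (B := B) (LinearMap.toContinuousLinearMap (b.coord i))
    have h := key f
    rw [hf] at h
    exact h
  · push Not at hA
    -- All fibres have the dimension of one model fibre, so a zero fibre at `x` makes `A` the zero
    -- bundle.
    have h0 : ∀ y, ∀ e : A.Fiber y, e = 0 := fun y e => by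
      have hx : Subsingleton (A.Fiber x) := ⟨fun a b => (hA a).trans (hA b).symm⟩
      have := A.finiteDimensional_fiber y
      have h1 : finrank ℝ (A.Fiber y) = 0 := by
        rw [A.finrank_fiber, ← A.finrank_fiber x]
        exact finrank_zero_of_subsingleton
      have := finrank_zero_iff.1 h1
      exact Subsingleton.elim _ _
    have h1 : ∀ α : Sect A, (fun y => S.anchor.app y (α y)) = 0 := fun α => funext fun y => by
      rw [h0 y (α y), map_zero]
      rfl
    rw [h1, h1, h0 x (S.lie.br α β x), map_zero]
    simp

end LieAlgebroid

namespace IsSpencerOperator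

variable [T2Space M] {A : SmoothVB.{uB, uM, v₁, w₁} B M}
  {E : SmoothVB.{uB, uM, v₂, w₂} B M} {S : LieAlgebroid A} {D : RelConn A E}

/-- When `D s = D t = 0`, every term in the compatibility formula for `D[s, t]` vanishes. -/
theorem br_mem_Sol (h : IsSpencerOperator S D) {s t : Sect A} (hs : s ∈ D.Sol) (ht : t ∈ D.Sol) :
    S.lie.br s t ∈ D.Sol := by
  obtain ⟨nabla, h1, h2⟩ := h.compatible
  have hs' : D.D s = 0 := hs
  have ht' : D.D t = 0 := ht
  -- `nabla` is not assumed linear; writing the zero section as `l(0)` brings it under the defining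
  -- formula.
  have h3 : ∀ (α : Sect A) (X : VField B M) (x : M),
      nabla α (OneForm.along (0 : OneForm E) X) x = 0 := fun α X x => by
    have h4 : OneForm.along (0 : OneForm E) X = D.l.map 0 := by
      ext y
      simp
    rw [h4, h1]
    simp
  rw [RelConn.Sol, LinearMap.mem_ker]
  ext x u
  obtain ⟨X, rfl⟩ := exists_vfield_apply_eq u
  rw [h2, hs', ht', h3, h3]
  simp

end IsSpencerOperator

namespace LieAlgebroid

variable [T2Space M] {A : SmoothVB.{uB, uM, v, w} B M}
  {E : SmoothVB.{uB, uM, v₂, w₂} B M} (S : LieAlgebroid A) {D : RelConn A E}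

/-- The infinitesimal action on the base of a finite-dimensional Lie algebra of sections, in
terms of a basis. -/
def infinitesimalAction {r : ℕ} {p : Submodule ℝ (Sect A)} (σ : Basis (Fin r) ℝ p)
    (hp : ∀ s ∈ p, ∀ t ∈ p, S.lie.br s t ∈ p) :
    InfinitesimalAction B M ((S.lie.restrict p hp).transport σ.equivFun) where
  act := S.anchor.mapₗ.comp (p.subtype.comp σ.equivFun.symm.toLinearMap)
  map_lie a b x := by
    -- A Lie algebra map because the anchor preserves brackets.
    have h := S.anchor_br (σ.equivFun.symm a : p) (σ.equivFun.symm b : p) x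
    refine Eq.trans ?_ h
    change S.anchor.app x (((σ.equivFun.symm (σ.equivFun _) : p) : Sect A) x) = _
    rw [LinearEquiv.symm_apply_apply]
    rfl

/-- On constant sections the brackets agree by construction. For variable coefficients, the Leibniz
rule in each argument of the bracket of `A` produces exactly the two derivative terms of the action
bracket. -/
theorem isActionMorphism_framing {r : ℕ} {p : Submodule ℝ (Sect A)} (σ : Basis (Fin r) ℝ p)
    (hp : ∀ s ∈ p, ∀ t ∈ p, S.lie.br s t ∈ p) :
    IsActionMorphism (S.infinitesimalAction σ hp) S (Sect.framing (fun i => (σ i : Sect A))) := by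
  have hσ : ∀ a : Fin r → ℝ, ((σ.equivFun.symm a : p) : Sect A) = ∑ i, a i • (σ i : Sect A) := by
    intro a
    rw [Basis.equivFun_symm_apply, AddSubmonoidClass.coe_finsetSum]
    rfl
  have happ : ∀ (a : Fin r → ℝ) x, (Sect.framing (fun i => (σ i : Sect A))).app x a =
      ((σ.equivFun.symm a : p) : Sect A) x := by
    intro a x
    rw [hσ, Sect.sum_smul_apply, Sect.framing_apply]
  have hanch : ∀ (x : M) (a : Fin r → ℝ), S.anchor.app x
      ((Sect.framing (fun i => (σ i : Sect A))).app x a) = (S.infinitesimalAction σ hp).act a x := by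
    intro x a
    rw [happ]
    rfl
  refine ⟨hanch, fun α β => ?_⟩
  ext x
  let ψ := S.infinitesimalAction σ hp
  let a : Fin r → ℝ := α x
  let b : Fin r → ℝ := β x
  have hα : S.anchor.app x ((Sect.framing (fun i => (σ i : Sect A))).map α x) = ψ.anchorSect α x :=
    hanch x a
  have hβ : S.anchor.app x ((Sect.framing (fun i => (σ i : Sect A))).map β x) = ψ.anchorSect β x :=
    hanch x b
  have hbr : (Sect.framing (fun i => (σ i : Sect A))).app x
      (((S.lie.restrict p hp).transport σ.equivFun).br a b) =
      ∑ j, b j • ∑ i, a i • S.lie.br (σ i) (σ j) x := by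
    rw [happ]
    change (((σ.equivFun.symm (σ.equivFun _) : p)) : Sect A) x = _
    rw [LinearEquiv.symm_apply_apply]
    change S.lie.br (σ.equivFun.symm a : p) (σ.equivFun.symm b : p) x = _
    rw [hσ, hσ, map_sum, Sect.sum_apply]
    refine Finset.sum_congr rfl fun j _ => ?_
    rw [map_smul, map_sum, LinearMap.sum_apply]
    refine congrArg (fun t : A.Fiber x => b j • t) ((Sect.sum_apply _ _ _).trans ?_)
    exact Finset.sum_congr rfl fun i _ => by rw [map_smul]; rfl
  -- The Leibniz rule is given for the second argument; skew-symmetry transfers it to the first,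
  -- which accounts for the minus sign.
  have hσj : ∀ j, S.lie.br ((Sect.framing (fun i => (σ i : Sect A))).map α) (σ j) x =
      ∑ i, a i • S.lie.br (σ i) (σ j) x -
        ∑ i, mvfderiv 𝓘(ℝ, B) (α.component i) x (S.anchor.app x ((σ j : Sect A) x)) •
          (σ i : Sect A) x := by
    intro j
    rw [S.lie.skew, ContMDiffSection.coe_neg, Pi.neg_apply, Sect.framing_map, br_sum_smulFun,
      Finset.sum_add_distrib, neg_add, ← sub_eq_add_neg, ← Finset.sum_neg_distrib]
    congr 1
    refine Finset.sum_congr rfl fun i _ => ?_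
    rw [S.lie.skew (σ j : Sect A), ContMDiffSection.coe_neg, Pi.neg_apply, smul_neg, neg_neg]
    rfl
  have hβ' : ψ.anchorSect β x = ∑ j, b j • S.anchor.app x ((σ j : Sect A) x) := by
    rw [← hβ, VBHom.map_apply, Sect.framing_apply, map_sum]
    exact Finset.sum_congr rfl fun j _ => map_smul _ _ _
  have hdα : ∑ j, b j • ∑ i, mvfderiv 𝓘(ℝ, B) (α.component i) x
      (S.anchor.app x ((σ j : Sect A) x)) • (σ i : Sect A) x =
      (Sect.framing (fun i => (σ i : Sect A))).app x
        ((flatConn B M (Fin r → ℝ)).D α x (ψ.anchorSect β x)) := by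
    simp only [Finset.smul_sum]
    rw [Finset.sum_comm, Sect.framing_apply]
    refine Finset.sum_congr rfl fun i _ => ?_
    refine Eq.trans ?_ (congrArg (· • (σ i : Sect A) x) (Sect.mvfderiv_component α i x _))
    rw [hβ', map_sum, Finset.sum_smul]
    exact Finset.sum_congr rfl fun j _ => by rw [map_smul, smul_smul]; rfl
  have hdβ : ∑ j, mvfderiv 𝓘(ℝ, B) (β.component j) x (ψ.anchorSect α x) • (σ j : Sect A) x =
      (Sect.framing (fun i => (σ i : Sect A))).app x
        ((flatConn B M (Fin r → ℝ)).D β x (ψ.anchorSect α x)) := by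
    rw [Sect.framing_apply]
    exact Finset.sum_congr rfl fun i _ =>
      congrArg (· • (σ i : Sect A) x) (Sect.mvfderiv_component β i x _)
  have hright : S.lie.br ((Sect.framing (fun i => (σ i : Sect A))).map α)
      ((Sect.framing (fun i => (σ i : Sect A))).map β) x =
      ∑ j, b j • ∑ i, a i • S.lie.br (σ i) (σ j) x -
        ∑ j, b j • ∑ i, mvfderiv 𝓘(ℝ, B) (α.component i) x
          (S.anchor.app x ((σ j : Sect A) x)) • (σ i : Sect A) x +
        ∑ j, mvfderiv 𝓘(ℝ, B) (β.component j) x (ψ.anchorSect α x) • (σ j : Sect A) x := by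
    rw [Sect.framing_map _ β, br_sum_smulFun, Finset.sum_add_distrib, hα, ← Finset.sum_sub_distrib]
    congr 1
    refine Finset.sum_congr rfl fun j _ => ?_
    rw [hσj, smul_sub]
    rfl
  rw [hright, hdα, hdβ, ← hbr, sub_add_eq_add_sub, ← map_add, ← map_sub]
  rfl

end LieAlgebroid
end Algebroid
end

theorem mainTheorem11 {B : Type uB} [NormedAddCommGroup B] [NormedSpace ℝ B]
    [FiniteDimensional ℝ B] {M : Type uM} [TopologicalSpace M] [ChartedSpace B M]
    [IsManifold 𝓘(ℝ, B) ∞ M] [T2Space M] [SecondCountableTopology M] [SimplyConnectedSpace M]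
    {F E : SmoothVB.{uB, uM, v, w} B M} (D : RelConn F E)
    (k : ℕ) (hk : D.IsOrder k)
    {Fk Ek : SmoothVB.{uB, uM, v, w} B M} (Dk : RelConn Fk Ek) (hDk : D.IsProlongation k Dk)
    (hsurj : Dk.ProlSurjective) :
    ∃ r : ℕ,
      (∀ x : M, r = finrank ℝ (F.Fiber x) + ∑ i ∈ Finset.Ico 1 k, finrank ℝ (D.symbolProl x i)) ∧
      FiniteDimensional ℝ D.Sol ∧ finrank ℝ D.Sol = r ∧
      (∃ p : VBHom (trivialVB B M (Fin r → ℝ)) F,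
        IsFlatMorphism p D ∧ (∀ x, Function.Surjective (p.app x)) ∧
        Set.BijOn p.map (flatConn B M (Fin r → ℝ)).Sol D.Sol) ∧
      ∀ S : LieAlgebroid F, IsSpencerOperator S D →
        (∀ s ∈ D.Sol, ∀ t ∈ D.Sol, S.lie.br s t ∈ D.Sol) ∧
        ∃ (L : LieBracketOn (Fin r → ℝ)) (ψ : InfinitesimalAction B M L)
          (p : VBHom (trivialVB B M (Fin r → ℝ)) F),
          IsActionMorphism ψ S p ∧ IsFlatMorphism p D ∧
          (∀ x, Function.Surjective (p.app x)) ∧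
          Set.BijOn p.map (flatConn B M (Fin r → ℝ)).Sol D.Sol := by
  obtain ⟨⟨σ⟩, hD⟩ := hDk.exists_basis_Sol hk hsurj
  have hflat := RelConn.isFlatMorphism_framing (D := D) (s := fun i => (σ i : Sect F))
    fun i => (σ i).2
  have hsur := RelConn.surjective_framing σ hD
  have hbij := RelConn.bijOn_framing σ
  refine ⟨finrank ℝ Fk.Model, hDk.finrank_eq hk, σ.finiteDimensional_of_finite,
    by simp [finrank_eq_card_basis σ], ⟨_, hflat, hsur, hbij⟩, fun S hS => ?_⟩
  have hcl : ∀ s ∈ D.Sol, ∀ t ∈ D.Sol, S.lie.br s t ∈ D.Sol := fun s hs t ht => hS.br_mem_Sol hs ht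
  -- The Lie algebra is the solution space in the coordinates of `σ`, and the bundle map is the one
  -- already used for the first part.
  exact ⟨hcl, _, S.infinitesimalAction σ hcl, _, S.isActionMorphism_framing σ hcl, hflat, hsur,
    hbij⟩
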